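/- Let $\mathbb K$ be a field, $G$ a finite group, and $A$ a $G$-Hopf algebra over $\mathbb K$. That is, $A$ is a Hopf algebra with a weak $G$-action $((\varphi_g)_{g\in G},(c_{g,h})_{g,h\in G})$ by Hopf algebra automorphisms $\varphi_g$ and invertible grouplike elements $c_{g,h}$ with $\varphi_g\varphi_h(a)=c_{g,h}\,\varphi_{gh}(a)\,c_{g,h}^{-1}$, $\varphi_g(c_{h,k})c_{g,hk}=c_{g,h}c_{gh,k}$, $c_{1,1}=1$, together with a decomposition $A=\bigoplus_g A_g$ as an algebra such that $\varphi_g(A_h)\subset A_{ghg^{-1}}$ and $\Delta(A_g)\subset\bigoplus_{pq=g}A_p\otimes A_q$. A $G$-weak Hopf algebra is defined in the same way, with a weak Hopf algebra $H$ in place of $A$ and $\Delta(c_{g,h})=(c_{g,h}\otimes c_{g,h})\Delta(1)$. For a $G$-(weak) Hopf algebra $H$ let $H\text{-mod}$ be the category of finite-dimensional right $H$-modules. It is a $G$-equivariant tensor category: $V\bar\otimes W=(V\otimes W)\Delta(1)$ is the tensor product, the tensor unit is the source counital subalgebra $H_s$ with $z.h=\epsilon_s(zh)$, the module ${}^gV$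 is $V$ with $h$ acting as $\varphi_{g^{-1}}(h)$, the compositors ${}^g({}^hV)\cong{}^{gh}V$ are $v\mapsto v.c_{h^{-1},g^{-1}}$, and $(H\text{-mod})_g$ consists of the modules on which $H_h$ acts as zero for all $h\ne g$. A $G$-equivariant $R$-matrix is an element $R=R_1\otimes R_2\in H\otimes H$ with $\Delta(1)R=R$ and $(a\otimes 1)\,R\,(\mathrm{id}\otimes\varphi_{g^{-1}})(\Delta^{op}(1))=(a\otimes 1)R$ for all $g\in G$, $a\in H_g$ (both conditions are void if $H$ is a Hopf algebra), such that $v\otimes w\mapsto w.R_2\otimes v.R_1$, for $V\in(H\text{-mod})_g$, defines a $G$-braiding $V\bar\otimes W\cong{}^gW\bar\otimes V$ on $H\text{-mod}$. A $G$-twist is an invertible $\theta\in H$ such that $v\mapsto v.\theta^{-1}$ defines a $G$-twist $V\cong{}^gV$, $V\in(H\text{-mod})_g$, on $H\text{-mod}$. A $G$-(weak) ribbon algebra is a $G$-(weak) Hopf algebra with a $G$-equivariant $R$-matrix and a $G$-twist; then $H\text{-mod}$ is considered as a $G$-ribbon category with this $G$-braiding and this $G$-twist. Let $A^{str}=\mathbb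 K(G)\otimes A\otimes\mathbb K[G]$, with basis $(\delta_g)$ of $\mathbb K(G)$, with unit $\sum_g\delta_g\otimes1\otimes1$ and $$(\delta_g\otimes a\otimes h)(\delta_{g'}\otimes a'\otimes h')=\delta(gh',g')\,\delta_{g'}\otimes a\,\varphi_h(a')\,c_{h,h'}\otimes hh',$$ $$\Delta(\delta_g\otimes a\otimes h)=(\delta_g\otimes a_{(1)}\otimes h)\otimes(\delta_g\otimes a_{(2)}\otimes h),\qquad \epsilon(\delta_g\otimes a\otimes h)=\epsilon(a),$$ $$S(\delta_g\otimes a\otimes h)=\delta_{gh^{-1}}\otimes c_{h^{-1},h}^{-1}\varphi_{h^{-1}}(S(a))\otimes h^{-1},\qquad \varphi_k(\delta_g\otimes a\otimes h)=\delta_{kg}\otimes a\otimes h,$$ with all compositors $c_{g,h}=1$, and with the grading $(A^{str})_d=\bigoplus_{g,h\in G}\mathbb K\delta_g\otimes A_{k^{-1}dk}\otimes\mathbb Kh$, where $k=gh^{-1}$. This is a $G$-weak Hopf algebra with strict $G$-action. Let $F:A\text{-mod}\to A^{str}\text{-mod}$ be the functor $M\mapsto M\otimes\mathbb K[G]$,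 $f\mapsto f\otimes\mathrm{id}$, with action $(m\otimes k).(\delta_g\otimes a\otimes h)=\delta(kh,g)\,m.(\varphi_k(a)c_{k,h})\otimes g$. Statement. Suppose that $A$ is a $G$-ribbon algebra. Then there are a $G$-equivariant $R$-matrix and a $G$-twist which make the $G$-weak Hopf algebra $A^{str}$ a $G$-weak ribbon algebra, such that $F$ is an equivalence of $G$-ribbon categories. In detail: both module categories have left and right duals, so that they are $G$-ribbon categories; and $F$ is a $\mathbb K$-linear equivalence of categories, a tensor functor with $\eta_0:F(\mathbf 1)\cong\mathbf 1$, $\lambda\otimes k\mapsto\lambda\delta_k\otimes1\otimes1$, and $\eta_2:F(M)\bar\otimes F(N)\cong F(M\otimes N)$, $m\otimes k\otimes n\otimes k\mapsto m\otimes n\otimes k$; it preserves the gradings, it commutes with the $G$-actions through the coherent monoidal natural isomorphisms $\psi_g:F({}^gM)\cong{}^gF(M)$, $m\otimes k\mapsto m.c_{g^{-1},k}\otimes g^{-1}k$, and it carries the $G$-braiding and the $G$-twist of $A\text{-mod}$ to those of $A^{str}\text{-mod}$. -/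

import Mathlib

open CategoryTheory MonoidalCategory TensorProduct Coalgebra

universe u

set_option linter.unusedVariables false
set_option linter.unusedSectionVars false
set_option linter.deprecated false

namespace GHopf

noncomputable section

/-- A weak bialgebra over a field: an algebra and coalgebra whose coproduct is multiplicative
(but not necessarily unital), with the weak (co)unit axioms
`(Δ ⊗ id)Δ(1) = (Δ(1) ⊗ 1)(1 ⊗ Δ(1)) = (1 ⊗ Δ(1))(Δ(1) ⊗ 1)` and
`ε(xyz) = ε(x y₁) ε(y₂ z) = ε(x y₂) ε(y₁ z)`. -/
class WeakBialgebra (K H : Type u) [Field K] [Ring H] [Algebra K H] [Coalgebra K H] : Prop where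
  comul_mul (x y : H) : comul (R := K) (x * y) = comul (R := K) x * comul (R := K) y
  comul_one_left :
    TensorProduct.assoc K H H H ((comul (R := K)).rTensor H (comul (R := K) (1 : H))) =
      TensorProduct.assoc K H H H (comul (R := K) (1 : H) ⊗ₜ[K] (1 : H)) *
        ((1 : H) ⊗ₜ[K] comul (R := K) (1 : H))
  comul_one_right :
    TensorProduct.assoc K H H H ((comul (R := K)).rTensor H (comul (R := K) (1 : H))) =
      ((1 : H) ⊗ₜ[K] comul (R := K) (1 : H)) *
        TensorProduct.assoc K H H H (comul (R := K) (1 : H) ⊗ₜ[K] (1 : H))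
  counit_mul_left (x y z : H) :
    counit (R := K) (x * y * z) =
      LinearMap.mul' K K (TensorProduct.map (counit (R := K)) (counit (R := K))
        ((x ⊗ₜ[K] (1 : H)) * comul (R := K) y * ((1 : H) ⊗ₜ[K] z)))
  counit_mul_right (x y z : H) :
    counit (R := K) (x * y * z) =
      LinearMap.mul' K K (TensorProduct.map (counit (R := K)) (counit (R := K))
        (((1 : H) ⊗ₜ[K] x) * comul (R := K) y * (z ⊗ₜ[K] (1 : H))))

section Counital

variable (K : Type u) {H : Type u} [Field K] [Ring H] [Algebra K H] [Coalgebra K H]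

/-- The target counital map `ε_t(h) = (ε ⊗ id)(Δ(1)(h ⊗ 1))`. -/
def counitalTarget : H →ₗ[K] H :=
  (TensorProduct.lid K H).toLinearMap ∘ₗ (counit (R := K)).rTensor H ∘ₗ
    LinearMap.mulLeft K (comul (R := K) (1 : H)) ∘ₗ (TensorProduct.mk K H H).flip 1

/-- The source counital map `ε_s(h) = (id ⊗ ε)((1 ⊗ h)Δ(1))`. -/
def counitalSource : H →ₗ[K] H :=
  (TensorProduct.rid K H).toLinearMap ∘ₗ (counit (R := K)).lTensor H ∘ₗ
    LinearMap.mulRight K (comul (R := K) (1 : H)) ∘ₗ TensorProduct.mk K H H 1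

end Counital

/-- A weak Hopf algebra: a weak bialgebra with an antipode `S` such that `h₁ S(h₂) = ε_t(h)`,
`S(h₁) h₂ = ε_s(h)` and `S(h₁) h₂ S(h₃) = S(h)`. -/
class WeakHopfAlgebra (K H : Type u) [Field K] [Ring H] [Algebra K H] [Coalgebra K H] extends
    WeakBialgebra K H where
  antipode : H →ₗ[K] H
  mul_antipode_right (h : H) :
    LinearMap.mul' K H (antipode.lTensor H (comul (R := K) h)) = counitalTarget K h
  mul_antipode_left (h : H) :
    LinearMap.mul' K H (antipode.rTensor H (comul (R := K) h)) = counitalSource K h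
  antipode_mul_antipode (h : H) :
    LinearMap.mul' K H (TensorProduct.map antipode
      (LinearMap.mul' K H ∘ₗ antipode.lTensor H ∘ₗ comul (R := K)) (comul (R := K) h)) =
      antipode h

section Identities

variable {K : Type u} {H : Type u} [Field K] [Ring H] [Algebra K H] [Coalgebra K H]

/-- The functional `ε(z ·)`. -/
def counitMul (K : Type u) {H : Type u} [Field K] [Ring H] [Algebra K H] [Coalgebra K H]
    (z : H) : H →ₗ[K] K :=
  counit (R := K) ∘ₗ LinearMap.mulLeft K z

@[simp]
theorem counitMul_apply (z h : H) : counitMul K z h = counit (R := K) (z * h) := rfl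

/-- Contraction of the left leg, `a ⊗ b ↦ f(a) b`. -/
def contractLeft {V W : Type u} [AddCommGroup V] [Module K V] [AddCommGroup W] [Module K W]
    (f : V →ₗ[K] K) : V ⊗[K] W →ₗ[K] W :=
  (TensorProduct.lid K W).toLinearMap ∘ₗ f.rTensor W

/-- Contraction of the right leg, `a ⊗ b ↦ f(b) a`. -/
def contractRight {V W : Type u} [AddCommGroup V] [Module K V] [AddCommGroup W] [Module K W]
    (f : W →ₗ[K] K) : V ⊗[K] W →ₗ[K] V :=
  (TensorProduct.rid K V).toLinearMap ∘ₗ f.lTensor V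

@[simp]
theorem contractLeft_tmul {V W : Type u} [AddCommGroup V] [Module K V] [AddCommGroup W]
    [Module K W] (f : V →ₗ[K] K) (v : V) (w : W) :
    contractLeft f (v ⊗ₜ[K] w) = f v • w := by simp [contractLeft]

@[simp]
theorem contractRight_tmul {V W : Type u} [AddCommGroup V] [Module K V] [AddCommGroup W]
    [Module K W] (f : W →ₗ[K] K) (v : V) (w : W) :
    contractRight f (v ⊗ₜ[K] w) = f w • v := by simp [contractRight]

theorem counitalSource_eq (z : H) :
    counitalSource K z = contractRight (counitMul K z) (comul (R := K) (1 : H)) := by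
  simp only [counitalSource, LinearMap.comp_apply, LinearMap.mulRight_apply, TensorProduct.mk_apply,
    contractRight, LinearEquiv.coe_coe]
  congr 1
  induction comul (R := K) (1 : H) using TensorProduct.induction_on with
  | zero => simp
  | add x y hx hy => simp only [mul_add, map_add, hx, hy]
  | tmul x y => simp

theorem contractLeft_counit_comul (h : H) : contractLeft (counit (R := K)) (comul (R := K) h) = h := by
  simp [contractLeft]

theorem contractRight_counit_comul (h : H) :
    contractRight (counit (R := K)) (comul (R := K) h) = h := by
  simp [contractRight]

theorem counitalSource_one : counitalSource K (1 : H) = 1 := by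
  rw [counitalSource_eq]
  have : counitMul K (1 : H) = counit (R := K) := by ext; simp
  rw [this, contractRight_counit_comul]

variable [WeakBialgebra K H]

theorem comul_one_mul (h : H) :
    comul (R := K) (1 : H) * comul (R := K) h = comul (R := K) h := by
  rw [← WeakBialgebra.comul_mul, one_mul]

theorem comul_mul_one (h : H) :
    comul (R := K) h * comul (R := K) (1 : H) = comul (R := K) h := by
  rw [← WeakBialgebra.comul_mul, mul_one]

theorem counit_contract_left (x y z : H) :
    counit (R := K) (x * y * z) = counit (R := K)
      (contractLeft (counitMul K x) (comul (R := K) y * ((1 : H) ⊗ₜ[K] z))) := by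
  rw [WeakBialgebra.counit_mul_left]
  induction comul (R := K) y using TensorProduct.induction_on with
  | zero => simp
  | add a b ha hb => simp only [mul_add, add_mul, map_add, ha, hb]
  | tmul a b => simp

theorem counit_contract_right (x y z : H) :
    counit (R := K) (x * y * z) = counit (R := K)
      (contractRight (counitMul K x) (comul (R := K) y * (z ⊗ₜ[K] (1 : H)))) := by
  rw [WeakBialgebra.counit_mul_right]
  induction comul (R := K) y using TensorProduct.induction_on with
  | zero => simp
  | add a b ha hb => simp only [mul_add, add_mul, map_add, ha, hb]
  | tmul a b => simp [mul_comm]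

/-- `ε(z h₁) h₂ = ε(z 1₁) 1₂ h`. -/
theorem contractLeft_comul (z h : H) :
    contractLeft (counitMul K z) (comul (R := K) h) =
      contractLeft (counitMul K z) (comul (R := K) (1 : H)) * h := by
  let Φ : H ⊗[K] (H ⊗[K] H) →ₗ[K] H :=
    contractLeft (counitMul K z) ∘ₗ (contractLeft (counit (R := K)) ∘ₗ
      LinearMap.mulRight K (comul (R := K) h)).lTensor H
  have h1 (T : H ⊗[K] H) : contractLeft (counitMul K z) (T * comul (R := K) h) =
      Φ (TensorProduct.assoc K H H H ((comul (R := K)).rTensor H T)) := by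
    simp only [Φ]
    generalize comul (R := K) h = S
    induction T using TensorProduct.induction_on with
    | zero => simp
    | add a b ha hb => simp only [add_mul, map_add, ha, hb]
    | tmul a b =>
      induction S using TensorProduct.induction_on with
      | zero => simp
      | add c d hc hd =>
        simp only [mul_add, map_add, hc, hd, LinearMap.comp_apply]
        rw [← map_add, ← LinearMap.add_apply, ← LinearMap.lTensor_add]
        congr 3
        ext; simp [mul_add]
      | tmul c d =>
        simp only [Algebra.TensorProduct.tmul_mul_tmul, contractLeft_tmul, counitMul_apply,
          LinearMap.rTensor_tmul, ← mul_assoc]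
        rw [counit_contract_left]
        induction comul (R := K) a using TensorProduct.induction_on with
        | zero => simp
        | add a b ha hb => simp only [add_mul, TensorProduct.add_tmul, add_smul, map_add, ha, hb]
        | tmul e f => simp [mul_smul, smul_comm (counit (R := K) (z * e))]
  have h2 (T : H ⊗[K] H) : Φ ((comul (R := K)).lTensor H T) =
      contractLeft (counitMul K z) T * h := by
    simp only [Φ]
    induction T using TensorProduct.induction_on with
    | zero => simp
    | add a b ha hb => simp only [add_mul, map_add, ha, hb]
    | tmul a b => simp [← WeakBialgebra.comul_mul, contractLeft_counit_comul]
  rw [← h2, ← Coalgebra.coassoc_apply, ← h1, comul_one_mul]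

/-- `h₁ ε(z h₂) = ε_s(z) h`. -/
theorem contractRight_comul (z h : H) :
    contractRight (counitMul K z) (comul (R := K) h) = counitalSource K z * h := by
  let Φ : (H ⊗[K] H) ⊗[K] H →ₗ[K] H :=
    contractRight (counitMul K z) ∘ₗ (contractRight (counit (R := K)) ∘ₗ
      LinearMap.mulRight K (comul (R := K) h)).rTensor H
  have h1 (T : H ⊗[K] H) : contractRight (counitMul K z) (T * comul (R := K) h) =
      Φ ((TensorProduct.assoc K H H H).symm ((comul (R := K)).lTensor H T)) := by
    simp only [Φ]
    generalize comul (R := K) h = S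
    induction T using TensorProduct.induction_on with
    | zero => simp
    | add a b ha hb => simp only [add_mul, map_add, ha, hb]
    | tmul a b =>
      induction S using TensorProduct.induction_on with
      | zero => simp
      | add c d hc hd =>
        simp only [mul_add, map_add, hc, hd, LinearMap.comp_apply]
        rw [← map_add, ← LinearMap.add_apply, ← LinearMap.rTensor_add]
        congr 3
        ext; simp [mul_add]
      | tmul c d =>
        simp only [Algebra.TensorProduct.tmul_mul_tmul, contractRight_tmul, counitMul_apply,
          LinearMap.lTensor_tmul, ← mul_assoc]
        rw [counit_contract_right]
        induction comul (R := K) b using TensorProduct.induction_on with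
        | zero => simp
        | add a b ha hb => simp only [add_mul, TensorProduct.tmul_add, add_smul, map_add, ha, hb]
        | tmul e f => simp [mul_smul]
  have h2 (T : H ⊗[K] H) : Φ ((comul (R := K)).rTensor H T) =
      contractRight (counitMul K z) T * h := by
    simp only [Φ]
    induction T using TensorProduct.induction_on with
    | zero => simp
    | add a b ha hb => simp only [add_mul, map_add, ha, hb]
    | tmul a b => simp [← WeakBialgebra.comul_mul, contractRight_counit_comul]
  rw [counitalSource_eq, ← h2, ← Coalgebra.coassoc_symm_apply, ← h1, comul_one_mul]

/-- `ε_s(h₁) ε(z h₂) = ε_s(z h)`. -/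
theorem counitalSource_contractRight (z h : H) :
    counitalSource K (contractRight (counitMul K z) (comul (R := K) h)) =
      counitalSource K (z * h) := by
  simp only [counitalSource_eq]
  generalize comul (R := K) (1 : H) = T
  induction T using TensorProduct.induction_on with
  | zero => simp
  | add a b ha hb => simp only [map_add, ha, hb]
  | tmul e f =>
    simp only [contractRight_tmul, counitMul_apply]
    rw [counit_contract_right]
    congr 2
    induction comul (R := K) h using TensorProduct.induction_on with
    | zero => simp
    | add a b ha hb => simp only [map_add, add_mul, ha, hb]
    | tmul e f => simp

/-- `ε(z h₁) ε_s(h₂) = ε_s(z h)`. -/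
theorem counitalSource_contractLeft (z h : H) :
    counitalSource K (contractLeft (counitMul K z) (comul (R := K) h)) =
      counitalSource K (z * h) := by
  simp only [counitalSource_eq]
  generalize comul (R := K) (1 : H) = T
  induction T using TensorProduct.induction_on with
  | zero => simp
  | add a b ha hb => simp only [map_add, ha, hb]
  | tmul e f =>
    simp only [contractRight_tmul, counitMul_apply]
    rw [counit_contract_left]
    congr 2
    induction comul (R := K) h using TensorProduct.induction_on with
    | zero => simp
    | add a b ha hb => simp only [map_add, add_mul, ha, hb]
    | tmul e f => simp

theorem counitalSource_mul (x b : H) :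
    counitalSource K (counitalSource K x * b) = counitalSource K (x * b) := by
  rw [← contractRight_comul, counitalSource_contractRight]

theorem counitalSource_idem (x : H) :
    counitalSource K (counitalSource K x) = counitalSource K x := by
  simpa using counitalSource_mul (K := K) x 1

theorem counit_counitalSource (x : H) :
    counit (R := K) (counitalSource K x) = counit (R := K) x := by
  have h := counit_contract_right (K := K) x 1 1
  rw [← Algebra.TensorProduct.one_def, mul_one, mul_one, mul_one, ← counitalSource_eq] at h
  exact h.symm

end Identities

/-! ### Finite-dimensional right modules -/

/-- A finite-dimensional right module over `H`: `act a v` is `v.a`. -/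
structure RMod (K H : Type u) [Field K] [Ring H] [Algebra K H] where
  carrier : Type u
  [addCommGroup : AddCommGroup carrier]
  [module : Module K carrier]
  [finite : FiniteDimensional K carrier]
  act : H →ₗ[K] Module.End K carrier
  act_one : act 1 = LinearMap.id
  act_mul (a b : H) : act (a * b) = act b ∘ₗ act a

namespace RMod

section Basic

variable {K H : Type u} [Field K] [Ring H] [Algebra K H]

instance : CoeSort (RMod K H) (Type u) := ⟨RMod.carrier⟩

attribute [instance] RMod.addCommGroup RMod.module RMod.finite

/-- The space of `H`-linear maps. -/
def homs (V W : RMod K H) : Submodule K (V →ₗ[K] W) where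
  carrier := {f | ∀ (a : H) (v : V), f (V.act a v) = W.act a (f v)}
  add_mem' hf hg a v := by
    have h1 := hf a v
    have h2 := hg a v
    simp_all
  zero_mem' a v := by simp
  smul_mem' c f hf a v := by
    have h1 := hf a v
    simp_all

/-- `H-mod`, the category of finite-dimensional right `H`-modules. -/
instance : Category (RMod K H) where
  Hom V W := homs V W
  id V := ⟨LinearMap.id, fun _ _ => rfl⟩
  comp f g := ⟨g.1 ∘ₗ f.1, fun a v =>
    (congrArg g.1 (f.2 a v)).trans (g.2 a (f.1 v))⟩

/-- The linear map underlying a morphism. -/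
def lin {V W : RMod K H} (f : V ⟶ W) : V →ₗ[K] W := Subtype.val (p := (· ∈ homs V W)) f

/-- Constructor for morphisms. -/
def ofLin {V W : RMod K H} (f : V →ₗ[K] W)
    (hf : ∀ (a : H) (v : V), f (V.act a v) = W.act a (f v)) : V ⟶ W :=
  (⟨f, hf⟩ : homs V W)

theorem lin_act {V W : RMod K H} (f : V ⟶ W) (a : H) (v : V) :
    lin f (V.act a v) = W.act a (lin f v) := Subtype.property (p := (· ∈ homs V W)) f a v

@[simp]
theorem lin_ofLin {V W : RMod K H} (f : V →ₗ[K] W)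
    (hf : ∀ (a : H) (v : V), f (V.act a v) = W.act a (f v)) : lin (ofLin f hf) = f := rfl

@[simp]
theorem lin_id (V : RMod K H) : lin (𝟙 V) = LinearMap.id := rfl

@[simp]
theorem lin_comp {U V W : RMod K H} (f : U ⟶ V) (g : V ⟶ W) :
    lin (f ≫ g) = lin g ∘ₗ lin f := rfl

theorem hom_ext {V W : RMod K H} {f g : V ⟶ W} (h : ∀ v, lin f v = lin g v) : f = g :=
  Subtype.ext (LinearMap.ext h)

instance : Preadditive (RMod K H) where
  homGroup V W := inferInstanceAs (AddCommGroup (homs V W))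
  add_comp U V W f f' g := hom_ext fun v => map_add (lin g) _ _
  comp_add U V W f g g' := rfl

@[simp]
theorem lin_add {V W : RMod K H} (f g : V ⟶ W) : lin (f + g) = lin f + lin g := rfl

@[simp]
theorem lin_zero {V W : RMod K H} : lin (0 : V ⟶ W) = 0 := rfl

instance : Linear K (RMod K H) where
  homModule V W := inferInstanceAs (Module K (homs V W))
  smul_comp U V W c f g := hom_ext fun v => map_smul (lin g) _ _
  comp_smul U V W f c g := rfl

@[simp]
theorem lin_smul {V W : RMod K H} (c : K) (f : V ⟶ W) : lin (c • f) = c • lin f := rfl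

/-- Constructor for isomorphisms. -/
def mkIso {V W : RMod K H} (f : V →ₗ[K] W) (g : W →ₗ[K] V) (hgf : ∀ v, g (f v) = v)
    (hfg : ∀ w, f (g w) = w) (hf : ∀ (a : H) (v : V), f (V.act a v) = W.act a (f v)) :
    V ≅ W where
  hom := ofLin f hf
  inv := ofLin g fun a w => by rw [← hfg w, ← hf, hgf, hgf]
  hom_inv_id := hom_ext hgf
  inv_hom_id := hom_ext hfg

@[simp]
theorem mkIso_hom {V W : RMod K H} (f : V →ₗ[K] W) (g : W →ₗ[K] V) (hgf : ∀ v, g (f v) = v)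
    (hfg : ∀ w, f (g w) = w) (hf : ∀ (a : H) (v : V), f (V.act a v) = W.act a (f v)) :
    lin (mkIso f g hgf hfg hf).hom = f := rfl

@[simp]
theorem mkIso_inv {V W : RMod K H} (f : V →ₗ[K] W) (g : W →ₗ[K] V) (hgf : ∀ v, g (f v) = v)
    (hfg : ∀ w, f (g w) = w) (hf : ∀ (a : H) (v : V), f (V.act a v) = W.act a (f v)) :
    lin (mkIso f g hgf hfg hf).inv = g := rfl

theorem act_one_apply (V : RMod K H) (v : V) : V.act 1 v = v := by rw [V.act_one]; rfl

theorem act_mul_apply (V : RMod K H) (a b : H) (v : V) :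
    V.act (a * b) v = V.act b (V.act a v) := by rw [V.act_mul]; rfl

/-- The right action of `H ⊗ H` on `V ⊗ W`: `(v ⊗ w).(a ⊗ b) = v.a ⊗ w.b`. -/
def act₂ (V W : RMod K H) : H ⊗[K] H →ₗ[K] Module.End K (V ⊗[K] W) :=
  TensorProduct.homTensorHomMap (.id K) V W V W ∘ₗ TensorProduct.map V.act W.act

@[simp]
theorem act₂_tmul (V W : RMod K H) (a b : H) :
    act₂ V W (a ⊗ₜ[K] b) = TensorProduct.map (V.act a) (W.act b) := rfl

theorem act₂_mul (V W : RMod K H) (S T : H ⊗[K] H) (x : V ⊗[K] W) :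
    act₂ V W (S * T) x = act₂ V W T (act₂ V W S x) := by
  induction S using TensorProduct.induction_on with
  | zero => simp
  | add S S' h h' => simp only [add_mul, map_add, LinearMap.add_apply, h, h']
  | tmul a b =>
    induction T using TensorProduct.induction_on with
    | zero => simp
    | add S S' h h' => simp only [mul_add, map_add, LinearMap.add_apply, h, h']
    | tmul c d => simp [TensorProduct.map_comp, act_mul]

theorem map_act₂ {V V' W W' : RMod K H} (f : V ⟶ V') (g : W ⟶ W') (T : H ⊗[K] H)
    (x : V ⊗[K] W) :
    TensorProduct.map (lin f) (lin g) (act₂ V W T x) =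
      act₂ V' W' T (TensorProduct.map (lin f) (lin g) x) := by
  induction T using TensorProduct.induction_on with
  | zero => simp
  | add S S' h h' => simp only [map_add, LinearMap.add_apply, h, h']
  | tmul a b =>
    induction x using TensorProduct.induction_on with
    | zero => simp
    | add S S' h h' => simp only [map_add, h, h']
    | tmul v w => simp [lin_act]

end Basic

section Tensor

variable {K H : Type u} [Field K] [Ring H] [Algebra K H] [Coalgebra K H]

/-- The vector space `V ⊗̄ W = (V ⊗ W)Δ(1)`. -/
abbrev truncated (V W : RMod K H) : Submodule K (V ⊗[K] W) :=
  LinearMap.range (act₂ V W (comul (R := K) 1))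

/-- The projection `V ⊗ W → V ⊗̄ W`, `x ↦ x.Δ(1)`. -/
def proj (V W : RMod K H) : V ⊗[K] W →ₗ[K] truncated V W :=
  (act₂ V W (comul (R := K) 1)).rangeRestrict

variable [WeakBialgebra K H]

/-- The tensor product `V ⊗̄ W` of right `H`-modules, with `x.h = x.Δ(h)`. -/
def tensor (V W : RMod K H) : RMod K H where
  carrier := truncated V W
  act :=
    { toFun := fun h => proj V W ∘ₗ act₂ V W (comul (R := K) h) ∘ₗ (truncated V W).subtype
      map_add' := fun a b => by simp [LinearMap.add_comp, LinearMap.comp_add]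
      map_smul' := fun a b => by simp [LinearMap.smul_comp, LinearMap.comp_smul] }
  act_one := by
    ext ⟨_, x, rfl⟩ : 2
    simp [proj, ← act₂_mul, comul_one_mul]
  act_mul a b := by
    ext x : 2
    simp [proj, ← act₂_mul, comul_mul_one, WeakBialgebra.comul_mul]

end Tensor

end RMod

namespace RMod

section Monoidal

variable {K H : Type u} [Field K] [Ring H] [Algebra K H] [Coalgebra K H] [WeakBialgebra K H]

/-- The inclusion `V ⊗̄ W → V ⊗ W`. -/
def incl (V W : RMod K H) : tensor V W →ₗ[K] V ⊗[K] W := (truncated V W).subtype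

/-- The projection `V ⊗ W → V ⊗̄ W`, as a map to the module `V ⊗̄ W`. -/
def pr (V W : RMod K H) : V ⊗[K] W →ₗ[K] tensor V W := proj V W

theorem incl_injective (V W : RMod K H) : Function.Injective (incl V W) := Subtype.val_injective

theorem incl_pr (V W : RMod K H) (x : V ⊗[K] W) :
    incl V W (pr V W x) = act₂ V W (comul (R := K) 1) x := rfl

@[simp]
theorem act₂_incl (V W : RMod K H) (x : tensor V W) :
    act₂ V W (comul (R := K) 1) (incl V W x) = incl V W x := by
  obtain ⟨_, x, rfl⟩ := x
  change act₂ V W (comul (R := K) 1) (act₂ V W (comul (R := K) 1) x) =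
    act₂ V W (comul (R := K) 1) x
  rw [← act₂_mul, comul_one_mul]

@[simp]
theorem pr_incl (V W : RMod K H) (x : tensor V W) : pr V W (incl V W x) = x :=
  incl_injective V W (by rw [incl_pr, act₂_incl])

theorem incl_act (V W : RMod K H) (a : H) (x : tensor V W) :
    incl V W ((tensor V W).act a x) = act₂ V W (comul (R := K) a) (incl V W x) := by
  change act₂ V W (comul (R := K) 1) (act₂ V W (comul (R := K) a) (incl V W x)) = _
  rw [← act₂_mul, comul_mul_one]

theorem pr_act₂ (V W : RMod K H) (a : H) (x : V ⊗[K] W) :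
    pr V W (act₂ V W (comul (R := K) a) x) = (tensor V W).act a (pr V W x) :=
  incl_injective V W (by
    rw [incl_pr, incl_act, incl_pr, ← act₂_mul, ← act₂_mul, comul_mul_one, comul_one_mul])

/-- The tensor product of morphisms. -/
def tmap {V V' W W' : RMod K H} (f : V ⟶ V') (g : W ⟶ W') : tensor V W ⟶ tensor V' W' :=
  ofLin (pr V' W' ∘ₗ TensorProduct.map (lin f) (lin g) ∘ₗ incl V W) fun a v => by
    simp only [LinearMap.comp_apply]
    rw [incl_act, map_act₂, pr_act₂]

theorem incl_tmap {V V' W W' : RMod K H} (f : V ⟶ V') (g : W ⟶ W') (x : tensor V W) :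
    incl V' W' (lin (tmap f g) x) = TensorProduct.map (lin f) (lin g) (incl V W x) := by
  change incl V' W' (pr V' W' (TensorProduct.map (lin f) (lin g) (incl V W x))) = _
  rw [incl_pr, ← map_act₂, act₂_incl]

/-- The underlying inclusion `(U ⊗̄ V) ⊗̄ W → U ⊗ (V ⊗ W)`. -/
def inclLeft (U V W : RMod K H) : tensor (tensor U V) W →ₗ[K] U ⊗[K] (V ⊗[K] W) :=
  (TensorProduct.assoc K U V W).toLinearMap ∘ₗ (incl U V).rTensor W ∘ₗ incl (tensor U V) W

/-- The underlying inclusion `U ⊗̄ (V ⊗̄ W) → U ⊗ (V ⊗ W)`. -/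
def inclRight (U V W : RMod K H) : tensor U (tensor V W) →ₗ[K] U ⊗[K] (V ⊗[K] W) :=
  (incl V W).lTensor U ∘ₗ incl U (tensor V W)

/-- The underlying projection `U ⊗ (V ⊗ W) → (U ⊗̄ V) ⊗̄ W`. -/
def prLeft (U V W : RMod K H) : U ⊗[K] (V ⊗[K] W) →ₗ[K] tensor (tensor U V) W :=
  pr (tensor U V) W ∘ₗ (pr U V).rTensor W ∘ₗ (TensorProduct.assoc K U V W).symm.toLinearMap

/-- The underlying projection `U ⊗ (V ⊗ W) → U ⊗̄ (V ⊗̄ W)`. -/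
def prRight (U V W : RMod K H) : U ⊗[K] (V ⊗[K] W) →ₗ[K] tensor U (tensor V W) :=
  pr U (tensor V W) ∘ₗ (pr V W).lTensor U

/-- The right action of `H ⊗ (H ⊗ H)` on `U ⊗ (V ⊗ W)`. -/
def act₃ (U V W : RMod K H) : H ⊗[K] (H ⊗[K] H) →ₗ[K] Module.End K (U ⊗[K] (V ⊗[K] W)) :=
  TensorProduct.homTensorHomMap (.id K) U (V ⊗[K] W) U (V ⊗[K] W) ∘ₗ
    TensorProduct.map U.act (act₂ V W)

@[simp]
theorem act₃_tmul (U V W : RMod K H) (a : H) (T : H ⊗[K] H) :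
    act₃ U V W (a ⊗ₜ[K] T) = TensorProduct.map (U.act a) (act₂ V W T) := rfl

theorem rTensor_pr_incl {M : Type u} [AddCommGroup M] [Module K M] (U V : RMod K H)
    (x : tensor U V ⊗[K] M) : (pr U V).rTensor M ((incl U V).rTensor M x) = x := by
  rw [← LinearMap.rTensor_comp_apply,
    show pr U V ∘ₗ incl U V = LinearMap.id from LinearMap.ext (pr_incl U V)]
  simp

theorem lTensor_pr_incl {M : Type u} [AddCommGroup M] [Module K M] (U V : RMod K H)
    (x : M ⊗[K] tensor U V) : (pr U V).lTensor M ((incl U V).lTensor M x) = x := by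
  rw [← LinearMap.lTensor_comp_apply,
    show pr U V ∘ₗ incl U V = LinearMap.id from LinearMap.ext (pr_incl U V)]
  simp

theorem rTensor_incl_injective {M : Type u} [AddCommGroup M] [Module K M] (U V : RMod K H) :
    Function.Injective ((incl U V).rTensor M) :=
  Function.LeftInverse.injective (rTensor_pr_incl U V)

theorem lTensor_incl_injective {M : Type u} [AddCommGroup M] [Module K M] (U V : RMod K H) :
    Function.Injective ((incl U V).lTensor M) :=
  Function.LeftInverse.injective (lTensor_pr_incl U V)

theorem prLeft_inclLeft (U V W : RMod K H) (x : tensor (tensor U V) W) :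
    prLeft U V W (inclLeft U V W x) = x := by
  simp [prLeft, inclLeft, rTensor_pr_incl]

theorem prRight_inclRight (U V W : RMod K H) (x : tensor U (tensor V W)) :
    prRight U V W (inclRight U V W x) = x := by
  simp [prRight, inclRight, lTensor_pr_incl]

theorem incl_act_pr (V W : RMod K H) (a : H) (x : V ⊗[K] W) :
    incl V W ((tensor V W).act a (pr V W x)) = act₂ V W (comul (R := K) a) x := by
  rw [incl_act, incl_pr, ← act₂_mul, comul_one_mul]

theorem inclLeft_prLeft (U V W : RMod K H) (x : U ⊗[K] (V ⊗[K] W)) :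
    inclLeft U V W (prLeft U V W x) = act₃ U V W
      (TensorProduct.assoc K H H H ((comul (R := K)).rTensor H (comul (R := K) 1))) x := by
  simp only [inclLeft, prLeft, LinearMap.comp_apply, incl_pr]
  generalize comul (R := K) (1 : H) = T
  induction T using TensorProduct.induction_on with
  | zero => simp
  | add S S' h h' => simp only [map_add, LinearMap.add_apply, h, h']
  | tmul a b =>
    obtain ⟨y, rfl⟩ := (TensorProduct.assoc K U V W).surjective x
    induction y using TensorProduct.induction_on with
    | zero => simp
    | add S S' h h' => simp only [map_add, h, h']
    | tmul y w =>
      simp only [LinearEquiv.coe_coe, LinearEquiv.symm_apply_apply, LinearMap.rTensor_tmul,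
        act₂_tmul, TensorProduct.map_tmul, incl_act_pr]
      induction comul (R := K) a using TensorProduct.induction_on with
      | zero => simp
      | add S S' h h' => simp only [TensorProduct.add_tmul, map_add, LinearMap.add_apply, h, h']
      | tmul c d =>
        induction y using TensorProduct.induction_on with
        | zero => simp
        | add S S' h h' => simp only [TensorProduct.add_tmul, map_add, h, h']
        | tmul u v => simp

theorem inclRight_prRight (U V W : RMod K H) (x : U ⊗[K] (V ⊗[K] W)) :
    inclRight U V W (prRight U V W x) = act₃ U V W
      ((comul (R := K)).lTensor H (comul (R := K) 1)) x := by
  simp only [inclRight, prRight, LinearMap.comp_apply, incl_pr]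
  generalize comul (R := K) (1 : H) = T
  induction T using TensorProduct.induction_on with
  | zero => simp
  | add S S' h h' => simp only [map_add, LinearMap.add_apply, h, h']
  | tmul a b =>
    induction x using TensorProduct.induction_on with
    | zero => simp
    | add S S' h h' => simp only [map_add, h, h']
    | tmul u y => simp [incl_act_pr]

theorem act₃_inclLeft (U V W : RMod K H) (x : tensor (tensor U V) W) :
    act₃ U V W ((comul (R := K)).lTensor H (comul (R := K) 1)) (inclLeft U V W x) =
      inclLeft U V W x := by
  rw [← Coalgebra.coassoc_apply, ← inclLeft_prLeft, prLeft_inclLeft]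

theorem act₃_inclRight (U V W : RMod K H) (x : tensor U (tensor V W)) :
    act₃ U V W ((comul (R := K)).lTensor H (comul (R := K) 1)) (inclRight U V W x) =
      inclRight U V W x := by
  rw [← inclRight_prRight, prRight_inclRight]

theorem inclLeft_act (U V W : RMod K H) (a : H) (x : tensor (tensor U V) W) :
    inclLeft U V W ((tensor (tensor U V) W).act a x) =
      act₃ U V W ((comul (R := K)).lTensor H (comul (R := K) a)) (inclLeft U V W x) := by
  rw [← Coalgebra.coassoc_apply]
  simp only [inclLeft, LinearMap.comp_apply, incl_act]
  generalize incl (tensor U V) W x = y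
  induction comul (R := K) a using TensorProduct.induction_on with
  | zero => simp
  | add S S' h h' => simp only [map_add, LinearMap.add_apply, h, h']
  | tmul a b =>
    induction y using TensorProduct.induction_on with
    | zero => simp
    | add S S' h h' => simp only [map_add, h, h']
    | tmul y w =>
      simp only [act₂_tmul, TensorProduct.map_tmul, LinearMap.rTensor_tmul, incl_act]
      generalize incl U V y = z
      induction comul (R := K) a using TensorProduct.induction_on with
      | zero => simp
      | add S S' h h' => simp only [TensorProduct.add_tmul, map_add, LinearMap.add_apply, h, h']
      | tmul c d =>
        induction z using TensorProduct.induction_on with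
        | zero => simp
        | add S S' h h' => simp only [TensorProduct.add_tmul, map_add, h, h']
        | tmul u v => simp

theorem inclRight_act (U V W : RMod K H) (a : H) (x : tensor U (tensor V W)) :
    inclRight U V W ((tensor U (tensor V W)).act a x) =
      act₃ U V W ((comul (R := K)).lTensor H (comul (R := K) a)) (inclRight U V W x) := by
  simp only [inclRight, LinearMap.comp_apply, incl_act]
  generalize incl U (tensor V W) x = y
  induction comul (R := K) a using TensorProduct.induction_on with
  | zero => simp
  | add S S' h h' => simp only [map_add, LinearMap.add_apply, h, h']
  | tmul a b =>
    induction y using TensorProduct.induction_on with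
    | zero => simp
    | add S S' h h' => simp only [map_add, h, h']
    | tmul y w => simp [incl_act]

theorem inclLeft_injective (U V W : RMod K H) : Function.Injective (inclLeft U V W) :=
  Function.LeftInverse.injective (prLeft_inclLeft U V W)

theorem inclRight_injective (U V W : RMod K H) : Function.Injective (inclRight U V W) :=
  Function.LeftInverse.injective (prRight_inclRight U V W)

theorem inclRight_prRight_inclLeft (U V W : RMod K H) (x : tensor (tensor U V) W) :
    inclRight U V W (prRight U V W (inclLeft U V W x)) = inclLeft U V W x := by
  rw [inclRight_prRight, act₃_inclLeft]

theorem inclLeft_prLeft_inclRight (U V W : RMod K H) (x : tensor U (tensor V W)) :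
    inclLeft U V W (prLeft U V W (inclRight U V W x)) = inclRight U V W x := by
  rw [inclLeft_prLeft, Coalgebra.coassoc_apply, act₃_inclRight]

/-- The associator, induced by that of vector spaces. -/
def assoc (U V W : RMod K H) : tensor (tensor U V) W ≅ tensor U (tensor V W) :=
  mkIso (prRight U V W ∘ₗ inclLeft U V W) (prLeft U V W ∘ₗ inclRight U V W)
    (fun x => by
      simp only [LinearMap.comp_apply]
      rw [inclRight_prRight_inclLeft, prLeft_inclLeft])
    (fun x => by
      simp only [LinearMap.comp_apply]
      rw [inclLeft_prLeft_inclRight, prRight_inclRight])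
    (fun a x => inclRight_injective U V W (by
      simp only [LinearMap.comp_apply]
      rw [inclRight_act, inclRight_prRight_inclLeft, inclRight_prRight_inclLeft, inclLeft_act]))

theorem inclRight_assoc (U V W : RMod K H) (x : tensor (tensor U V) W) :
    (incl V W).lTensor U (incl U (tensor V W) (lin (assoc U V W).hom x)) =
      TensorProduct.assoc K U V W ((incl U V).rTensor W (incl (tensor U V) W x)) :=
  inclRight_prRight_inclLeft U V W x

variable (K H) in
/-- The tensor unit: the source counital subalgebra `H_s`, with `z.h = ε_s(zh)`. -/
def unit : RMod K H where
  carrier := LinearMap.range (counitalSource K (H := H))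
  finite := by
    obtain ⟨S, hS⟩ := TensorProduct.exists_finset (comul (R := K) (1 : H))
    have hle : LinearMap.range (counitalSource K (H := H)) ≤
        Submodule.span K (Prod.fst '' (S : Set (H × H))) := by
      rintro _ ⟨x, rfl⟩
      rw [counitalSource_eq, hS, map_sum]
      refine Submodule.sum_mem _ fun i hi => ?_
      rw [contractRight_tmul]
      exact Submodule.smul_mem _ _ (Submodule.subset_span ⟨i, hi, rfl⟩)
    have : FiniteDimensional K (Submodule.span K (Prod.fst '' (S : Set (H × H)))) :=
      FiniteDimensional.span_of_finite K ((Finset.finite_toSet S).image _)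
    exact Submodule.finiteDimensional_of_le hle
  act :=
    { toFun := fun h => (counitalSource K).rangeRestrict ∘ₗ LinearMap.mulRight K h ∘ₗ
        (LinearMap.range (counitalSource K (H := H))).subtype
      map_add' := fun a b => by ext x; simp [mul_add]
      map_smul' := fun a b => by ext x; simp }
  act_one := by
    ext ⟨_, x, rfl⟩
    simp [counitalSource_idem]
  act_mul a b := by
    ext ⟨_, x, rfl⟩
    simp [counitalSource_mul, mul_assoc]

/-- The inclusion `H_s → H`. -/
def unitIncl : unit K H →ₗ[K] H := (LinearMap.range (counitalSource K (H := H))).subtype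

/-- The projection `H → H_s`. -/
def unitPr : H →ₗ[K] unit K H := (counitalSource K).rangeRestrict

theorem unitIncl_injective : Function.Injective (unitIncl (K := K) (H := H)) :=
  Subtype.val_injective

theorem unitIncl_unitPr (x : H) : unitIncl (unitPr x : unit K H) = counitalSource K x := rfl

theorem unitPr_unitIncl (z : unit K H) : unitPr (unitIncl z) = z := by
  obtain ⟨_, x, rfl⟩ := z
  exact unitIncl_injective (by
    rw [unitIncl_unitPr]
    exact counitalSource_idem x)

theorem act_unitPr (x a : H) : (unit K H).act a (unitPr x) = unitPr (x * a) :=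
  unitIncl_injective (counitalSource_mul x a)

theorem unit_act (z : unit K H) (a : H) : (unit K H).act a z = unitPr (unitIncl z * a) := rfl

/-- The counit restricted to `H_s`. -/
def unitCounit : unit K H →ₗ[K] K := counit (R := K) ∘ₗ unitIncl

theorem unitCounit_unitPr (x : H) : unitCounit (unitPr x : unit K H) = counit (R := K) x :=
  counit_counitalSource x

theorem unitCounit_act (z : unit K H) (a : H) :
    unitCounit ((unit K H).act a z) = counit (R := K) (unitIncl z * a) :=
  counit_counitalSource _

/-- The linear map `V → H_s ⊗̄ V`, `v ↦ (1 ⊗ v).Δ(1)`. -/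
def leftInv (V : RMod K H) : V →ₗ[K] tensor (unit K H) V :=
  pr (unit K H) V ∘ₗ TensorProduct.mk K (unit K H) V (unitPr 1)

/-- The linear map `V → V ⊗̄ H_s`, `v ↦ (v ⊗ 1).Δ(1)`. -/
def rightInv (V : RMod K H) : V →ₗ[K] tensor V (unit K H) :=
  pr V (unit K H) ∘ₗ (TensorProduct.mk K V (unit K H)).flip (unitPr 1)

theorem contractLeft_act₂ (V : RMod K H) (T : H ⊗[K] H) (z : unit K H) (v : V) :
    contractLeft unitCounit (act₂ (unit K H) V T (z ⊗ₜ v)) =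
      V.act (contractLeft (counitMul K (unitIncl z)) T) v := by
  induction T using TensorProduct.induction_on with
  | zero => simp
  | add S S' h h' => simp only [map_add, LinearMap.add_apply, h, h']
  | tmul a b => simp [unitCounit_act]

theorem contractRight_act₂ (V : RMod K H) (T : H ⊗[K] H) (v : V) (z : unit K H) :
    contractRight unitCounit (act₂ V (unit K H) T (v ⊗ₜ z)) =
      V.act (contractRight (counitMul K (unitIncl z)) T) v := by
  induction T using TensorProduct.induction_on with
  | zero => simp
  | add S S' h h' => simp only [map_add, LinearMap.add_apply, h, h']
  | tmul a b => simp [unitCounit_act]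

theorem leftUnit_act (V : RMod K H) (a : H) (x : unit K H ⊗[K] V) :
    contractLeft unitCounit (act₂ (unit K H) V (comul (R := K) a) x) =
      V.act a (contractLeft unitCounit (act₂ (unit K H) V (comul (R := K) 1) x)) := by
  induction x using TensorProduct.induction_on with
  | zero => simp
  | add S S' h h' => simp only [map_add, h, h']
  | tmul z v => rw [contractLeft_act₂, contractLeft_act₂, contractLeft_comul, act_mul_apply]

theorem rightUnit_act (V : RMod K H) (a : H) (x : V ⊗[K] unit K H) :
    contractRight unitCounit (act₂ V (unit K H) (comul (R := K) a) x) =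
      V.act a (contractRight unitCounit (act₂ V (unit K H) (comul (R := K) 1) x)) := by
  induction x using TensorProduct.induction_on with
  | zero => simp
  | add S S' h h' => simp only [map_add, h, h']
  | tmul v z =>
    rw [contractRight_act₂, contractRight_act₂, contractRight_comul, act_mul_apply,
      counitalSource_eq]

theorem counitMul_unitPr_one :
    counitMul K (unitIncl (unitPr 1 : unit K H)) = counit (R := K) := by
  ext a
  rw [unitIncl_unitPr, counitalSource_one]
  simp

/-- The left unitor `H_s ⊗̄ V → V`, `z ⊗ v ↦ ε(z) v`. -/
def leftUnit (V : RMod K H) : tensor (unit K H) V ≅ V :=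
  mkIso (contractLeft unitCounit ∘ₗ incl (unit K H) V) (leftInv V)
    (fun x => incl_injective _ _ (by
      rw [leftInv, LinearMap.comp_apply, incl_pr, LinearMap.comp_apply, ← act₂_incl _ _ x]
      generalize incl (unit K H) V x = y
      induction y using TensorProduct.induction_on with
      | zero => simp
      | add S S' h h' => simp only [map_add, h, h']
      | tmul z v =>
        rw [contractLeft_act₂, TensorProduct.mk_apply]
        have key (T : H ⊗[K] H) : act₂ (unit K H) V T
            (unitPr 1 ⊗ₜ[K] V.act (contractLeft (counitMul K (unitIncl z)) (comul (R := K) 1)) v) =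
            TensorProduct.map (unitPr ∘ₗ contractRight (counitMul K (unitIncl z)))
              (V.act.flip v) ((TensorProduct.assoc K H H H).symm
                ((comul (R := K)).lTensor H T)) := by
          induction T using TensorProduct.induction_on with
          | zero => simp
          | add S S' h h' => simp only [map_add, LinearMap.add_apply, h, h']
          | tmul a b =>
            simp only [act₂_tmul, TensorProduct.map_tmul, act_unitPr, one_mul, ← act_mul_apply,
              ← contractLeft_comul, LinearMap.lTensor_tmul]
            induction comul (R := K) b using TensorProduct.induction_on with
            | zero => simp
            | add S S' h h' =>
              simp only [map_add, LinearMap.add_apply, TensorProduct.tmul_add, h, h']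
            | tmul c d => simp [TensorProduct.smul_tmul]
        rw [key, ← Coalgebra.coassoc_apply, LinearEquiv.symm_apply_apply]
        induction comul (R := K) (1 : H) using TensorProduct.induction_on with
        | zero => simp
        | add S S' h h' => simp only [map_add, LinearMap.add_apply, h, h']
        | tmul a b =>
          simp only [act₂_tmul, TensorProduct.map_tmul, LinearMap.rTensor_tmul,
            LinearMap.comp_apply, LinearMap.flip_apply]
          congr 1
          exact unitIncl_injective (by
            rw [unit_act, unitIncl_unitPr, unitIncl_unitPr, counitalSource_contractRight])))
    (fun v => by
      rw [leftInv, LinearMap.comp_apply, LinearMap.comp_apply, incl_pr, TensorProduct.mk_apply,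
        contractLeft_act₂, counitMul_unitPr_one, contractLeft_counit_comul, act_one_apply])
    (fun a x => by
      simp only [LinearMap.comp_apply]
      rw [incl_act, leftUnit_act, act₂_incl])

/-- The right unitor `V ⊗̄ H_s → V`, `v ⊗ z ↦ ε(z) v`. -/
def rightUnit (V : RMod K H) : tensor V (unit K H) ≅ V :=
  mkIso (contractRight unitCounit ∘ₗ incl V (unit K H)) (rightInv V)
    (fun x => incl_injective _ _ (by
      rw [rightInv, LinearMap.comp_apply, incl_pr, LinearMap.comp_apply, ← act₂_incl _ _ x]
      generalize incl V (unit K H) x = y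
      induction y using TensorProduct.induction_on with
      | zero => simp
      | add S S' h h' => simp only [map_add, h, h']
      | tmul v z =>
        rw [contractRight_act₂, LinearMap.flip_apply, TensorProduct.mk_apply]
        have key (T : H ⊗[K] H) : act₂ V (unit K H) T
            (V.act (contractRight (counitMul K (unitIncl z)) (comul (R := K) 1)) v ⊗ₜ[K]
              unitPr 1) =
            TensorProduct.map (V.act.flip v)
              (unitPr ∘ₗ contractLeft (counitMul K (unitIncl z))) (TensorProduct.assoc K H H H
                ((comul (R := K)).rTensor H T)) := by
          induction T using TensorProduct.induction_on with
          | zero => simp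
          | add S S' h h' => simp only [map_add, LinearMap.add_apply, h, h']
          | tmul a b =>
            simp only [act₂_tmul, TensorProduct.map_tmul, act_unitPr, one_mul, ← act_mul_apply,
              ← counitalSource_eq, ← contractRight_comul, LinearMap.rTensor_tmul]
            induction comul (R := K) a using TensorProduct.induction_on with
            | zero => simp
            | add S S' h h' =>
              simp only [map_add, LinearMap.add_apply, TensorProduct.add_tmul, h, h']
            | tmul c d => simp [TensorProduct.smul_tmul]
        rw [key, Coalgebra.coassoc_apply]
        induction comul (R := K) (1 : H) using TensorProduct.induction_on with
        | zero => simp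
        | add S S' h h' => simp only [map_add, LinearMap.add_apply, h, h']
        | tmul a b =>
          simp only [act₂_tmul, TensorProduct.map_tmul, LinearMap.lTensor_tmul,
            LinearMap.comp_apply, LinearMap.flip_apply]
          congr 1
          exact unitIncl_injective (by
            rw [unit_act, unitIncl_unitPr, unitIncl_unitPr, counitalSource_contractLeft])))
    (fun v => by
      rw [rightInv, LinearMap.comp_apply, LinearMap.comp_apply, incl_pr, LinearMap.flip_apply,
        TensorProduct.mk_apply, contractRight_act₂, counitMul_unitPr_one,
        contractRight_counit_comul, act_one_apply])
    (fun a x => by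
      simp only [LinearMap.comp_apply]
      rw [incl_act, rightUnit_act, act₂_incl])

theorem map_rTensor_incl {M M' : Type u} [AddCommGroup M] [Module K M] [AddCommGroup M']
    [Module K M'] {V V' W W' : RMod K H} (f : V ⟶ V') (g : W ⟶ W') (p : M →ₗ[K] M')
    (x : tensor V W ⊗[K] M) :
    (incl V' W').rTensor M' (TensorProduct.map (lin (tmap f g)) p x) =
      TensorProduct.map (TensorProduct.map (lin f) (lin g)) p ((incl V W).rTensor M x) := by
  induction x using TensorProduct.induction_on with
  | zero => simp
  | add S S' h h' => simp only [map_add, h, h']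
  | tmul y m => simp [incl_tmap]

theorem map_lTensor_incl {M M' : Type u} [AddCommGroup M] [Module K M] [AddCommGroup M']
    [Module K M'] {V V' W W' : RMod K H} (f : V ⟶ V') (g : W ⟶ W') (p : M →ₗ[K] M')
    (x : M ⊗[K] tensor V W) :
    (incl V' W').lTensor M' (TensorProduct.map p (lin (tmap f g)) x) =
      TensorProduct.map p (TensorProduct.map (lin f) (lin g)) ((incl V W).lTensor M x) := by
  induction x using TensorProduct.induction_on with
  | zero => simp
  | add S S' h h' => simp only [map_add, h, h']
  | tmul y m => simp [incl_tmap]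

theorem tmap_id (V W : RMod K H) : tmap (𝟙 V) (𝟙 W) = 𝟙 (tensor V W) :=
  hom_ext fun v => incl_injective _ _ (by rw [incl_tmap]; simp)

theorem tmap_comp {U U' U'' V V' V'' : RMod K H} (f : U ⟶ U') (f' : U' ⟶ U'') (g : V ⟶ V')
    (g' : V' ⟶ V'') : tmap f g ≫ tmap f' g' = tmap (f ≫ f') (g ≫ g') :=
  hom_ext fun v => incl_injective _ _ (by
    rw [lin_comp, LinearMap.comp_apply, incl_tmap, incl_tmap, incl_tmap, lin_comp, lin_comp,
      TensorProduct.map_comp, LinearMap.comp_apply])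

theorem associator_natural {U U' V V' W W' : RMod K H} (f : U ⟶ U') (g : V ⟶ V')
    (h : W ⟶ W') :
    tmap (tmap f g) h ≫ (assoc U' V' W').hom = (assoc U V W).hom ≫ tmap f (tmap g h) :=
  hom_ext fun x => incl_injective _ _ <| lTensor_incl_injective _ _ (by
    simp only [lin_comp, LinearMap.comp_apply]
    rw [inclRight_assoc, incl_tmap, incl_tmap, map_rTensor_incl, map_lTensor_incl,
      inclRight_assoc, TensorProduct.map_map_assoc])

theorem lTensor_assoc_incl {M : Type u} [AddCommGroup M] [Module K M] (U V W : RMod K H)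
    (y : M ⊗[K] tensor (tensor U V) W) :
    ((incl V W).lTensor U).lTensor M ((incl U (tensor V W)).lTensor M
      ((lin (assoc U V W).hom).lTensor M y)) =
      (TensorProduct.assoc K U V W).toLinearMap.lTensor M
        (((incl U V).rTensor W).lTensor M ((incl (tensor U V) W).lTensor M y)) := by
  induction y using TensorProduct.induction_on with
  | zero => simp
  | add S S' h h' => simp only [map_add, h, h']
  | tmul m y => simp [inclRight_assoc]

theorem rTensor_assoc_incl {M : Type u} [AddCommGroup M] [Module K M] (U V W : RMod K H)
    (y : tensor (tensor U V) W ⊗[K] M) :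
    ((incl V W).lTensor U).rTensor M ((incl U (tensor V W)).rTensor M
      ((lin (assoc U V W).hom).rTensor M y)) =
      (TensorProduct.assoc K U V W).toLinearMap.rTensor M
        (((incl U V).rTensor W).rTensor M ((incl (tensor U V) W).rTensor M y)) := by
  induction y using TensorProduct.induction_on with
  | zero => simp
  | add S S' h h' => simp only [map_add, h, h']
  | tmul m y => simp [inclRight_assoc]

theorem lTensor_rTensor_assoc {A B B' C : Type u} [AddCommGroup A] [Module K A] [AddCommGroup B]
    [Module K B] [AddCommGroup B'] [Module K B'] [AddCommGroup C] [Module K C] (p : B →ₗ[K] B')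
    (x : (A ⊗[K] B) ⊗[K] C) :
    (p.rTensor C).lTensor A (TensorProduct.assoc K A B C x) =
      TensorProduct.assoc K A B' C ((p.lTensor A).rTensor C x) := by
  have : (p.rTensor C).lTensor A ∘ₗ (TensorProduct.assoc K A B C).toLinearMap =
      (TensorProduct.assoc K A B' C).toLinearMap ∘ₗ (p.lTensor A).rTensor C := by
    ext; simp
  exact LinearMap.congr_fun this x

theorem lTensor_lTensor_assoc {A B C C' : Type u} [AddCommGroup A] [Module K A] [AddCommGroup B]
    [Module K B] [AddCommGroup C'] [Module K C'] [AddCommGroup C] [Module K C] (p : C →ₗ[K] C')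
    (x : (A ⊗[K] B) ⊗[K] C) :
    (p.lTensor B).lTensor A (TensorProduct.assoc K A B C x) =
      TensorProduct.assoc K A B C' (p.lTensor (A ⊗[K] B) x) := by
  have : (p.lTensor B).lTensor A ∘ₗ (TensorProduct.assoc K A B C).toLinearMap =
      (TensorProduct.assoc K A B C').toLinearMap ∘ₗ p.lTensor (A ⊗[K] B) := by
    ext; simp
  exact LinearMap.congr_fun this x

theorem pentagon_aux (U V W X : RMod K H) :
    tmap (assoc U V W).hom (𝟙 X) ≫ (assoc U (tensor V W) X).hom ≫ tmap (𝟙 U) (assoc V W X).hom =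
      (assoc (tensor U V) W X).hom ≫ (assoc U V (tensor W X)).hom :=
  hom_ext fun x => incl_injective _ _ <| lTensor_incl_injective _ _ <|
    Module.Flat.lTensor_preserves_injective_linearMap (M := U) _
      (lTensor_incl_injective (M := V) W X) (by
    simp only [lin_comp, LinearMap.comp_apply]
    rw [inclRight_assoc, lTensor_lTensor_assoc, ← LinearMap.comp_apply ((incl W X).lTensor _),
      LinearMap.lTensor_comp_rTensor, ← LinearMap.rTensor_comp_lTensor, LinearMap.comp_apply,
      inclRight_assoc, incl_tmap, lin_id, ← LinearMap.lTensor_def, lTensor_assoc_incl,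
      inclRight_assoc, lTensor_rTensor_assoc, incl_tmap, lin_id, ← LinearMap.rTensor_def,
      rTensor_assoc_incl]
    generalize (incl (tensor U V) W).rTensor X (incl _ X x) = q
    induction q using TensorProduct.induction_on with
    | zero => simp
    | add S S' h h' => simp only [map_add, h, h']
    | tmul q x =>
      induction q using TensorProduct.induction_on with
      | zero => simp
      | add S S' h h' => simp only [TensorProduct.add_tmul, map_add, h, h']
      | tmul p w =>
        simp only [LinearMap.rTensor_tmul, TensorProduct.assoc_tmul]
        generalize incl U V p = r
        induction r using TensorProduct.induction_on with
        | zero => simp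
        | add S S' h h' => simp only [TensorProduct.add_tmul, map_add, h, h']
        | tmul u v => simp)

theorem triangle_aux (V W : RMod K H) :
    (assoc V (unit K H) W).hom ≫ tmap (𝟙 V) (leftUnit W).hom = tmap (rightUnit V).hom (𝟙 W) :=
  hom_ext fun x => incl_injective _ _ (by
    simp only [lin_comp, LinearMap.comp_apply]
    rw [incl_tmap, incl_tmap]
    have h1 (y : V ⊗[K] tensor (unit K H) W) : TensorProduct.map (lin (𝟙 V))
        (lin (leftUnit W).hom) y =
        (contractLeft unitCounit).lTensor V ((incl (unit K H) W).lTensor V y) := by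
      rw [← LinearMap.lTensor_comp_apply]; rfl
    have h2 (y : tensor V (unit K H) ⊗[K] W) : TensorProduct.map (lin (rightUnit V).hom)
        (lin (𝟙 W)) y =
        (contractRight unitCounit).rTensor W ((incl V (unit K H)).rTensor W y) := by
      rw [← LinearMap.rTensor_comp_apply]; rfl
    rw [h1, h2, inclRight_assoc]
    generalize (incl V (unit K H)).rTensor W (incl _ W x) = y
    induction y using TensorProduct.induction_on with
    | zero => simp
    | add S S' h h' => simp only [map_add, h, h']
    | tmul y w =>
      induction y using TensorProduct.induction_on with
      | zero => simp
      | add S S' h h' => simp only [TensorProduct.add_tmul, map_add, h, h']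
      | tmul v z => simp [TensorProduct.smul_tmul])

theorem leftUnit_natural {V W : RMod K H} (f : V ⟶ W) :
    tmap (𝟙 (unit K H)) f ≫ (leftUnit W).hom = (leftUnit V).hom ≫ f :=
  hom_ext fun x => by
    change contractLeft unitCounit (incl _ _ (lin (tmap _ _) x)) =
      lin f (contractLeft unitCounit (incl _ _ x))
    rw [incl_tmap]
    generalize incl (unit K H) V x = y
    induction y using TensorProduct.induction_on with
    | zero => simp
    | add S S' h h' => simp only [map_add, h, h']
    | tmul z v => simp

theorem rightUnit_natural {V W : RMod K H} (f : V ⟶ W) :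
    tmap f (𝟙 (unit K H)) ≫ (rightUnit W).hom = (rightUnit V).hom ≫ f :=
  hom_ext fun x => by
    change contractRight unitCounit (incl _ _ (lin (tmap _ _) x)) =
      lin f (contractRight unitCounit (incl _ _ x))
    rw [incl_tmap]
    generalize incl V (unit K H) x = y
    induction y using TensorProduct.induction_on with
    | zero => simp
    | add S S' h h' => simp only [map_add, h, h']
    | tmul z v => simp

instance : MonoidalCategoryStruct (RMod K H) where
  tensorObj := tensor
  whiskerLeft V _ _ f := tmap (𝟙 V) f
  whiskerRight f W := tmap f (𝟙 W)
  tensorHom := tmap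
  tensorUnit := unit K H
  associator := assoc
  leftUnitor := leftUnit
  rightUnitor := rightUnit

/-- The tensor category `H-mod`. -/
instance : MonoidalCategory (RMod K H) where
  tensorHom_def f g := by
    change tmap f g = tmap f (𝟙 _) ≫ tmap (𝟙 _) g
    rw [tmap_comp, Category.comp_id, Category.id_comp]
  id_tensorHom_id := tmap_id
  tensorHom_comp_tensorHom f g f' g' := tmap_comp f f' g g'
  whiskerLeft_id := tmap_id
  id_whiskerRight := tmap_id
  associator_naturality := associator_natural
  leftUnitor_naturality := leftUnit_natural
  rightUnitor_naturality := rightUnit_natural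
  pentagon := pentagon_aux
  triangle := triangle_aux

theorem incl_tensorHom {V V' W W' : RMod K H} (f : V ⟶ V') (g : W ⟶ W')
    (x : (V ⊗ W : RMod K H)) : incl V' W' (lin (f ⊗ₘ g) x) =
      TensorProduct.map (lin f) (lin g) (incl V W x) := incl_tmap f g x

theorem incl_whiskerLeft (V : RMod K H) {W W' : RMod K H} (g : W ⟶ W')
    (x : (V ⊗ W : RMod K H)) : incl V W' (lin (V ◁ g) x) =
      (lin g).lTensor V (incl V W x) := incl_tmap (𝟙 V) g x

theorem incl_whiskerRight {V V' : RMod K H} (f : V ⟶ V') (W : RMod K H)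
    (x : (V ⊗ W : RMod K H)) : incl V' W (lin (f ▷ W) x) =
      (lin f).rTensor W (incl V W x) := incl_tmap f (𝟙 W) x

theorem incl_associator (U V W : RMod K H) (x : ((U ⊗ V) ⊗ W : RMod K H)) :
    (incl V W).lTensor U (incl U (V ⊗ W) (lin (α_ U V W).hom x)) =
      TensorProduct.assoc K U V W ((incl U V).rTensor W (incl (U ⊗ V) W x)) :=
  inclRight_assoc U V W x

theorem lin_leftUnitor (V : RMod K H) :
    lin (λ_ V).hom = contractLeft unitCounit ∘ₗ incl (𝟙_ (RMod K H)) V := rfl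

theorem lin_rightUnitor (V : RMod K H) :
    lin (ρ_ V).hom = contractRight unitCounit ∘ₗ incl V (𝟙_ (RMod K H)) := rfl

instance : MonoidalPreadditive (RMod K H) where
  whiskerLeft_zero {V _ _} := hom_ext fun x => incl_injective _ _ (by
    rw [incl_whiskerLeft]; simp)
  zero_whiskerRight {V _ _} := hom_ext fun x => incl_injective _ _ (by
    rw [incl_whiskerRight]; simp)
  whiskerLeft_add f g := hom_ext fun x => incl_injective _ _ (by
    rw [incl_whiskerLeft, lin_add, lin_add, LinearMap.lTensor_add, LinearMap.add_apply,
      LinearMap.add_apply, map_add, incl_whiskerLeft, incl_whiskerLeft])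
  add_whiskerRight f g := hom_ext fun x => incl_injective _ _ (by
    rw [incl_whiskerRight, lin_add, lin_add, LinearMap.rTensor_add, LinearMap.add_apply,
      LinearMap.add_apply, map_add, incl_whiskerRight, incl_whiskerRight])

instance : MonoidalLinear K (RMod K H) where
  whiskerLeft_smul V _ _ r f := hom_ext fun x => incl_injective _ _ (by
    rw [incl_whiskerLeft, lin_smul, lin_smul, LinearMap.lTensor_smul, LinearMap.smul_apply,
      LinearMap.smul_apply, map_smul, incl_whiskerLeft])
  smul_whiskerRight r _ _ f V := hom_ext fun x => incl_injective _ _ (by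
    rw [incl_whiskerRight, lin_smul, lin_smul, LinearMap.rTensor_smul, LinearMap.smul_apply,
      LinearMap.smul_apply, map_smul, incl_whiskerRight])

end Monoidal

end RMod

/-! ### `G`-equivariant tensor categories and `G`-ribbon categories -/

section Abstract

open Functor.LaxMonoidal Functor.OplaxMonoidal

universe v₁ v₂ u₁ u₂

/-- The structure of a `K`-linear `G`-equivariant tensor category on a `K`-linear tensor category
`C`: a categorical action of `G` by linear tensor functors `X ↦ ^g X` with monoidal compositors
`^g(^h X) ≅ ^{gh} X`, and a decomposition `C = ⨁ C_g` into full subcategories, such that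
`C_g ⊗ C_h ⊆ C_{gh}`, `𝟙 ∈ C_1` and `^g C_h ⊆ C_{ghg⁻¹}`. -/
structure GEquivariantStructure (K : Type*) (G : Type*) (C : Type u₁) [Field K] [Group G]
    [Category.{v₁} C] [Preadditive C] [Linear K C] [MonoidalCategory C] [MonoidalPreadditive C]
    [MonoidalLinear K C] where
  /-- `X ↦ ^g X` -/
  act (g : G) : C ⥤ C
  act_additive (g : G) : (act g).Additive
  act_linear (g : G) : (act g).Linear K
  actMonoidal (g : G) : (act g).Monoidal
  /-- the compositors -/
  actComp (g h : G) : act h ⋙ act g ≅ act (g * h)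
  actComp_isMonoidal (g h : G) : NatTrans.IsMonoidal (actComp g h).hom
  actOne : 𝟭 C ≅ act 1
  actOne_isMonoidal : NatTrans.IsMonoidal actOne.hom
  actComp_assoc (g h k : G) (X : C) :
    (actComp g h).hom.app ((act k).obj X) ≫ (actComp (g * h) k).hom.app X ≫
      eqToHom (by rw [mul_assoc]) =
    (act g).map ((actComp h k).hom.app X) ≫ (actComp g (h * k)).hom.app X
  actOne_left (g : G) (X : C) :
    actOne.hom.app ((act g).obj X) ≫ (actComp 1 g).hom.app X = eqToHom (by simp)
  actOne_right (g : G) (X : C) :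
    (act g).map (actOne.hom.app X) ≫ (actComp g 1).hom.app X = eqToHom (by simp)
  /-- `deg g X`: the object `X` lies in the component `C_g` -/
  deg (g : G) : ObjectProperty C
  deg_iso (g : G) : (deg g).IsClosedUnderIsomorphisms
  deg_hom {g h : G} (hgh : g ≠ h) {X Y : C} (hX : deg g X) (hY : deg h Y) (f : X ⟶ Y) : f = 0
  deg_decomp (X : C) : ∃ Y : G → C, (∀ g, deg g (Y g)) ∧
    ∃ b : Limits.Bicone Y, Nonempty b.IsBilimit ∧ Nonempty (b.pt ≅ X)
  deg_unit : deg 1 (𝟙_ C)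
  deg_tensor {g h : G} {X Y : C} (hX : deg g X) (hY : deg h Y) : deg (g * h) (X ⊗ Y)
  deg_act (g : G) {h : G} {X : C} (hX : deg h X) : deg (g * h * g⁻¹) ((act g).obj X)

attribute [instance] GEquivariantStructure.act_additive GEquivariantStructure.act_linear
  GEquivariantStructure.actMonoidal GEquivariantStructure.actComp_isMonoidal
  GEquivariantStructure.actOne_isMonoidal

variable {K : Type*} {G : Type*} {C : Type u₁} [Field K] [Group G]
  [Category.{v₁} C] [Preadditive C] [Linear K C] [MonoidalCategory C] [MonoidalPreadditive C]
  [MonoidalLinear K C]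

/-- A `G`-braiding: natural isomorphisms `c_{X,Y} : X ⊗ Y ≅ ^g Y ⊗ X` for `X ∈ C_g`, satisfying
the two hexagon axioms and preserved by the action of `G`. -/
structure GBraiding (E : GEquivariantStructure K G C) where
  braid {g : G} {X : C} (hX : E.deg g X) (Y : C) : X ⊗ Y ≅ (E.act g).obj Y ⊗ X
  natural_left {g : G} {X X' : C} (hX : E.deg g X) (hX' : E.deg g X') (f : X ⟶ X') (Y : C) :
    f ▷ Y ≫ (braid hX' Y).hom = (braid hX Y).hom ≫ (E.act g).obj Y ◁ f
  natural_right {g : G} {X : C} (hX : E.deg g X) {Y Y' : C} (f : Y ⟶ Y') :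
    X ◁ f ≫ (braid hX Y').hom = (braid hX Y).hom ≫ (E.act g).map f ▷ X
  hexagon_right {g : G} {X : C} (hX : E.deg g X) (Y Z : C) :
    (α_ X Y Z).hom ≫ (braid hX (Y ⊗ Z)).hom =
      (braid hX Y).hom ▷ Z ≫ (α_ _ _ _).hom ≫ (E.act g).obj Y ◁ (braid hX Z).hom ≫
        (α_ _ _ _).inv ≫ μ (E.act g) Y Z ▷ X
  hexagon_left {g h : G} {X Y : C} (hX : E.deg g X) (hY : E.deg h Y) (Z : C) :
    (α_ X Y Z).inv ≫ (braid (E.deg_tensor hX hY) Z).hom =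
      X ◁ (braid hY Z).hom ≫ (α_ _ _ _).inv ≫ (braid hX ((E.act h).obj Z)).hom ▷ Y ≫
        (α_ _ _ _).hom ≫ (E.actComp g h).hom.app Z ▷ (X ⊗ Y)
  equivariant (k : G) {g : G} {X : C} (hX : E.deg g X) (Y : C) :
    μ (E.act k) X Y ≫ (E.act k).map (braid hX Y).hom ≫ δ (E.act k) ((E.act g).obj Y) X ≫
        (E.actComp k g).hom.app Y ▷ (E.act k).obj X =
      (braid (E.deg_act k hX) ((E.act k).obj Y)).hom ≫
        ((E.actComp (k * g * k⁻¹) k).hom.app Y ≫ eqToHom (by simp)) ▷ (E.act k).obj X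

/-- A `G`-twist for a `G`-braiding: natural isomorphisms `θ_X : X ≅ ^g X` for `X ∈ C_g`, preserved
by the action of `G`, compatible with the tensor product through
`θ_{X ⊗ Y} = (^{ghg⁻¹} θ_X ⊗ ^g θ_Y) c_{^g Y, X} c_{X, Y}` for `X ∈ C_g`, `Y ∈ C_h`, and
compatible with dualities through `(θ_X ⊗ id) b = (id ⊗ ^g θ_Y) (^g b)` for every dual
pair `(X, Y)` with coevaluation `b : 𝟙 ⟶ X ⊗ Y`. -/
structure GTwist {E : GEquivariantStructure K G C} (β : GBraiding E) where
  twist {g : G} {X : C} (hX : E.deg g X) : X ≅ (E.act g).obj X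
  natural {g : G} {X X' : C} (hX : E.deg g X) (hX' : E.deg g X') (f : X ⟶ X') :
    f ≫ (twist hX').hom = (twist hX).hom ≫ (E.act g).map f
  equivariant (k : G) {g : G} {X : C} (hX : E.deg g X) :
    (E.act k).map (twist hX).hom ≫ (E.actComp k g).hom.app X =
      (twist (E.deg_act k hX)).hom ≫ (E.actComp (k * g * k⁻¹) k).hom.app X ≫ eqToHom (by simp)
  tensor {g h : G} {X Y : C} (hX : E.deg g X) (hY : E.deg h Y) :
    (twist (E.deg_tensor hX hY)).hom =
      (β.braid hX Y).hom ≫ (β.braid (E.deg_act g hY) X).hom ≫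
        (((E.act (g * h * g⁻¹)).map (twist hX).hom ≫ (E.actComp (g * h * g⁻¹) g).hom.app X ≫
            eqToHom (by simp)) ⊗ₘ
          ((E.act g).map (twist hY).hom ≫ (E.actComp g h).hom.app Y)) ≫
        μ (E.act (g * h)) X Y
  dual {g : G} {X Y : C} [ExactPairing X Y] (hX : E.deg g X) (hY : E.deg g⁻¹ Y) :
    η_ X Y ≫ (twist hX).hom ▷ Y =
      ε (E.act g) ≫ (E.act g).map (η_ X Y) ≫ δ (E.act g) X Y ≫
        (E.act g).obj X ◁ ((E.act g).map (twist hY).hom ≫ (E.actComp g g⁻¹).hom.app Y ≫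
          eqToHom (by simp) ≫ E.actOne.inv.app Y)

/-- Every object has a left dual and a right dual. -/
def HasDuals (C : Type u₁) [Category.{v₁} C] [MonoidalCategory C] : Prop :=
  ∀ X : C, (∃ Y : C, Nonempty (ExactPairing Y X)) ∧ ∃ Y : C, Nonempty (ExactPairing X Y)

/-- The structure of a `G`-ribbon category on a `G`-equivariant tensor category. -/
structure GRibbonStructure (E : GEquivariantStructure K G C) where
  hasDuals : HasDuals C
  braiding : GBraiding E
  twist : GTwist braiding

variable {D : Type u₂} [Category.{v₂} D] [Preadditive D] [Linear K D] [MonoidalCategory D]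
  [MonoidalPreadditive D] [MonoidalLinear K D]

/-- The structure of a `K`-linear `G`-equivariant functor on a functor `F`: the structure of a
tensor functor, and monoidal natural isomorphisms `ψ_g : F(^g X) ≅ ^g F(X)` compatible with the
compositors, such that `F` preserves the grading. -/
structure GEquivariantFunctor (E : GEquivariantStructure K G C)
    (E' : GEquivariantStructure K G D) (F : C ⥤ D) where
  additive : F.Additive
  linear : F.Linear K
  monoidal : F.Monoidal
  ψ (g : G) : E.act g ⋙ F ≅ F ⋙ E'.act g
  ψ_isMonoidal (g : G) : NatTrans.IsMonoidal (ψ g).hom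
  ψ_comp (g h : G) (X : C) :
    F.map ((E.actComp g h).hom.app X) ≫ (ψ (g * h)).hom.app X =
      (ψ g).hom.app ((E.act h).obj X) ≫ (E'.act g).map ((ψ h).hom.app X) ≫
        (E'.actComp g h).hom.app (F.obj X)
  map_deg {g : G} {X : C} (hX : E.deg g X) : E'.deg g (F.obj X)

/-- The structure of an equivalence of `G`-ribbon categories on a functor `F`: the structure of a
`G`-equivariant functor preserving the `G`-braidings and the `G`-twists, where `F` is an
equivalence of categories. -/
structure GRibbonEquivalence {E : GEquivariantStructure K G C} {E' : GEquivariantStructure K G D}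
    (R : GRibbonStructure E) (R' : GRibbonStructure E') (F : C ⥤ D) extends
    GEquivariantFunctor E E' F where
  isEquivalence : F.IsEquivalence
  map_braid {g : G} {X : C} (hX : E.deg g X) (Y : C) :
    letI := monoidal
    μ F X Y ≫ F.map (R.braiding.braid hX Y).hom =
      (R'.braiding.braid (map_deg hX) (F.obj Y)).hom ≫
        (ψ g).inv.app Y ▷ F.obj X ≫ μ F ((E.act g).obj Y) X
  map_twist {g : G} {X : C} (hX : E.deg g X) :
    F.map (R.twist.twist hX).hom ≫ (ψ g).hom.app X = (R'.twist.twist (map_deg hX)).hom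

end Abstract

/-! ### `G`-weak Hopf algebras -/

/-- A weak `G`-action on an algebra `A`: algebra automorphisms `φ_g` and invertible elements
`c_{g,h}` with `φ_g φ_h = Inn(c_{g,h}) φ_{gh}`, `φ_g(c_{h,k}) c_{g,hk} = c_{g,h} c_{gh,k}` and
`c_{1,1} = 1`. -/
structure WeakAction (K G A : Type u) [Field K] [Group G] [Ring A] [Algebra K A] where
  φ : G → A ≃ₐ[K] A
  c : G → G → Aˣ
  φ_φ (g h : G) (a : A) : φ g (φ h a) = c g h * φ (g * h) a * ((c g h)⁻¹ : Aˣ)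
  cocycle (g h k : G) : φ g (c h k) * (c g (h * k) : A) = c g h * c (g * h) k
  c_one_one : c 1 1 = 1

/-- A weak `G`-action is strict if all `c_{g,h}` are `1`. -/
def WeakAction.IsStrict {K G A : Type u} [Field K] [Group G] [Ring A] [Algebra K A]
    (W : WeakAction K G A) : Prop :=
  ∀ g h : G, W.c g h = 1

/-- The structure of a `G`-weak Hopf algebra on a weak Hopf algebra `H`: a weak action of `G` by
automorphisms of weak Hopf algebras with right grouplike `c_{g,h}`, and a compatible grading
`H = ⨁ H_g` as an algebra. If `H` is a Hopf algebra, then `Δ(1) = 1 ⊗ 1` and this is the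
structure of a `G`-Hopf algebra. -/
structure GWeakHopf (K G H : Type u) [Field K] [Group G] [Ring H] [Algebra K H] [Coalgebra K H]
    [WeakHopfAlgebra K H] extends WeakAction K G H where
  comul_φ (g : G) (a : H) : comul (R := K) (φ g a) =
    TensorProduct.map (φ g).toLinearMap (φ g).toLinearMap (comul (R := K) a)
  counit_φ (g : G) (a : H) : counit (R := K) (φ g a) = counit (R := K) a
  antipode_φ (g : G) (a : H) :
    WeakHopfAlgebra.antipode (K := K) (φ g a) = φ g (WeakHopfAlgebra.antipode (K := K) a)
  comul_c (g h : G) : comul (R := K) (c g h : H) =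
    ((c g h : H) ⊗ₜ[K] (c g h : H)) * comul (R := K) 1
  /-- the component `H_g` -/
  grading : G → Submodule K H
  grading_iSupIndep : iSupIndep grading
  grading_iSup : ⨆ g, grading g = ⊤
  grading_mul {g : G} {a b : H} (ha : a ∈ grading g) (hb : b ∈ grading g) : a * b ∈ grading g
  grading_mul_ne {g h : G} (hgh : g ≠ h) {a b : H} (ha : a ∈ grading g) (hb : b ∈ grading h) :
    a * b = 0
  grading_φ (g : G) {h : G} {a : H} (ha : a ∈ grading h) : φ g a ∈ grading (g * h * g⁻¹)
  grading_comul {g : G} {a : H} (ha : a ∈ grading g) : comul (R := K) a ∈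
    ⨆ (p : G) (q : G) (_ : p * q = g),
      LinearMap.range (TensorProduct.mapIncl (grading p) (grading q))

namespace WeakAction

variable {K G A : Type u} [Field K] [Group G] [Ring A] [Algebra K A] (W : WeakAction K G A)

theorem φ_one (a : A) : W.φ 1 a = a := by
  have := W.φ_φ 1 1 a
  simp only [W.c_one_one, mul_one, Units.val_one, one_mul, inv_one] at this
  exact (W.φ 1).injective this

theorem c_one_right (g : G) : W.c g 1 = 1 := by
  have := W.cocycle g 1 1
  simp only [W.c_one_one, mul_one, Units.val_one, map_one, one_mul] at this
  have h2 : W.c g 1 * 1 = W.c g 1 * W.c g 1 := Units.ext (by simpa using this)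
  exact (mul_left_cancel h2).symm

theorem c_one_left (g : G) : W.c 1 g = 1 := by
  have := W.cocycle 1 1 g
  simp only [W.c_one_one, Units.val_one, one_mul, φ_one] at this
  have h2 : W.c 1 g * W.c 1 g = W.c 1 g * 1 := Units.ext (by simpa using this)
  exact mul_left_cancel h2

theorem φ_φ_mul_c (g h : G) (a : A) :
    W.φ g (W.φ h a) * W.c g h = W.c g h * W.φ (g * h) a := by
  rw [W.φ_φ, mul_assoc, Units.inv_mul, mul_one]

end WeakAction

namespace RMod

/-! #### The action of `G` on `H-mod` -/

section Act

variable {K G H : Type u} [Field K] [Group G] [Ring H] [Algebra K H]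

/-- The module `^g V`: the space `V` on which `a` acts as `φ_{g⁻¹}(a)`. -/
def twist (W : WeakAction K G H) (g : G) (V : RMod K H) : RMod K H where
  carrier := V
  act := V.act ∘ₗ (W.φ g⁻¹).toLinearMap
  act_one := by simp [V.act_one]
  act_mul a b := by simp [V.act_mul]

/-- The identity map `^g V → V`. -/
def fromTw (W : WeakAction K G H) (g : G) (V : RMod K H) : twist W g V →ₗ[K] V :=
  (LinearMap.id : V →ₗ[K] V)

/-- The identity map `V → ^g V`. -/
def toTw (W : WeakAction K G H) (g : G) (V : RMod K H) : V →ₗ[K] twist W g V :=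
  (LinearMap.id : V →ₗ[K] V)

@[simp]
theorem fromTw_toTw (W : WeakAction K G H) (g : G) (V : RMod K H) (v : V) :
    fromTw W g V (toTw W g V v) = v := rfl

@[simp]
theorem toTw_fromTw (W : WeakAction K G H) (g : G) (V : RMod K H) (v : twist W g V) :
    toTw W g V (fromTw W g V v) = v := rfl

theorem fromTw_injective (W : WeakAction K G H) (g : G) (V : RMod K H) :
    Function.Injective (fromTw W g V) := Function.LeftInverse.injective (toTw_fromTw W g V)

theorem fromTw_act (W : WeakAction K G H) (g : G) (V : RMod K H) (a : H) (v : twist W g V) :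
    fromTw W g V ((twist W g V).act a v) = V.act (W.φ g⁻¹ a) (fromTw W g V v) := rfl

/-- The functor `V ↦ ^g V` on morphisms. -/
def twistMap (W : WeakAction K G H) (g : G) {V V' : RMod K H} (f : V ⟶ V') :
    twist W g V ⟶ twist W g V' :=
  ofLin (toTw W g V' ∘ₗ lin f ∘ₗ fromTw W g V) fun a v => fromTw_injective W g V' (by
    simp only [LinearMap.comp_apply, fromTw_act, lin_act, fromTw_toTw])

theorem fromTw_twistMap (W : WeakAction K G H) (g : G) {V V' : RMod K H} (f : V ⟶ V')
    (v : twist W g V) : fromTw W g V' (lin (twistMap W g f) v) = lin f (fromTw W g V v) := rfl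

/-- The functor `V ↦ ^g V`, the identity on morphisms. -/
abbrev twistFunctor (W : WeakAction K G H) (g : G) : RMod K H ⥤ RMod K H where
  obj := twist W g
  map := twistMap W g
  map_id _ := rfl
  map_comp _ _ := rfl

instance (W : WeakAction K G H) (g : G) : (twistFunctor W g).Additive where
  map_add := rfl

instance (W : WeakAction K G H) (g : G) : (twistFunctor W g).Linear K where
  map_smul _ _ := rfl

/-- The identity map `^g U ⊗ ^g V → U ⊗ V`. -/
def fromTw₂ (W : WeakAction K G H) (g : G) (U V : RMod K H) :
    twist W g U ⊗[K] twist W g V →ₗ[K] U ⊗[K] V :=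
  TensorProduct.map (fromTw W g U) (fromTw W g V)

/-- The identity map `U ⊗ V → ^g U ⊗ ^g V`. -/
def toTw₂ (W : WeakAction K G H) (g : G) (U V : RMod K H) :
    U ⊗[K] V →ₗ[K] twist W g U ⊗[K] twist W g V :=
  TensorProduct.map (toTw W g U) (toTw W g V)

@[simp]
theorem fromTw₂_toTw₂ (W : WeakAction K G H) (g : G) (U V : RMod K H) (x : U ⊗[K] V) :
    fromTw₂ W g U V (toTw₂ W g U V x) = x := by
  induction x using TensorProduct.induction_on with
  | zero => simp
  | add S S' h h' => simp only [map_add, h, h']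
  | tmul a b => rfl

@[simp]
theorem toTw₂_fromTw₂ (W : WeakAction K G H) (g : G) (U V : RMod K H)
    (x : twist W g U ⊗[K] twist W g V) : toTw₂ W g U V (fromTw₂ W g U V x) = x := by
  induction x using TensorProduct.induction_on with
  | zero => simp
  | add S S' h h' => simp only [map_add, h, h']
  | tmul a b => rfl

theorem fromTw₂_injective (W : WeakAction K G H) (g : G) (U V : RMod K H) :
    Function.Injective (fromTw₂ W g U V) :=
  Function.LeftInverse.injective (toTw₂_fromTw₂ W g U V)

theorem fromTw₂_act₂ (W : WeakAction K G H) (g : G) (U V : RMod K H) (T : H ⊗[K] H)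
    (x : twist W g U ⊗[K] twist W g V) :
    fromTw₂ W g U V (act₂ (twist W g U) (twist W g V) T x) =
      act₂ U V (TensorProduct.map (W.φ g⁻¹).toLinearMap (W.φ g⁻¹).toLinearMap T)
        (fromTw₂ W g U V x) := by
  induction T using TensorProduct.induction_on with
  | zero => simp
  | add S S' h h' => simp only [map_add, LinearMap.add_apply, h, h']
  | tmul a b =>
    induction x using TensorProduct.induction_on with
    | zero => simp
    | add S S' h h' => simp only [map_add, h, h']
    | tmul u v => rfl

/-- The compositor `^g(^h V) ≅ ^{gh} V`, `v ↦ v.c_{h⁻¹,g⁻¹}`. -/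
def twistCompIso (W : WeakAction K G H) (g h : G) (V : RMod K H) :
    twist W g (twist W h V) ≅ twist W (g * h) V :=
  mkIso
    (toTw W (g * h) V ∘ₗ V.act (W.c h⁻¹ g⁻¹ : H) ∘ₗ fromTw W h V ∘ₗ fromTw W g (twist W h V))
    (toTw W g (twist W h V) ∘ₗ toTw W h V ∘ₗ V.act ((W.c h⁻¹ g⁻¹)⁻¹ : Hˣ) ∘ₗ fromTw W (g * h) V)
    (fun v => by
      simp only [LinearMap.comp_apply, fromTw_toTw]
      rw [← act_mul_apply, Units.mul_inv, act_one_apply, toTw_fromTw, toTw_fromTw])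
    (fun v => by
      simp only [LinearMap.comp_apply, fromTw_toTw]
      rw [← act_mul_apply, Units.inv_mul, act_one_apply, toTw_fromTw])
    (fun a v => fromTw_injective _ _ _ (by
      simp only [LinearMap.comp_apply, fromTw_toTw, fromTw_act]
      rw [← act_mul_apply, W.φ_φ_mul_c, act_mul_apply, mul_inv_rev]))

theorem fromTw_twistCompIso (W : WeakAction K G H) (g h : G) (V : RMod K H)
    (v : twist W g (twist W h V)) :
    fromTw W (g * h) V (lin (twistCompIso W g h V).hom v) =
      V.act (W.c h⁻¹ g⁻¹ : H) (fromTw W h V (fromTw W g (twist W h V) v)) := rfl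

/-- The compositors `^g(^h V) ≅ ^{gh} V` as a natural isomorphism. -/
def twistComp (W : WeakAction K G H) (g h : G) :
    twistFunctor W h ⋙ twistFunctor W g ≅ twistFunctor W (g * h) :=
  NatIso.ofComponents (twistCompIso W g h)
    (fun {V V'} f => hom_ext fun v => (lin_act f _ _).symm)

/-- The isomorphism `V ≅ ^1 V` given by the identity. -/
def twistOneIso (W : WeakAction K G H) (V : RMod K H) : V ≅ twist W 1 V :=
  mkIso (toTw W 1 V) (fromTw W 1 V) (fun _ => rfl) (fun _ => rfl)
    (fun a v => fromTw_injective _ _ _ (by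
      rw [fromTw_act, inv_one, W.φ_one, fromTw_toTw, fromTw_toTw]))

/-- The isomorphisms `V ≅ ^1 V` as a natural isomorphism. -/
def twistOne (W : WeakAction K G H) : 𝟭 (RMod K H) ≅ twistFunctor W 1 :=
  NatIso.ofComponents (twistOneIso W) (fun {V V'} f => hom_ext fun v => rfl)

theorem fromTw_eqToHom (W : WeakAction K G H) {g h : G} (e : g = h) (V : RMod K H)
    (e' : twist W g V = twist W h V) (v : twist W g V) :
    fromTw W h V (lin (eqToHom e') v) = fromTw W g V v := by
  subst e
  rfl

end Act

section ActMonoidal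

variable {K G H : Type u} [Field K] [Group G] [Ring H] [Algebra K H] [Coalgebra K H]
variable [WeakHopfAlgebra K H]

theorem map_φ_comul_one (S : GWeakHopf K G H) (g : G) :
    TensorProduct.map (S.φ g).toLinearMap (S.φ g).toLinearMap (comul (R := K) (1 : H)) =
      comul (R := K) (1 : H) := by
  rw [← S.comul_φ, map_one (S.φ g)]

theorem fromTw₂_act₂_one (S : GWeakHopf K G H) (g : G) (U V : RMod K H)
    (x : twist S.toWeakAction g U ⊗[K] twist S.toWeakAction g V) :
    fromTw₂ _ g U V (act₂ (twist S.toWeakAction g U) (twist S.toWeakAction g V)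
      (comul (R := K) 1) x) = act₂ U V (comul (R := K) 1) (fromTw₂ _ g U V x) := by
  rw [fromTw₂_act₂, map_φ_comul_one]

theorem counitalSource_φ (S : GWeakHopf K G H) (g : G) (a : H) :
    counitalSource K (S.φ g a) = S.φ g (counitalSource K a) := by
  have key (T : H ⊗[K] H) : contractRight (counitMul K (S.φ g a))
      (TensorProduct.map (S.φ g).toLinearMap (S.φ g).toLinearMap T) =
      S.φ g (contractRight (counitMul K a) T) := by
    induction T using TensorProduct.induction_on with
    | zero => simp
    | add T T' h h' => simp only [map_add, h, h']
    | tmul b b' =>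
      simp only [TensorProduct.map_tmul, AlgEquiv.toLinearMap_apply, contractRight_tmul,
        counitMul_apply]
      rw [← map_mul, S.counit_φ, map_smul]
  rw [counitalSource_eq, counitalSource_eq, ← key, map_φ_comul_one]

theorem comul_one_mul_c (S : GWeakHopf K G H) (g h : G) :
    comul (R := K) (1 : H) * ((S.c g h : H) ⊗ₜ[K] (S.c g h : H)) =
      ((S.c g h : H) ⊗ₜ[K] (S.c g h : H)) * comul (R := K) (1 : H) := by
  have key (T : H ⊗[K] H) :
      TensorProduct.map (S.φ g).toLinearMap (S.φ g).toLinearMap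
        (TensorProduct.map (S.φ h).toLinearMap (S.φ h).toLinearMap T) *
          ((S.c g h : H) ⊗ₜ[K] (S.c g h : H)) =
        ((S.c g h : H) ⊗ₜ[K] (S.c g h : H)) *
          TensorProduct.map (S.φ (g * h)).toLinearMap (S.φ (g * h)).toLinearMap T := by
    induction T using TensorProduct.induction_on with
    | zero => simp
    | add T T' h h' => simp only [map_add, add_mul, mul_add, h, h']
    | tmul a b => simp [S.φ_φ_mul_c]
  simpa only [map_φ_comul_one] using key (comul (R := K) (1 : H))

/-- The tensor structure `^g U ⊗̄ ^g V ≅ ^g(U ⊗̄ V)`, the identity on underlying spaces. -/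
def twistTensor (S : GWeakHopf K G H) (g : G) (U V : RMod K H) :
    tensor (twist S.toWeakAction g U) (twist S.toWeakAction g V) ≅
      twist S.toWeakAction g (tensor U V) :=
  mkIso
    (toTw _ g (tensor U V) ∘ₗ pr U V ∘ₗ fromTw₂ _ g U V ∘ₗ
      incl (twist S.toWeakAction g U) (twist S.toWeakAction g V))
    (pr (twist S.toWeakAction g U) (twist S.toWeakAction g V) ∘ₗ toTw₂ _ g U V ∘ₗ incl U V ∘ₗ
      fromTw _ g (tensor U V))
    (fun x => incl_injective _ _ <| fromTw₂_injective _ _ _ _ (by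
      simp only [LinearMap.comp_apply, fromTw_toTw]
      rw [incl_pr, fromTw₂_act₂_one, fromTw₂_toTw₂, act₂_incl, incl_pr, ← fromTw₂_act₂_one,
        act₂_incl]))
    (fun x => fromTw_injective _ _ _ <| incl_injective _ _ (by
      simp only [LinearMap.comp_apply, fromTw_toTw]
      rw [incl_pr, incl_pr, fromTw₂_act₂_one, fromTw₂_toTw₂, act₂_incl, act₂_incl]))
    (fun a x => fromTw_injective _ _ _ <| incl_injective _ _ (by
      simp only [LinearMap.comp_apply, fromTw_toTw, fromTw_act]
      rw [incl_act, incl_act, fromTw₂_act₂, ← S.comul_φ, pr_act₂, incl_act]))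

theorem incl_twistTensor (S : GWeakHopf K G H) (g : G) (U V : RMod K H)
    (x : tensor (twist S.toWeakAction g U) (twist S.toWeakAction g V)) :
    incl U V (fromTw _ g (tensor U V) (lin (twistTensor S g U V).hom x)) =
      fromTw₂ _ g U V (incl (twist S.toWeakAction g U) (twist S.toWeakAction g V) x) := by
  change incl U V (pr U V (fromTw₂ _ g U V (incl _ _ x))) = _
  rw [incl_pr, ← fromTw₂_act₂_one, act₂_incl]

/-- The isomorphism `𝟙 ≅ ^g 𝟙` given by `φ_{g⁻¹}` on `H_s`. -/
def twistUnit (S : GWeakHopf K G H) (g : G) : unit K H ≅ twist S.toWeakAction g (unit K H) :=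
  mkIso
    (toTw _ g (unit K H) ∘ₗ unitPr ∘ₗ (S.φ g⁻¹).toLinearMap ∘ₗ unitIncl)
    (unitPr ∘ₗ (S.φ g⁻¹).symm.toLinearMap ∘ₗ unitIncl ∘ₗ fromTw _ g (unit K H))
    (fun z => by
      obtain ⟨x, rfl⟩ : ∃ x, unitPr x = z := ⟨_, unitPr_unitIncl z⟩
      refine unitIncl_injective ?_
      simp [unitIncl_unitPr, counitalSource_φ, counitalSource_idem])
    (fun z => by
      obtain ⟨x, rfl⟩ : ∃ x, toTw _ g _ (unitPr (S.φ g⁻¹ x)) = z :=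
        ⟨(S.φ g⁻¹).symm (unitIncl (fromTw _ g _ z)), by simp [unitPr_unitIncl]⟩
      refine fromTw_injective _ _ _ (unitIncl_injective ?_)
      simp [unitIncl_unitPr, counitalSource_φ, counitalSource_idem])
    (fun a z => by
      obtain ⟨x, rfl⟩ : ∃ x, unitPr x = z := ⟨_, unitPr_unitIncl z⟩
      refine fromTw_injective _ _ _ (unitIncl_injective ?_)
      simp only [LinearMap.comp_apply, fromTw_toTw, fromTw_act, AlgEquiv.toLinearMap_apply]
      simp only [act_unitPr, unitIncl_unitPr, ← counitalSource_φ, counitalSource_idem, map_mul,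
        counitalSource_mul])

theorem unitIncl_twistUnit (S : GWeakHopf K G H) (g : G) (z : unit K H) :
    unitIncl (fromTw _ g _ (lin (twistUnit S g).hom z)) = S.φ g⁻¹ (unitIncl z) := by
  obtain ⟨x, rfl⟩ : ∃ x, unitPr x = z := ⟨_, unitPr_unitIncl z⟩
  change unitIncl (unitPr (S.φ g⁻¹ (unitIncl (unitPr x)))) = _
  rw [unitIncl_unitPr, unitIncl_unitPr, counitalSource_φ, counitalSource_idem]

theorem unitCounit_twistUnit (S : GWeakHopf K G H) (g : G) (z : unit K H) :
    unitCounit (fromTw _ g _ (lin (twistUnit S g).hom z)) = unitCounit z := by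
  change counit (R := K) (unitIncl _) = counit (R := K) (unitIncl _)
  rw [unitIncl_twistUnit, S.counit_φ]

theorem twistTensor_natural (S : GWeakHopf K G H) (g : G) {U U' V V' : RMod K H} (f : U ⟶ U')
    (f' : V ⟶ V') :
    tmap (twistMap S.toWeakAction g f) (twistMap S.toWeakAction g f') ≫
        (twistTensor S g U' V').hom =
      (twistTensor S g U V).hom ≫ twistMap S.toWeakAction g (tmap f f') :=
  hom_ext fun x => fromTw_injective _ _ _ <| incl_injective _ _ (by
    simp only [lin_comp, LinearMap.comp_apply]
    rw [incl_twistTensor, fromTw_twistMap, incl_tmap, incl_tmap, incl_twistTensor]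
    generalize incl _ _ x = y
    induction y using TensorProduct.induction_on with
    | zero => simp
    | add S S' h h' => simp only [map_add, h, h']
    | tmul u v => rfl)

theorem twistTensor_assoc (S : GWeakHopf K G H) (g : G) (U V W : RMod K H) :
    tmap (twistTensor S g U V).hom (𝟙 (twist S.toWeakAction g W)) ≫
        (twistTensor S g (tensor U V) W).hom ≫ twistMap S.toWeakAction g (assoc U V W).hom =
      (assoc _ _ _).hom ≫ tmap (𝟙 (twist S.toWeakAction g U)) (twistTensor S g V W).hom ≫
        (twistTensor S g U (tensor V W)).hom :=
  hom_ext fun x => fromTw_injective _ _ _ <| incl_injective _ _ <| lTensor_incl_injective _ _ (by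
    simp only [lin_comp, LinearMap.comp_apply]
    rw [fromTw_twistMap, inclRight_assoc, incl_twistTensor, incl_twistTensor, incl_tmap, incl_tmap]
    have h1 (y : tensor (twist S.toWeakAction g U) (twist S.toWeakAction g V) ⊗[K]
        twist S.toWeakAction g W) :
        (incl U V).rTensor W (fromTw₂ _ g (tensor U V) W
          (TensorProduct.map (lin (twistTensor S g U V).hom) (lin (𝟙 (twist _ g W))) y)) =
        TensorProduct.map (fromTw₂ _ g U V) (fromTw _ g W) ((incl _ _).rTensor _ y) := by
      induction y using TensorProduct.induction_on with
      | zero => simp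
      | add S S' h h' => simp only [map_add, h, h']
      | tmul u v => simp [fromTw₂, incl_twistTensor]
    have h2 (y : twist S.toWeakAction g U ⊗[K]
        tensor (twist S.toWeakAction g V) (twist S.toWeakAction g W)) :
        (incl V W).lTensor U (fromTw₂ _ g U (tensor V W)
          (TensorProduct.map (lin (𝟙 (twist _ g U))) (lin (twistTensor S g V W).hom) y)) =
        TensorProduct.map (fromTw _ g U) (fromTw₂ _ g V W) ((incl _ _).lTensor _ y) := by
      induction y using TensorProduct.induction_on with
      | zero => simp
      | add S S' h h' => simp only [map_add, h, h']
      | tmul u v => simp [fromTw₂, incl_twistTensor]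
    rw [h1, h2, inclRight_assoc]
    simp only [fromTw₂]
    rw [TensorProduct.map_map_assoc])

theorem twistTensor_left_unit (S : GWeakHopf K G H) (g : G) (V : RMod K H) :
    (leftUnit (twist S.toWeakAction g V)).hom =
      tmap (twistUnit S g).hom (𝟙 (twist S.toWeakAction g V)) ≫
        (twistTensor S g (unit K H) V).hom ≫ twistMap S.toWeakAction g (leftUnit V).hom :=
  hom_ext fun x => fromTw_injective _ _ _ (by
    simp only [lin_comp, LinearMap.comp_apply]
    rw [fromTw_twistMap]
    change fromTw _ g V (contractLeft unitCounit (incl _ _ x)) =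
      contractLeft unitCounit (incl _ _ _)
    rw [incl_twistTensor, incl_tmap]
    generalize incl _ _ x = y
    induction y using TensorProduct.induction_on with
    | zero => simp
    | add S S' h h' => simp only [map_add, h, h']
    | tmul u v => simp [fromTw₂, unitCounit_twistUnit])

theorem twistTensor_right_unit (S : GWeakHopf K G H) (g : G) (V : RMod K H) :
    (rightUnit (twist S.toWeakAction g V)).hom =
      tmap (𝟙 (twist S.toWeakAction g V)) (twistUnit S g).hom ≫
        (twistTensor S g V (unit K H)).hom ≫ twistMap S.toWeakAction g (rightUnit V).hom :=
  hom_ext fun x => fromTw_injective _ _ _ (by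
    simp only [lin_comp, LinearMap.comp_apply]
    rw [fromTw_twistMap]
    change fromTw _ g V (contractRight unitCounit (incl _ _ x)) =
      contractRight unitCounit (incl _ _ _)
    rw [incl_twistTensor, incl_tmap]
    generalize incl _ _ x = y
    induction y using TensorProduct.induction_on with
    | zero => simp
    | add S S' h h' => simp only [map_add, h, h']
    | tmul u v => simp [fromTw₂, unitCounit_twistUnit])

/-- The tensor functor structure on `V ↦ ^g V`. -/
def twistCore (S : GWeakHopf K G H) (g : G) : (twistFunctor S.toWeakAction g).CoreMonoidal where
  εIso := twistUnit S g
  μIso := twistTensor S g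
  μIso_hom_natural_left f V := twistTensor_natural S g f (𝟙 V)
  μIso_hom_natural_right V f := twistTensor_natural S g (𝟙 V) f
  associativity := twistTensor_assoc S g
  left_unitality := twistTensor_left_unit S g
  right_unitality := twistTensor_right_unit S g

/-- The functor `V ↦ ^g V` is a tensor functor. -/
@[reducible]
def twistMonoidal (S : GWeakHopf K G H) (g : G) : (twistFunctor S.toWeakAction g).Monoidal :=
  (twistCore S g).toMonoidal

theorem counitalSource_c (S : GWeakHopf K G H) (g h : G) :
    counitalSource K (S.c g h : H) = 1 := by
  have h1 := contractRight_counit_comul (K := K) (S.c g h : H)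
  rw [S.comul_c] at h1
  have h2 : contractRight (counit (R := K)) (((S.c g h : H) ⊗ₜ[K] (S.c g h : H)) *
      comul (R := K) 1) = (S.c g h : H) * counitalSource K (S.c g h : H) := by
    rw [counitalSource_eq]
    induction comul (R := K) (1 : H) using TensorProduct.induction_on with
    | zero => simp
    | add S S' h h' => simp only [map_add, mul_add, h, h']
    | tmul u v => simp
  rw [h2] at h1
  exact (S.c g h).isUnit.mul_left_cancel (by rw [h1, mul_one])

theorem twistComp_unit (S : GWeakHopf K G H) (g h : G) :
    ((twistUnit S g).hom ≫ twistMap S.toWeakAction g (twistUnit S h).hom) ≫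
        (twistCompIso S.toWeakAction g h (unit K H)).hom = (twistUnit S (g * h)).hom :=
  hom_ext fun z => fromTw_injective _ _ _ <| unitIncl_injective (by
    simp only [lin_comp, LinearMap.comp_apply]
    rw [unitIncl_twistUnit, fromTw_twistCompIso, fromTw_twistMap, unit_act, unitIncl_unitPr,
      unitIncl_twistUnit, unitIncl_twistUnit, S.φ_φ_mul_c, mul_inv_rev]
    rw [← counitalSource_mul, counitalSource_c, one_mul]
    obtain ⟨x, rfl⟩ : ∃ x, unitPr x = z := ⟨_, unitPr_unitIncl z⟩
    rw [unitIncl_unitPr, counitalSource_φ, counitalSource_idem])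

theorem twistComp_tensor (S : GWeakHopf K G H) (g h : G) (U V : RMod K H) :
    ((twistTensor S g (twist S.toWeakAction h U) (twist S.toWeakAction h V)).hom ≫
        twistMap S.toWeakAction g (twistTensor S h U V).hom) ≫
        (twistCompIso S.toWeakAction g h (tensor U V)).hom =
      tmap (twistCompIso S.toWeakAction g h U).hom (twistCompIso S.toWeakAction g h V).hom ≫
        (twistTensor S (g * h) U V).hom :=
  hom_ext fun x => fromTw_injective _ _ _ <| incl_injective _ _ (by
    have key (y : tensor U V) : incl U V ((tensor U V).act (S.c h⁻¹ g⁻¹ : H) y) =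
        TensorProduct.map (U.act (S.c h⁻¹ g⁻¹ : H)) (V.act (S.c h⁻¹ g⁻¹ : H)) (incl U V y) := by
      rw [incl_act, S.comul_c, ← comul_one_mul_c, act₂_mul, act₂_incl, act₂_tmul]
    simp only [lin_comp, LinearMap.comp_apply]
    rw [incl_twistTensor, fromTw_twistCompIso, key, fromTw_twistMap, incl_twistTensor,
      incl_twistTensor, incl_tmap]
    generalize incl _ _ x = y
    induction y using TensorProduct.induction_on with
    | zero => simp
    | add S S' h h' => simp only [map_add, h, h']
    | tmul u v => rfl)

theorem twistOne_unit (S : GWeakHopf K G H) :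
    𝟙 (unit K H) ≫ (twistOneIso S.toWeakAction (unit K H)).hom = (twistUnit S 1).hom :=
  hom_ext fun z => fromTw_injective _ _ _ <| unitIncl_injective (by
    rw [unitIncl_twistUnit, inv_one, S.φ_one]
    rfl)

theorem twistOne_tensor (S : GWeakHopf K G H) (U V : RMod K H) :
    𝟙 (tensor U V) ≫ (twistOneIso S.toWeakAction (tensor U V)).hom =
      tmap (twistOneIso S.toWeakAction U).hom (twistOneIso S.toWeakAction V).hom ≫
        (twistTensor S 1 U V).hom :=
  hom_ext fun x => fromTw_injective _ _ _ <| incl_injective _ _ (by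
    simp only [lin_comp, LinearMap.comp_apply]
    rw [incl_twistTensor, incl_tmap]
    change incl U V x = _
    generalize incl _ _ x = y
    induction y using TensorProduct.induction_on with
    | zero => simp
    | add S S' h h' => simpa only [map_add] using congrArg₂ (· + ·) h h'
    | tmul u v => rfl)

end ActMonoidal

section ActCoherence

variable {K G H : Type u} [Field K] [Group G] [Ring H] [Algebra K H]

theorem twistComp_assoc (W : WeakAction K G H) (g h k : G) (V : RMod K H)
    (e : twist W (g * h * k) V = twist W (g * (h * k)) V) :
    (twistCompIso W g h (twist W k V)).hom ≫ (twistCompIso W (g * h) k V).hom ≫ eqToHom e =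
      twistMap W g (twistCompIso W h k V).hom ≫ (twistCompIso W g (h * k) V).hom :=
  hom_ext fun v => fromTw_injective _ _ _ (by
    simp only [lin_comp, LinearMap.comp_apply]
    rw [fromTw_eqToHom W (mul_assoc g h k), fromTw_twistCompIso, fromTw_twistCompIso, fromTw_act,
      fromTw_twistCompIso, fromTw_twistMap, fromTw_twistCompIso, ← act_mul_apply, ← act_mul_apply,
      mul_inv_rev, mul_inv_rev, W.cocycle])

theorem twistOne_left (W : WeakAction K G H) (g : G) (V : RMod K H)
    (e : twist W g V = twist W (1 * g) V) :
    (twistOneIso W (twist W g V)).hom ≫ (twistCompIso W 1 g V).hom = eqToHom e :=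
  hom_ext fun v => fromTw_injective _ _ _ (by
    simp only [lin_comp, LinearMap.comp_apply]
    rw [fromTw_eqToHom W (one_mul g).symm, fromTw_twistCompIso, inv_one, W.c_one_right,
      Units.val_one, act_one_apply]
    rfl)

theorem twistOne_right (W : WeakAction K G H) (g : G) (V : RMod K H)
    (e : twist W g V = twist W (g * 1) V) :
    twistMap W g (twistOneIso W V).hom ≫ (twistCompIso W g 1 V).hom = eqToHom e :=
  hom_ext fun v => fromTw_injective _ _ _ (by
    simp only [lin_comp, LinearMap.comp_apply]
    rw [fromTw_eqToHom W (mul_one g).symm, fromTw_twistCompIso, fromTw_twistMap, inv_one,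
      W.c_one_left, Units.val_one, act_one_apply]
    rfl)

end ActCoherence

end RMod

/-! #### The grading of `H-mod` -/

section GradedAlgebra

variable {K G H : Type u} [Field K] [Ring H] [Algebra K H]

theorem exists_units_of_grading (A : G → Submodule K H) (hA : ⨆ g, A g = ⊤) :
    ∃ e : G →₀ H, (∀ g, e g ∈ A g) ∧ ∑ g ∈ e.support, e g = 1 := by
  have h1 : (1 : H) ∈ iSup A := by rw [hA]; trivial
  obtain ⟨f, hf, h⟩ := (Submodule.mem_iSup_iff_exists_finsupp A 1).1 h1
  exact ⟨f, hf, h⟩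

theorem sum_unit_mul (A : G → Submodule K H)
    (hne : ∀ {g h : G}, g ≠ h → ∀ {a b : H}, a ∈ A g → b ∈ A h → a * b = 0) (e : G →₀ H)
    (he : ∀ g, e g ∈ A g) {g : G} {a : H} (ha : a ∈ A g) :
    (∑ h ∈ e.support, e h) * a = e g * a := by
  rw [Finset.sum_mul]
  refine Finset.sum_eq_single g (fun h _ hh => hne hh (he h) ha) fun hg => ?_
  rw [Finsupp.notMem_support_iff.1 hg, zero_mul]

theorem mul_sum_unit (A : G → Submodule K H)
    (hne : ∀ {g h : G}, g ≠ h → ∀ {a b : H}, a ∈ A g → b ∈ A h → a * b = 0) (e : G →₀ H)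
    (he : ∀ g, e g ∈ A g) {g : G} {a : H} (ha : a ∈ A g) :
    a * (∑ h ∈ e.support, e h) = a * e g := by
  rw [Finset.mul_sum]
  refine Finset.sum_eq_single g (fun h _ hh => hne hh.symm ha (he h)) fun hg => ?_
  rw [Finsupp.notMem_support_iff.1 hg, mul_zero]

theorem iSupIndep_of_grading (A : G → Submodule K H) (hA : ⨆ g, A g = ⊤)
    (hne : ∀ {g h : G}, g ≠ h → ∀ {a b : H}, a ∈ A g → b ∈ A h → a * b = 0) : iSupIndep A := by
  obtain ⟨e, he, h1⟩ := exists_units_of_grading A hA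
  intro g
  rw [Submodule.disjoint_def]
  intro x hx hx'
  have h2 : e g * x = 0 := by
    have hle : (⨆ j, ⨆ (_ : j ≠ g), A j) ≤ LinearMap.ker (LinearMap.mulLeft K (e g)) :=
      iSup_le fun j => iSup_le fun hj => fun y hy => hne hj.symm (he g) hy
    exact hle hx'
  rw [← one_mul x, ← h1, sum_unit_mul A hne e he hx, h2]

end GradedAlgebra

namespace GWeakHopf

variable {K G H : Type u} [Field K] [Group G] [Ring H] [Algebra K H] [Coalgebra K H]
variable [WeakHopfAlgebra K H] (S : GWeakHopf K G H)

/-- The unit `1_g` of the component `H_g`. -/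
def gunit : G →₀ H := (exists_units_of_grading S.grading S.grading_iSup).choose

theorem gunit_mem (g : G) : S.gunit g ∈ S.grading g :=
  (exists_units_of_grading S.grading S.grading_iSup).choose_spec.1 g

theorem sum_gunit : ∑ g ∈ S.gunit.support, S.gunit g = 1 :=
  (exists_units_of_grading S.grading S.grading_iSup).choose_spec.2

theorem gunit_mul {g : G} {a : H} (ha : a ∈ S.grading g) : S.gunit g * a = a := by
  rw [← sum_unit_mul S.grading S.grading_mul_ne S.gunit S.gunit_mem ha, sum_gunit, one_mul]

theorem mul_gunit {g : G} {a : H} (ha : a ∈ S.grading g) : a * S.gunit g = a := by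
  rw [← mul_sum_unit S.grading S.grading_mul_ne S.gunit S.gunit_mem ha, sum_gunit, mul_one]

theorem grading_induction {motive : H → Prop} (mem : ∀ g, ∀ a ∈ S.grading g, motive a)
    (zero : motive 0) (add : ∀ a b, motive a → motive b → motive (a + b)) (a : H) : motive a :=
  Submodule.iSup_induction S.grading (x := a) (by rw [S.grading_iSup]; trivial) mem zero add

theorem gunit_comm (g : G) (a : H) : S.gunit g * a = a * S.gunit g := by
  refine S.grading_induction (motive := fun a => S.gunit g * a = a * S.gunit g)
    (fun h a ha => ?_) (by simp) (fun a b ha hb => by rw [mul_add, add_mul, ha, hb]) a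
  by_cases hgh : g = h
  · subst hgh
    rw [S.gunit_mul ha, S.mul_gunit ha]
  · rw [S.grading_mul_ne hgh (S.gunit_mem g) ha, S.grading_mul_ne (Ne.symm hgh) ha (S.gunit_mem g)]

theorem mul_mem_left {g : G} {a : H} (ha : a ∈ S.grading g) (b : H) : b * a ∈ S.grading g := by
  refine S.grading_induction (motive := fun b => b * a ∈ S.grading g) (fun h b hb => ?_)
    (by simp) (fun b c hb hc => by rw [add_mul]; exact add_mem hb hc) b
  by_cases hgh : h = g
  · subst hgh
    exact S.grading_mul hb ha
  · rw [S.grading_mul_ne hgh hb ha]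
    exact zero_mem _

theorem mul_mem_right {g : G} {a : H} (ha : a ∈ S.grading g) (b : H) : a * b ∈ S.grading g := by
  refine S.grading_induction (motive := fun b => a * b ∈ S.grading g) (fun h b hb => ?_)
    (by simp) (fun b c hb hc => by rw [mul_add]; exact add_mem hb hc) b
  by_cases hgh : g = h
  · subst hgh
    exact S.grading_mul ha hb
  · rw [S.grading_mul_ne hgh ha hb]
    exact zero_mem _

/-- A linear map vanishes on `Δ(H_g)` if it vanishes on `H_p ⊗ H_q` for all `pq = g`. -/
theorem comul_induction {M : Type u} [AddCommGroup M] [Module K M] (L : H ⊗[K] H →ₗ[K] M) {g : G}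
    {x : H} (hx : x ∈ S.grading g)
    (h : ∀ p q, p * q = g → ∀ a ∈ S.grading p, ∀ b ∈ S.grading q, L (a ⊗ₜ b) = 0) :
    L (comul (R := K) x) = 0 := by
  have hle : (⨆ (p : G) (q : G) (_ : p * q = g), LinearMap.range
      (TensorProduct.mapIncl (S.grading p) (S.grading q))) ≤ LinearMap.ker L := by
    refine iSup_le fun p => iSup_le fun q => iSup_le fun hpq => ?_
    rintro _ ⟨y, rfl⟩
    rw [LinearMap.mem_ker]
    induction y using TensorProduct.induction_on with
    | zero => simp
    | add y z hy hz => simp only [map_add, hy, hz, add_zero]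
    | tmul a b => exact h p q hpq a a.2 b b.2
  exact hle (S.grading_comul hx)

theorem contractLeft_gunit (x : H) :
    contractLeft (counitMul K (S.gunit 1)) (comul (R := K) x) = x := by
  refine S.grading_induction (motive := fun x => contractLeft (counitMul K (S.gunit 1))
    (comul (R := K) x) = x) (fun g x hx => ?_) (by simp) (fun a b ha hb => by rw [map_add, map_add, ha, hb]) x
  have key := S.comul_induction (contractLeft (counitMul K (S.gunit 1)) -
    LinearMap.mulLeft K (S.gunit g) ∘ₗ contractLeft (counit (R := K))) hx
    (fun p q hpq a ha b hb => by
      simp only [LinearMap.sub_apply, contractLeft_tmul, counitMul_apply, LinearMap.comp_apply,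
        LinearMap.mulLeft_apply, mul_smul_comm]
      by_cases hp : p = 1
      · subst hp
        rw [one_mul] at hpq
        subst hpq
        rw [S.gunit_mul ha, S.gunit_mul hb, sub_self]
      · have hq : g ≠ q := fun h => hp (by rw [h] at hpq; simpa using hpq)
        rw [S.grading_mul_ne (Ne.symm hp) (S.gunit_mem 1) ha,
          S.grading_mul_ne hq (S.gunit_mem g) hb]
        simp)
  rw [LinearMap.sub_apply, sub_eq_zero, LinearMap.comp_apply, contractLeft_counit_comul,
    LinearMap.mulLeft_apply, S.gunit_mul hx] at key
  exact key

theorem counit_grading {g : G} (hg : g ≠ 1) {x : H} (hx : x ∈ S.grading g) :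
    counit (R := K) x = 0 := by
  have swap (f f' : H →ₗ[K] K) (T : H ⊗[K] H) : f (contractRight f' T) = f' (contractLeft f T) := by
    induction T using TensorProduct.induction_on with
    | zero => simp
    | add y z hy hz => simp only [map_add, hy, hz]
    | tmul a b => simp [mul_comm]
  have h1 := swap (counitMul K (S.gunit 1)) (counit (R := K)) (comul (R := K) x)
  rw [S.contractLeft_gunit, contractRight_counit_comul, counitMul_apply,
    S.grading_mul_ne (Ne.symm hg) (S.gunit_mem 1) hx, map_zero] at h1
  exact h1.symm

/-- The component `(H-mod)_g = H_g-mod`: the modules on which all `H_h`, `h ≠ g`, act as zero. -/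
def deg (g : G) : ObjectProperty (RMod K H) :=
  fun V => ∀ h, h ≠ g → ∀ a ∈ S.grading h, ∀ v : V, V.act a v = 0

theorem act_gunit {g : G} {V : RMod K H} (hV : S.deg g V) (v : V) : V.act (S.gunit g) v = v := by
  have h1 : V.act (∑ h ∈ S.gunit.support, S.gunit h) v = v := by
    rw [S.sum_gunit, RMod.act_one_apply]
  rw [map_sum, LinearMap.sum_apply, Finset.sum_eq_single g] at h1
  · exact h1
  · exact fun h _ hh => hV h hh _ (S.gunit_mem h) v
  · intro hg
    rw [Finsupp.notMem_support_iff.1 hg]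
    simp

theorem deg_unit : S.deg 1 (RMod.unit K H) := fun h hh a ha z => RMod.unitIncl_injective (by
  rw [RMod.unit_act, RMod.unitIncl_unitPr, counitalSource_eq, map_zero]
  have : counitMul K (RMod.unitIncl z * a) = 0 := by
    ext w
    exact S.counit_grading hh (S.mul_mem_right (S.mul_mem_left ha _) _)
  rw [this]
  simp [contractRight])

theorem deg_tensor {g h : G} {V W : RMod K H} (hV : S.deg g V) (hW : S.deg h W) :
    S.deg (g * h) (RMod.tensor V W) := fun k hk a ha x => RMod.incl_injective _ _ (by
  rw [RMod.incl_act, map_zero]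
  have key := S.comul_induction (RMod.act₂ V W) ha (fun p q hpq a ha b hb => by
    rw [RMod.act₂_tmul]
    ext v w
    simp only [TensorProduct.AlgebraTensorModule.curry_apply, TensorProduct.curry_apply,
      LinearMap.coe_restrictScalars, TensorProduct.map_tmul, LinearMap.zero_apply]
    by_cases hp : p = g
    · have hq : q ≠ h := fun hq => hk (by rw [← hpq, hp, hq])
      rw [hW q hq b hb w, TensorProduct.tmul_zero]
    · rw [hV p hp a ha v, TensorProduct.zero_tmul])
  rw [key, LinearMap.zero_apply])

theorem deg_act (g : G) {h : G} {V : RMod K H} (hV : S.deg h V) :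
    S.deg (g * h * g⁻¹) (RMod.twist S.toWeakAction g V) := fun k hk a ha v =>
  RMod.fromTw_injective _ _ _ (by
    rw [RMod.fromTw_act, map_zero]
    refine hV _ (fun h1 => hk ?_) _ (S.grading_φ g⁻¹ ha) _
    rw [← h1]
    group)

theorem deg_hom {g h : G} (hgh : g ≠ h) {V W : RMod K H} (hV : S.deg g V) (hW : S.deg h W)
    (f : V ⟶ W) : f = 0 := RMod.hom_ext fun v => by
  rw [← S.act_gunit hV v, RMod.lin_act, hW g hgh _ (S.gunit_mem g)]
  rfl

theorem deg_iso (g : G) : (S.deg g).IsClosedUnderIsomorphisms where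
  of_iso {V W} e hV := fun h hh a ha w => by
    have h1 : RMod.lin e.hom (RMod.lin e.inv w) = w := by
      rw [← LinearMap.comp_apply, ← RMod.lin_comp, e.inv_hom_id]; rfl
    rw [← h1, ← RMod.lin_act, hV h hh a ha, map_zero]

/-- The component `V.1_g` of a module. -/
def component (V : RMod K H) (g : G) : RMod K H where
  carrier := LinearMap.range (V.act (S.gunit g))
  act :=
    { toFun := fun a => (V.act (S.gunit g)).rangeRestrict ∘ₗ V.act a ∘ₗ
        (LinearMap.range (V.act (S.gunit g))).subtype
      map_add' := fun a b => by simp [LinearMap.add_comp, LinearMap.comp_add]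
      map_smul' := fun a b => by simp [LinearMap.smul_comp, LinearMap.comp_smul] }
  act_one := by
    ext ⟨_, x, rfl⟩
    simp [← RMod.act_mul_apply, S.gunit_mul (S.gunit_mem g)]
  act_mul a b := by
    refine LinearMap.ext ?_
    rintro ⟨_, x, rfl⟩
    refine Subtype.ext ?_
    change V.act (S.gunit g) (V.act (a * b) (V.act (S.gunit g) x)) =
      V.act (S.gunit g) (V.act b (V.act (S.gunit g) (V.act a (V.act (S.gunit g) x))))
    simp only [← RMod.act_mul_apply]
    rw [S.gunit_comm g a, mul_assoc a (S.gunit g) (S.gunit g), S.mul_gunit (S.gunit_mem g),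
      ← S.gunit_comm g a, mul_assoc (S.gunit g) a b]

/-- The inclusion of a component. -/
def componentι (V : RMod K H) (g : G) : S.component V g ⟶ V :=
  RMod.ofLin (LinearMap.range (V.act (S.gunit g))).subtype (by
    rintro a ⟨_, x, rfl⟩
    change V.act (S.gunit g) (V.act a (V.act (S.gunit g) x)) = V.act a (V.act (S.gunit g) x)
    rw [← RMod.act_mul_apply, ← RMod.act_mul_apply, ← RMod.act_mul_apply,
      S.gunit_comm g (a * S.gunit g), mul_assoc, S.mul_gunit (S.gunit_mem g), S.gunit_comm g a])

/-- The projection to a component. -/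
def componentπ (V : RMod K H) (g : G) : V ⟶ S.component V g :=
  RMod.ofLin (V.act (S.gunit g)).rangeRestrict (fun a v => Subtype.ext (by
    change V.act (S.gunit g) (V.act a v) =
      V.act (S.gunit g) (V.act a (V.act (S.gunit g) v))
    rw [← RMod.act_mul_apply, ← RMod.act_mul_apply, ← RMod.act_mul_apply,
      S.gunit_comm g (a * S.gunit g), mul_assoc, S.mul_gunit (S.gunit_mem g)]))

theorem deg_component (V : RMod K H) (g : G) : S.deg g (S.component V g) := by
  rintro h hh a ha ⟨_, x, rfl⟩
  refine Subtype.ext ?_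
  change V.act (S.gunit g) (V.act a (V.act (S.gunit g) x)) = 0
  rw [← RMod.act_mul_apply, ← RMod.act_mul_apply, S.grading_mul_ne hh ha (S.gunit_mem g)]
  simp

open Classical in
theorem deg_decomp [Finite G] (V : RMod K H) : ∃ Y : G → RMod K H, (∀ g, S.deg g (Y g)) ∧
    ∃ b : Limits.Bicone Y, Nonempty b.IsBilimit ∧ Nonempty (b.pt ≅ V) := by
  have := Fintype.ofFinite G
  refine ⟨S.component V, S.deg_component V,
    { pt := V
      π := S.componentπ V
      ι := S.componentι V
      ι_π := fun g h => ?_ }, ⟨Limits.isBilimitOfTotal _ ?_⟩, ⟨Iso.refl _⟩⟩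
  · split_ifs with hgh
    · subst hgh
      refine RMod.hom_ext ?_
      rintro ⟨_, x, rfl⟩
      refine Subtype.ext ?_
      change V.act (S.gunit g) (V.act (S.gunit g) x) = V.act (S.gunit g) x
      rw [← RMod.act_mul_apply, S.gunit_mul (S.gunit_mem g)]
    · exact S.deg_hom hgh (S.deg_component V g) (S.deg_component V h) _
  · refine RMod.hom_ext fun v => ?_
    have hl : RMod.lin (∑ j : G, S.componentπ V j ≫ S.componentι V j) =
        ∑ j : G, V.act (S.gunit j) := by
      have : ∀ s : Finset G, RMod.lin (∑ j ∈ s, S.componentπ V j ≫ S.componentι V j) =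
          ∑ j ∈ s, V.act (S.gunit j) := fun s => by
        induction s using Finset.induction_on with
        | empty => simp
        | insert a s ha ih => rw [Finset.sum_insert ha, Finset.sum_insert ha, RMod.lin_add, ih]; rfl
      exact this _
    change RMod.lin (∑ j : G, S.componentπ V j ≫ S.componentι V j) v = v
    rw [hl, ← map_sum, ← Finset.sum_subset (Finset.subset_univ S.gunit.support), S.sum_gunit,
      RMod.act_one_apply]
    intro x _ hx
    exact Finsupp.notMem_support_iff.1 hx

/-- The `G`-equivariant tensor category `H-mod`. -/
def equivariant [Finite G] : GEquivariantStructure K G (RMod K H) where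
  act := RMod.twistFunctor S.toWeakAction
  act_additive g := inferInstance
  act_linear g := inferInstance
  actMonoidal := RMod.twistMonoidal S
  actComp := RMod.twistComp S.toWeakAction
  actComp_isMonoidal g h :=
    letI := RMod.twistMonoidal S
    { unit := RMod.twistComp_unit S g h
      tensor := RMod.twistComp_tensor S g h }
  actOne := RMod.twistOne S.toWeakAction
  actOne_isMonoidal :=
    letI := RMod.twistMonoidal S
    { unit := RMod.twistOne_unit S
      tensor := RMod.twistOne_tensor S }
  actComp_assoc g h k V := RMod.twistComp_assoc S.toWeakAction g h k V _
  actOne_left g V := RMod.twistOne_left S.toWeakAction g V _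
  actOne_right g V := RMod.twistOne_right S.toWeakAction g V _
  deg := S.deg
  deg_iso := S.deg_iso
  deg_hom := S.deg_hom
  deg_decomp := S.deg_decomp
  deg_unit := S.deg_unit
  deg_tensor := S.deg_tensor
  deg_act := S.deg_act

end GWeakHopf

/-! ### `G`-weak ribbon algebras -/

/-- A `G`-weak ribbon algebra: a `G`-weak Hopf algebra with a `G`-equivariant `R`-matrix and a
`G`-twist. The `R`-matrix is normalized by `R = Δ(1) R` and, on the component `H_g` of the first
leg, by `R = R (id ⊗ φ_{g⁻¹})(Δ^op(1))`: this says that `R` maps `V ⊗ W` through its summand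
`V ⊗̄ W` into the summand `^g W ⊗̄ V` of `W ⊗ V`, and it is empty if `Δ(1) = 1 ⊗ 1`.
The `G`-braiding `c_{V,W} : V ⊗̄ W ≅ ^g W ⊗̄ V` for `V ∈ (H-mod)_g` is
`v ⊗ w ↦ w.R₂ ⊗ v.R₁` and the `G`-twist `θ_V : V ≅ ^g V` is `v ↦ v.θ⁻¹`. -/
structure GRibbonAlgebra {K G H : Type u} [Field K] [Group G] [Finite G] [Ring H] [Algebra K H]
    [Coalgebra K H] [WeakHopfAlgebra K H] (S : GWeakHopf K G H) where
  R : H ⊗[K] H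
  comul_one_mul_R : comul (R := K) 1 * R = R
  R_mul_comul_one {g : G} {a : H} (ha : a ∈ S.grading g) :
    (a ⊗ₜ[K] 1) * R * TensorProduct.map LinearMap.id (S.φ g⁻¹).toLinearMap
      (TensorProduct.comm K H H (comul (R := K) 1)) = (a ⊗ₜ[K] 1) * R
  θ : Hˣ
  braiding : GBraiding S.equivariant
  braiding_apply {g : G} {V : RMod K H} (hV : S.deg g V) (W : RMod K H)
    (x : RMod.tensor V W) :
    TensorProduct.map (RMod.fromTw S.toWeakAction g W) LinearMap.id
        (RMod.incl (RMod.twist S.toWeakAction g W) V (RMod.lin (braiding.braid hV W).hom x)) =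
      TensorProduct.comm K V W (RMod.act₂ V W R (RMod.incl V W x))
  twist : GTwist braiding
  twist_apply {g : G} {V : RMod K H} (hV : S.deg g V) (v : V) :
    RMod.fromTw S.toWeakAction g V (RMod.lin (twist.twist hV).hom v) = V.act (θ⁻¹ : Hˣ) v

/-- The `G`-ribbon category of modules over a `G`-weak ribbon algebra; dualities are a property. -/
def GRibbonAlgebra.ribbonStructure {K G H : Type u} [Field K] [Group G] [Finite G] [Ring H]
    [Algebra K H] [Coalgebra K H] [WeakHopfAlgebra K H] {S : GWeakHopf K G H}
    (R : GRibbonAlgebra S) (hd : HasDuals (RMod K H)) : GRibbonStructure S.equivariant where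
  hasDuals := hd
  braiding := R.braiding
  twist := R.twist

/-! ### Hopf algebras as weak Hopf algebras -/

section Hopf

variable {K A : Type u} [Field K] [Ring A] [HopfAlgebra K A]

theorem counit_counit_comul (a : A) : LinearMap.mul' K K (TensorProduct.map (counit (R := K))
    (counit (R := K)) (comul (R := K) a)) = counit (R := K) a := by
  have key (T : A ⊗[K] A) : LinearMap.mul' K K (TensorProduct.map (counit (R := K))
      (counit (R := K)) T) = counit (R := K) (contractLeft (counit (R := K)) T) := by
    induction T using TensorProduct.induction_on with
    | zero => simp
    | add a b ha hb => simp only [map_add, ha, hb]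
    | tmul a b => simp
  rw [key, contractLeft_counit_comul]

/-- A Hopf algebra is a weak Hopf algebra. -/
instance hopfWeakHopf : WeakHopfAlgebra K A where
  comul_mul := Bialgebra.comul_mul
  comul_one_left := by simp [Algebra.TensorProduct.one_def]
  comul_one_right := by simp [Algebra.TensorProduct.one_def]
  counit_mul_left x y z := by
    rw [Bialgebra.counit_mul, Bialgebra.counit_mul, ← counit_counit_comul y]
    induction comul (R := K) y using TensorProduct.induction_on with
    | zero => simp
    | add a b ha hb => simp only [map_add, mul_add, add_mul, ha, hb]
    | tmul a b => simp; ring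
  counit_mul_right x y z := by
    rw [Bialgebra.counit_mul, Bialgebra.counit_mul, ← counit_counit_comul y]
    induction comul (R := K) y using TensorProduct.induction_on with
    | zero => simp
    | add a b ha hb => simp only [map_add, mul_add, add_mul, ha, hb]
    | tmul a b => simp; ring
  antipode := HopfAlgebra.antipode K
  mul_antipode_right h := by
    rw [HopfAlgebra.mul_antipode_lTensor_comul_apply]
    simp [counitalTarget, Algebra.algebraMap_eq_smul_one]
  mul_antipode_left h := by
    rw [HopfAlgebra.mul_antipode_rTensor_comul_apply]
    simp [counitalSource, Algebra.algebraMap_eq_smul_one]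
  antipode_mul_antipode h := by
    rw [HopfAlgebra.mul_antipode_lTensor_comul]
    conv_rhs => rw [← contractRight_counit_comul (K := K) h]
    induction comul (R := K) h using TensorProduct.induction_on with
    | zero => simp
    | add a b ha hb => simp only [map_add, ha, hb]
    | tmul a b => simp [Algebra.algebraMap_eq_smul_one]

end Hopf

/-! ### The strictification -/

/-- The vector space `A^str = K(G) ⊗ A ⊗ K[G]`, written as the direct sum of the subspaces
`δ_g ⊗ A ⊗ h` with `(g, h) ∈ G × G`. -/
def Strict {K G A : Type u} [Field K] [Group G] [Ring A] [HopfAlgebra K A]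
    (S : GWeakHopf K G A) : Type u := (G × G) →₀ A

namespace Strict

section Algebra

variable {K G A : Type u} [Field K] [Group G] [Ring A] [HopfAlgebra K A] (S : GWeakHopf K G A)

instance : AddCommGroup (Strict S) := inferInstanceAs (AddCommGroup ((G × G) →₀ A))

instance : Module K (Strict S) := inferInstanceAs (Module K ((G × G) →₀ A))

/-- The coalgebra `K(G) ⊗ A ⊗ K[G]`, with the diagonal coproduct on the outer factors. -/
instance : Coalgebra K (Strict S) := inferInstanceAs (Coalgebra K ((G × G) →₀ A))

/-- The map `a ↦ δ_g ⊗ a ⊗ h`. -/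
def of (g h : G) : A →ₗ[K] Strict S := Finsupp.lsingle (g, h)

variable {S} in
theorem induction {motive : Strict S → Prop} (x : Strict S) (zero : motive 0)
    (add : ∀ x y, motive x → motive y → motive (x + y))
    (of : ∀ g h a, motive (of S g h a)) : motive x :=
  Finsupp.induction_linear (motive := motive) x zero add fun p a => of p.1 p.2 a

theorem lin_ext {M : Type u} [AddCommGroup M] [Module K M] {f f' : Strict S →ₗ[K] M}
    (h : ∀ g h a, f (of S g h a) = f' (of S g h a)) : f = f' :=
  Finsupp.lhom_ext fun p a => h p.1 p.2 a

/-- A linear map out of `A^str`, given on the subspaces `δ_g ⊗ A ⊗ h`. -/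
def lift {M : Type u} [AddCommGroup M] [Module K M] (f : G → G → A →ₗ[K] M) : Strict S →ₗ[K] M :=
  Finsupp.lsum K fun p => f p.1 p.2

@[simp]
theorem lift_of {M : Type u} [AddCommGroup M] [Module K M] (f : G → G → A →ₗ[K] M) (g h : G)
    (a : A) : lift S f (of S g h a) = f g h a := Finsupp.lsum_single _ _ _ _

theorem comul_of (g h : G) (a : A) : comul (R := K) (of S g h a) =
    TensorProduct.map (of S g h) (of S g h) (comul (R := K) a) :=
  Finsupp.comul_single K (G × G) A (g, h) a

@[simp]
theorem counit_of (g h : G) (a : A) : counit (R := K) (of S g h a) = counit (R := K) a :=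
  Finsupp.counit_single K (G × G) A (g, h) a

open Classical in
/-- The product
`(δ_g ⊗ a ⊗ h)(δ_p ⊗ b ⊗ q) = δ(gq, p) (δ_p ⊗ a φ_h(b) c_{h,q} ⊗ hq)`. -/
def mulLin : Strict S →ₗ[K] Strict S →ₗ[K] Strict S :=
  lift S fun g h => LinearMap.flip (lift S fun g' h' => LinearMap.flip (if g * h' = g' then
    ((LinearMap.mul K A).compr₂ (of S g' (h * h') ∘ₗ LinearMap.mulRight K (S.c h h' : A))).compl₂
      (S.φ h).toLinearMap else 0))

open Classical in
theorem mulLin_of (g h : G) (a : A) (g' h' : G) (a' : A) :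
    mulLin S (of S g h a) (of S g' h' a') =
      if g * h' = g' then of S g' (h * h') (a * S.φ h a' * S.c h h') else 0 := by
  rw [mulLin, lift_of, LinearMap.flip_apply, lift_of, LinearMap.flip_apply]
  split_ifs <;> rfl

instance : Mul (Strict S) := ⟨fun x y => mulLin S x y⟩

theorem mul_def (x y : Strict S) : x * y = mulLin S x y := rfl

open Classical in
theorem of_mul_of (g h : G) (a : A) (g' h' : G) (a' : A) :
    of S g h a * of S g' h' a' =
      if g * h' = g' then of S g' (h * h') (a * S.φ h a' * S.c h h') else 0 :=
  mulLin_of S g h a g' h' a'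

/-- The unit `1 = ∑_g δ_g ⊗ 1 ⊗ 1`. -/
instance [Fintype G] : One (Strict S) := ⟨∑ g : G, of S g 1 1⟩

theorem one_def [Fintype G] : (1 : Strict S) = ∑ g : G, of S g 1 1 := rfl

theorem mulLin_sum_left {ι : Type u} (s : Finset ι) (f : ι → Strict S) (x : Strict S) :
    mulLin S (∑ i ∈ s, f i) x = ∑ i ∈ s, mulLin S (f i) x := by
  rw [map_sum, LinearMap.sum_apply]

instance [Fintype G] : Ring (Strict S) :=
  { (inferInstance : AddCommGroup (Strict S)) with
    mul := (· * ·)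
    one := 1
    left_distrib := fun x y z => map_add (mulLin S x) y z
    right_distrib := fun x y z => by simp only [mul_def, map_add, LinearMap.add_apply]
    zero_mul := fun x => by simp only [mul_def, map_zero, LinearMap.zero_apply]
    mul_zero := fun x => by simp only [mul_def, map_zero]
    mul_assoc := fun x y z => by
      classical
      simp only [mul_def]
      induction x using induction with
      | zero => simp only [map_zero, LinearMap.zero_apply]
      | add x x' h h' => simp only [map_add, LinearMap.add_apply, h, h']
      | of g h a =>
      induction y using induction with
      | zero => simp only [map_zero, LinearMap.zero_apply]
      | add x x' h h' => simp only [map_add, LinearMap.add_apply, h, h']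
      | of g' h' a' =>
      induction z using induction with
      | zero => simp only [map_zero]
      | add x x' h h' => simp only [map_add, h, h']
      | of g'' h'' a'' =>
      rw [mulLin_of, mulLin_of]
      by_cases h1 : g * h' = g'
      · by_cases h2 : g' * h'' = g''
        · rw [if_pos h1, if_pos h2, mulLin_of, mulLin_of, if_pos h2, if_pos (by rw [← h2, ← h1, mul_assoc]),
            mul_assoc h]
          congr 1
          simp only [map_mul, mul_assoc]
          rw [S.cocycle]
          simp only [← mul_assoc]
          rw [mul_assoc (a * S.φ h a') (S.φ h (S.φ h' a'')), S.φ_φ_mul_c]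
          simp only [← mul_assoc]
        · rw [if_pos h1, if_neg h2, mulLin_of, if_neg h2, map_zero]
      · rw [if_neg h1, map_zero, LinearMap.zero_apply]
        split_ifs with h2
        · rw [mulLin_of, if_neg (by rw [← h2, ← mul_assoc]; exact fun h3 => h1 (mul_right_cancel h3))]
        · rw [map_zero]
    one_mul := fun x => by
      classical
      simp only [mul_def]
      induction x using induction with
      | zero => simp only [map_zero]
      | add x x' h h' => simp only [map_add, h, h']
      | of g h a =>
        rw [one_def, mulLin_sum_left, Finset.sum_eq_single (g * h⁻¹)]
        · rw [mulLin_of, if_pos (by group), S.φ_one, S.c_one_left]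
          simp
        · intro k _ hk
          rw [mulLin_of, if_neg (fun h1 => hk (by rw [← h1]; group))]
        · simp
    mul_one := fun x => by
      classical
      simp only [mul_def]
      induction x using induction with
      | zero => simp only [map_zero, LinearMap.zero_apply]
      | add x x' h h' => simp only [map_add, LinearMap.add_apply, h, h']
      | of g h a =>
        rw [one_def, map_sum, Finset.sum_eq_single g]
        · rw [mulLin_of, if_pos (by group), S.c_one_right]
          simp
        · intro k _ hk
          rw [mulLin_of, if_neg (fun h1 => hk (by rw [← h1]; group))]
        · simp }

instance [Fintype G] : Algebra K (Strict S) :=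
  Algebra.ofModule (fun r x y => by simp only [mul_def, map_smul, LinearMap.smul_apply])
    (fun r x y => by simp only [mul_def, map_smul])

end Algebra

section WeakHopf

variable {K G A : Type u} [Field K] [Group G] [Fintype G] [Ring A] [HopfAlgebra K A]
variable (S : GWeakHopf K G A)

open Classical in
theorem map_of_mul_map_of (g h g' h' : G) (T T' : A ⊗[K] A) :
    TensorProduct.map (of S g h) (of S g h) T * TensorProduct.map (of S g' h') (of S g' h') T' =
      if g * h' = g' then TensorProduct.map (of S g' (h * h')) (of S g' (h * h'))
        (T * TensorProduct.map (S.φ h).toLinearMap (S.φ h).toLinearMap T' *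
          ((S.c h h' : A) ⊗ₜ[K] (S.c h h' : A))) else 0 := by
  induction T using TensorProduct.induction_on with
  | zero => simp
  | add x y hx hy => simp only [map_add, add_mul, hx, hy]; split_ifs <;> simp
  | tmul a b =>
    induction T' using TensorProduct.induction_on with
    | zero => simp
    | add x y hx hy => simp only [map_add, add_mul, mul_add, hx, hy]; split_ifs <;> simp
    | tmul a' b' =>
      simp only [TensorProduct.map_tmul, Algebra.TensorProduct.tmul_mul_tmul, of_mul_of,
        AlgEquiv.toLinearMap_apply]
      split_ifs <;> simp

theorem counit_c (g h : G) : counit (R := K) (S.c g h : A) = 1 := by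
  have h1 := contractLeft_counit_comul (K := K) (S.c g h : A)
  rw [S.comul_c, Bialgebra.comul_one, mul_one, contractLeft_tmul] at h1
  have h2 : (counit (R := K) (S.c g h : A) • (S.c g h : A)) * ((S.c g h)⁻¹ : Aˣ) = 1 := by
    rw [h1, Units.mul_inv]
  rw [smul_mul_assoc, Units.mul_inv] at h2
  have h3 := congrArg (counit (R := K)) h2
  simpa using h3

open Classical in
theorem counit_of_mul_of (g h : G) (a : A) (g' h' : G) (a' : A) :
    counit (R := K) (of S g h a * of S g' h' a') =
      if g * h' = g' then counit (R := K) a * counit (R := K) a' else 0 := by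
  rw [of_mul_of]
  split_ifs
  · rw [counit_of, Bialgebra.counit_mul, Bialgebra.counit_mul, S.counit_φ, counit_c, mul_one]
  · simp

theorem comul_one : comul (R := K) (1 : Strict S) = ∑ g : G, of S g 1 1 ⊗ₜ[K] of S g 1 1 := by
  rw [one_def, map_sum]
  exact Finset.sum_congr rfl fun g _ => by
    rw [comul_of, Bialgebra.comul_one, Algebra.TensorProduct.one_def, TensorProduct.map_tmul]

open Classical in
theorem unit_mul_of (k g h : G) (a : A) :
    of S k 1 1 * of S g h a = if k * h = g then of S g h a else 0 := by
  rw [of_mul_of]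
  split_ifs
  · rw [S.φ_one, S.c_one_left]
    simp
  · rfl

open Classical in
theorem of_mul_unit (k g h : G) (a : A) :
    of S g h a * of S k 1 1 = if g = k then of S k h a else 0 := by
  rw [of_mul_of, mul_one]
  split_ifs
  · rw [S.c_one_right]
    simp
  · rfl

instance : WeakBialgebra K (Strict S) where
  comul_mul x y := by
    classical
    induction x using induction with
    | zero => simp
    | add x x' h h' => simp only [map_add, add_mul, h, h']
    | of g h a =>
    induction y using induction with
    | zero => simp
    | add x x' h h' => simp only [map_add, mul_add, h, h']
    | of g' h' a' =>
    rw [comul_of, comul_of, map_of_mul_map_of, of_mul_of]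
    split_ifs
    · rw [comul_of, Bialgebra.comul_mul, Bialgebra.comul_mul, S.comul_φ, S.comul_c,
        Bialgebra.comul_one, mul_one]
    · simp
  comul_one_left := by
    classical
    rw [comul_one]
    simp only [map_sum, LinearMap.rTensor_tmul, comul_of, Bialgebra.comul_one,
      Algebra.TensorProduct.one_def, TensorProduct.map_tmul, TensorProduct.assoc_tmul,
      TensorProduct.sum_tmul, TensorProduct.tmul_sum, Finset.sum_mul, Finset.mul_sum,
      Algebra.TensorProduct.tmul_mul_tmul, of_mul_unit, mul_one, one_mul]
    simp [TensorProduct.ite_tmul, TensorProduct.tmul_ite]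
  comul_one_right := by
    classical
    rw [comul_one]
    simp only [map_sum, LinearMap.rTensor_tmul, comul_of, Bialgebra.comul_one,
      Algebra.TensorProduct.one_def, TensorProduct.map_tmul, TensorProduct.assoc_tmul,
      TensorProduct.sum_tmul, TensorProduct.tmul_sum, Finset.sum_mul, Finset.mul_sum,
      Algebra.TensorProduct.tmul_mul_tmul, of_mul_unit, mul_one, one_mul]
    simp [TensorProduct.ite_tmul, TensorProduct.tmul_ite]
  counit_mul_left x y z := by
    classical
    induction x using induction with
    | zero => simp
    | add x x' h h' => simp only [map_add, add_mul, TensorProduct.add_tmul, h, h']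
    | of g h a =>
    induction z using induction with
    | zero => simp
    | add x x' h h' => simp only [map_add, mul_add, TensorProduct.tmul_add, h, h']
    | of g'' h'' a'' =>
    induction y using induction with
    | zero => simp
    | add x x' h h' => simp only [map_add, mul_add, add_mul, h, h']
    | of g' h' a' =>
    rw [comul_of]
    have key (T : A ⊗[K] A) : LinearMap.mul' K K (TensorProduct.map (counit (R := K))
        (counit (R := K)) ((of S g h a ⊗ₜ[K] (1 : Strict S)) *
          TensorProduct.map (of S g' h') (of S g' h') T * (1 ⊗ₜ[K] of S g'' h'' a''))) =
        if g * h' = g' ∧ g' * h'' = g'' then counit (R := K) a * LinearMap.mul' K K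
          (TensorProduct.map (counit (R := K)) (counit (R := K)) T) * counit (R := K) a'' else 0 := by
      induction T using TensorProduct.induction_on with
      | zero => simp
      | add x y hx hy =>
        simp only [map_add, add_mul, mul_add, hx, hy]
        split_ifs
        · rfl
        · rw [add_zero]
      | tmul b b' =>
        simp only [TensorProduct.map_tmul, Algebra.TensorProduct.tmul_mul_tmul, one_mul, mul_one,
          counit_of_mul_of, LinearMap.mul'_apply]
        by_cases h1 : g * h' = g' <;> by_cases h2 : g' * h'' = g'' <;> simp [h1, h2]
        ring
    rw [key, counit_counit_comul, of_mul_of]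
    by_cases h1 : g * h' = g'
    · rw [if_pos h1, counit_of_mul_of, Bialgebra.counit_mul, Bialgebra.counit_mul, S.counit_φ,
        counit_c, mul_one]
      simp [h1]
    · simp [h1]
  counit_mul_right x y z := by
    classical
    induction x using induction with
    | zero => simp
    | add x x' h h' => simp only [map_add, add_mul, TensorProduct.tmul_add, h, h']
    | of g h a =>
    induction z using induction with
    | zero => simp
    | add x x' h h' => simp only [map_add, mul_add, TensorProduct.add_tmul, h, h']
    | of g'' h'' a'' =>
    induction y using induction with
    | zero => simp
    | add x x' h h' => simp only [map_add, mul_add, add_mul, h, h']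
    | of g' h' a' =>
    rw [comul_of]
    have key (T : A ⊗[K] A) : LinearMap.mul' K K (TensorProduct.map (counit (R := K))
        (counit (R := K)) (((1 : Strict S) ⊗ₜ[K] of S g h a) *
          TensorProduct.map (of S g' h') (of S g' h') T * (of S g'' h'' a'' ⊗ₜ[K] 1))) =
        if g * h' = g' ∧ g' * h'' = g'' then counit (R := K) a * LinearMap.mul' K K
          (TensorProduct.map (counit (R := K)) (counit (R := K)) T) * counit (R := K) a'' else 0 := by
      induction T using TensorProduct.induction_on with
      | zero => simp
      | add x y hx hy =>
        simp only [map_add, add_mul, mul_add, hx, hy]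
        split_ifs
        · rfl
        · rw [add_zero]
      | tmul b b' =>
        simp only [TensorProduct.map_tmul, Algebra.TensorProduct.tmul_mul_tmul, one_mul, mul_one,
          counit_of_mul_of, LinearMap.mul'_apply]
        by_cases h1 : g * h' = g' <;> by_cases h2 : g' * h'' = g'' <;> simp [h1, h2]
        ring
    rw [key, counit_counit_comul, of_mul_of]
    by_cases h1 : g * h' = g'
    · rw [if_pos h1, counit_of_mul_of, Bialgebra.counit_mul, Bialgebra.counit_mul, S.counit_φ,
        counit_c, mul_one]
      simp [h1]
    · simp [h1]

/-- The antipode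
`δ_g ⊗ a ⊗ h ↦ δ_{gh⁻¹} ⊗ c_{h⁻¹,h}⁻¹ φ_{h⁻¹}(S(a)) ⊗ h⁻¹`. -/
def antipodeLin : Strict S →ₗ[K] Strict S :=
  lift S fun g h => of S (g * h⁻¹) h⁻¹ ∘ₗ LinearMap.mulLeft K ((S.c h⁻¹ h)⁻¹ : Aˣ) ∘ₗ
    (S.φ h⁻¹).toLinearMap ∘ₗ HopfAlgebra.antipode K

theorem antipodeLin_of (g h : G) (a : A) : antipodeLin S (of S g h a) =
    of S (g * h⁻¹) h⁻¹ (((S.c h⁻¹ h)⁻¹ : Aˣ) * S.φ h⁻¹ (HopfAlgebra.antipode K a)) := by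
  rw [antipodeLin, lift_of]
  rfl

theorem counitalTarget_of (g h : G) (a : A) :
    counitalTarget K (of S g h a) = counit (R := K) a • of S (g * h⁻¹) 1 1 := by
  classical
  simp only [counitalTarget, LinearMap.comp_apply, LinearMap.flip_apply, TensorProduct.mk_apply,
    LinearMap.mulLeft_apply, comul_one, Finset.sum_mul, Algebra.TensorProduct.tmul_mul_tmul, mul_one,
    map_sum, LinearMap.rTensor_tmul, LinearEquiv.coe_coe, TensorProduct.lid_tmul]
  rw [Finset.sum_eq_single (g * h⁻¹)]
  · rw [unit_mul_of, if_pos (by group), counit_of]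
  · intro k _ hk
    rw [unit_mul_of, if_neg (fun h1 => hk (by rw [← h1]; group)), map_zero, zero_smul]
  · simp

theorem counitalSource_of (g h : G) (a : A) :
    counitalSource K (of S g h a) = counit (R := K) a • of S g 1 1 := by
  classical
  simp only [counitalSource, LinearMap.comp_apply, TensorProduct.mk_apply,
    LinearMap.mulRight_apply, comul_one, Finset.mul_sum, Algebra.TensorProduct.tmul_mul_tmul, one_mul,
    map_sum, LinearMap.lTensor_tmul, LinearEquiv.coe_coe, TensorProduct.rid_tmul]
  rw [Finset.sum_eq_single g]
  · rw [of_mul_unit, if_pos rfl, counit_of]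
  · intro k _ hk
    rw [of_mul_unit, if_neg hk.symm, map_zero, zero_smul]
  · simp

theorem φ_c_inv (h : G) : S.φ h (S.c h⁻¹ h) = S.c h h⁻¹ := by
  have h1 := S.cocycle h h⁻¹ h
  rw [inv_mul_cancel, mul_inv_cancel, S.c_one_right, S.c_one_left] at h1
  simpa using h1

theorem φ_c_inv_inv (h : G) :
    S.φ h ((S.c h⁻¹ h)⁻¹ : Aˣ) = ((S.c h h⁻¹)⁻¹ : Aˣ) := by
  refine (Units.inv_eq_of_mul_eq_one_right ?_).symm
  rw [← φ_c_inv, ← map_mul, Units.mul_inv, map_one]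

theorem of_mul_antipodeLin (g h : G) (a b : A) :
    of S g h a * antipodeLin S (of S g h b) =
      of S (g * h⁻¹) 1 (a * HopfAlgebra.antipode K b) := by
  classical
  rw [antipodeLin_of, of_mul_of, if_pos rfl, mul_inv_cancel, map_mul (S.φ h), φ_c_inv_inv]
  congr 1
  simp only [mul_assoc]
  rw [S.φ_φ_mul_c, mul_inv_cancel, S.φ_one, Units.inv_mul_cancel_left]

theorem antipodeLin_mul_of (g h : G) (a b : A) :
    antipodeLin S (of S g h a) * of S g h b = of S g 1
      (((S.c h⁻¹ h)⁻¹ : Aˣ) * S.φ h⁻¹ (HopfAlgebra.antipode K a * b) * S.c h⁻¹ h) := by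
  classical
  rw [antipodeLin_of, of_mul_of, if_pos (by group), inv_mul_cancel, map_mul (S.φ h⁻¹)]
  simp only [mul_assoc]

/-- The strictification as a weak Hopf algebra. -/
instance : WeakHopfAlgebra K (Strict S) where
  antipode := antipodeLin S
  mul_antipode_right x := by
    induction x using induction with
    | zero => simp
    | add x x' h h' => simp only [map_add, h, h']
    | of g h a =>
      rw [counitalTarget_of, comul_of]
      have key (T : A ⊗[K] A) : LinearMap.mul' K (Strict S) ((antipodeLin S).lTensor (Strict S)
          (TensorProduct.map (of S g h) (of S g h) T)) = of S (g * h⁻¹) 1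
            (LinearMap.mul' K A ((HopfAlgebra.antipode K).lTensor A T)) := by
        induction T using TensorProduct.induction_on with
        | zero => simp
        | add x y hx hy => simp only [map_add, hx, hy]
        | tmul b b' => simp [of_mul_antipodeLin]
      rw [key, HopfAlgebra.mul_antipode_lTensor_comul_apply, Algebra.algebraMap_eq_smul_one,
        map_smul]
  mul_antipode_left x := by
    induction x using induction with
    | zero => simp
    | add x x' h h' => simp only [map_add, h, h']
    | of g h a =>
      rw [counitalSource_of, comul_of]
      have key (T : A ⊗[K] A) : LinearMap.mul' K (Strict S) ((antipodeLin S).rTensor (Strict S)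
          (TensorProduct.map (of S g h) (of S g h) T)) = of S g 1 (((S.c h⁻¹ h)⁻¹ : Aˣ) *
            S.φ h⁻¹ (LinearMap.mul' K A ((HopfAlgebra.antipode K).rTensor A T)) * S.c h⁻¹ h) := by
        induction T using TensorProduct.induction_on with
        | zero => simp
        | add x y hx hy => simp only [map_add, hx, hy, mul_add, add_mul]
        | tmul b b' => simp [antipodeLin_mul_of]
      rw [key, HopfAlgebra.mul_antipode_rTensor_comul_apply, Algebra.algebraMap_eq_smul_one]
      simp
  antipode_mul_antipode x := by
    classical
    induction x using induction with
    | zero => simp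
    | add x x' h h' => simp only [map_add, h, h']
    | of g h a =>
      have h0 : LinearMap.mul' K (Strict S) ∘ₗ (antipodeLin S).lTensor (Strict S) ∘ₗ
          comul (R := K) = counitalTarget K := by
        refine lin_ext S fun g h a => ?_
        rw [counitalTarget_of]
        simp only [LinearMap.comp_apply]
        rw [comul_of]
        have key (T : A ⊗[K] A) : LinearMap.mul' K (Strict S) ((antipodeLin S).lTensor (Strict S)
            (TensorProduct.map (of S g h) (of S g h) T)) = of S (g * h⁻¹) 1
              (LinearMap.mul' K A ((HopfAlgebra.antipode K).lTensor A T)) := by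
          induction T using TensorProduct.induction_on with
          | zero => simp
          | add x y hx hy => simp only [map_add, hx, hy]
          | tmul b b' => simp [of_mul_antipodeLin]
        rw [key, HopfAlgebra.mul_antipode_lTensor_comul_apply, Algebra.algebraMap_eq_smul_one,
          map_smul]
      rw [h0, comul_of]
      have key (T : A ⊗[K] A) : LinearMap.mul' K (Strict S)
          (TensorProduct.map (antipodeLin S) (counitalTarget K)
            (TensorProduct.map (of S g h) (of S g h) T)) =
          antipodeLin S (of S g h (contractRight (counit (R := K)) T)) := by
        induction T using TensorProduct.induction_on with
        | zero => simp
        | add x y hx hy => simp only [map_add, hx, hy]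
        | tmul b b' =>
          simp only [TensorProduct.map_tmul, LinearMap.mul'_apply, counitalTarget_of,
            contractRight_tmul, map_smul, mul_smul_comm, antipodeLin_of, of_mul_unit, if_true]
      rw [key, contractRight_counit_comul]

end WeakHopf
end Strict

namespace Strict

section Graded

variable {K G A : Type u} [Field K] [Group G] [Fintype G] [Ring A] [HopfAlgebra K A]
variable (S : GWeakHopf K G A)

/-- The map `δ_g ⊗ a ⊗ h ↦ δ_{kg} ⊗ a ⊗ h`. -/
def shiftLin (k : G) : Strict S →ₗ[K] Strict S := lift S fun g h => of S (k * g) h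

@[simp]
theorem shiftLin_of (k g h : G) (a : A) : shiftLin S k (of S g h a) = of S (k * g) h a := by
  rw [shiftLin, lift_of]

theorem shiftLin_shiftLin (k l : G) (x : Strict S) :
    shiftLin S k (shiftLin S l x) = shiftLin S (k * l) x := by
  induction x using induction with
  | zero => simp
  | add x x' h h' => simp only [map_add, h, h']
  | of g h a => simp [mul_assoc]

theorem shiftLin_one (x : Strict S) : shiftLin S 1 x = x := by
  induction x using induction with
  | zero => simp
  | add x x' h h' => simp only [map_add, h, h']
  | of g h a => simp

/-- The action `φ_k(δ_g ⊗ a ⊗ h) = δ_{kg} ⊗ a ⊗ h` of `G` on `A^str`. -/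
def shift (k : G) : Strict S ≃ₐ[K] Strict S :=
  AlgEquiv.ofLinearEquiv
    (LinearEquiv.ofLinearMap (shiftLin S k) (shiftLin S k⁻¹)
      (LinearMap.ext fun x => by simp [shiftLin_shiftLin, shiftLin_one])
      (LinearMap.ext fun x => by simp [shiftLin_shiftLin, shiftLin_one]))
    (by
      change shiftLin S k 1 = 1
      rw [one_def, map_sum]
      simp only [shiftLin_of]
      exact Equiv.sum_comp (Equiv.mulLeft k) fun g => of S g 1 (1 : A))
    (fun x y => by
      classical
      change shiftLin S k (x * y) = shiftLin S k x * shiftLin S k y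
      induction x using induction with
      | zero => simp
      | add x x' h h' => simp only [map_add, add_mul, h, h']
      | of g h a =>
      induction y using induction with
      | zero => simp
      | add x x' h h' => simp only [map_add, mul_add, h, h']
      | of g' h' a' =>
      rw [shiftLin_of, shiftLin_of, of_mul_of, of_mul_of]
      simp only [mul_assoc k g h', mul_right_inj]
      split_ifs <;> simp)

theorem shift_apply (k : G) (x : Strict S) : shift S k x = shiftLin S k x := rfl

@[simp]
theorem shift_of (k g h : G) (a : A) : shift S k (of S g h a) = of S (k * g) h a :=
  shiftLin_of S k g h a

/-- The component `(A^str)_d = ⨁_{g,h} δ_g ⊗ A_{k⁻¹dk} ⊗ h`, where `k = gh⁻¹`. -/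
def component (d : G) : Submodule K (Strict S) :=
  ⨆ p : G × G, (S.grading ((p.1 * p.2⁻¹)⁻¹ * d * (p.1 * p.2⁻¹))).map (of S p.1 p.2)

theorem of_mem_component {d g h : G} {a : A}
    (ha : a ∈ S.grading ((g * h⁻¹)⁻¹ * d * (g * h⁻¹))) : of S g h a ∈ component S d :=
  Submodule.mem_iSup_of_mem (g, h) ⟨a, ha, rfl⟩

theorem component_induction {d : G} {motive : Strict S → Prop} {x : Strict S}
    (hx : x ∈ component S d) (zero : motive 0) (add : ∀ x y, motive x → motive y → motive (x + y))
    (of : ∀ g h a, a ∈ S.grading ((g * h⁻¹)⁻¹ * d * (g * h⁻¹)) → motive (of S g h a)) :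
    motive x :=
  Submodule.iSup_induction _ (motive := motive) hx (fun p y hy => by
    obtain ⟨a, ha, rfl⟩ := hy
    exact of p.1 p.2 a ha) zero add

theorem component_mul_ne {d d' : G} (hd : d ≠ d') {x y : Strict S} (hx : x ∈ component S d)
    (hy : y ∈ component S d') : x * y = 0 := by
  classical
  refine component_induction S (motive := fun x => x * y = 0) hx (zero_mul y) (fun x x' h h' => by rw [add_mul, h, h', add_zero])
    fun g h a ha => ?_
  refine component_induction S (motive := fun y => of S g h a * y = 0) hy (mul_zero _) (fun x x' h h' => by rw [mul_add, h, h', add_zero])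
    fun g' h' a' ha' => ?_
  rw [of_mul_of]
  split_ifs with h1
  · subst h1
    have h2 := S.grading_φ h ha'
    rw [S.grading_mul_ne _ ha h2, zero_mul, map_zero]
    simp only [mul_inv_cancel_right, mul_inv_rev, inv_inv, ← mul_assoc]
    intro h3
    simp only [mul_assoc, mul_right_inj, mul_left_inj] at h3
    exact hd h3
  · rfl

theorem component_iSup : ⨆ d, component S d = ⊤ := by
  rw [eq_top_iff]
  intro x _
  induction x using induction with
  | zero => exact zero_mem _
  | add x x' h h' => exact add_mem (h trivial) (h' trivial)
  | of g h a =>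
    refine S.grading_induction (motive := fun a => of S g h a ∈ ⨆ d, component S d)
      (fun d a ha => ?_) (by simp) (fun a b ha hb => by rw [map_add]; exact add_mem ha hb) a
    refine Submodule.mem_iSup_of_mem (g * h⁻¹ * d * (g * h⁻¹)⁻¹) (of_mem_component S ?_)
    convert ha using 2
    group

theorem component_comul {d : G} {x : Strict S} (hx : x ∈ component S d) :
    comul (R := K) x ∈ ⨆ (p : G) (q : G) (_ : p * q = d),
      LinearMap.range (TensorProduct.mapIncl (component S p) (component S q)) := by
  refine component_induction S (motive := fun x => comul (R := K) x ∈ ⨆ (p : G) (q : G)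
    (_ : p * q = d), LinearMap.range (TensorProduct.mapIncl (component S p) (component S q))) hx
    (by simp) (fun x y h h' => by rw [map_add]; exact add_mem h h') fun g h a ha => ?_
  rw [comul_of, ← Submodule.Quotient.mk_eq_zero]
  refine S.comul_induction (Submodule.mkQ _ ∘ₗ TensorProduct.map (of S g h) (of S g h)) ha
    fun p q hpq b hb b' hb' => ?_
  rw [LinearMap.comp_apply, TensorProduct.map_tmul, Submodule.mkQ_apply,
    Submodule.Quotient.mk_eq_zero]
  have hk (r : G) : (g * h⁻¹)⁻¹ * (g * h⁻¹ * r * (g * h⁻¹)⁻¹) * (g * h⁻¹) = r := by group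
  refine Submodule.mem_iSup_of_mem (g * h⁻¹ * p * (g * h⁻¹)⁻¹) <| Submodule.mem_iSup_of_mem
    (g * h⁻¹ * q * (g * h⁻¹)⁻¹) <| Submodule.mem_iSup_of_mem ?_ ?_
  · calc _ = g * h⁻¹ * (p * q) * (g * h⁻¹)⁻¹ := by group
      _ = d := by rw [hpq]; group
  · exact ⟨⟨of S g h b, of_mem_component S (by rw [hk]; exact hb)⟩ ⊗ₜ[K]
      ⟨of S g h b', of_mem_component S (by rw [hk]; exact hb')⟩, rfl⟩

end Graded

end Strict

section Strictification

variable {K G A : Type u} [Field K] [Group G] [Fintype G] [Ring A] [HopfAlgebra K A]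

/-- The strictification `A^str` of a `G`-Hopf algebra `A`, as a `G`-weak Hopf algebra. -/
def strict (S : GWeakHopf K G A) : GWeakHopf K G (Strict S) where
  φ := Strict.shift S
  c _ _ := 1
  φ_φ g h x := by simp [Strict.shift_apply, Strict.shiftLin_shiftLin]
  cocycle g h k := by simp
  c_one_one := rfl
  comul_φ k x := by
    induction x using Strict.induction with
    | zero => simp
    | add x x' h h' => simp only [map_add, h, h']
    | of g h a =>
      have h1 : (Strict.shift S k).toLinearMap ∘ₗ Strict.of S g h = Strict.of S (k * g) h :=
        LinearMap.ext fun a => Strict.shift_of S k g h a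
      rw [Strict.shift_of, Strict.comul_of, Strict.comul_of, ← h1, TensorProduct.map_comp]
      rfl
  counit_φ k x := by
    induction x using Strict.induction with
    | zero => simp
    | add x x' h h' => simp only [map_add, h, h']
    | of g h a => simp
  antipode_φ k x := by
    change Strict.antipodeLin S _ = Strict.shift S k (Strict.antipodeLin S x)
    induction x using Strict.induction with
    | zero => simp
    | add x x' h h' => simp only [map_add, h, h']
    | of g h a => simp [Strict.antipodeLin_of, mul_assoc]
  comul_c g h := by simp [← Algebra.TensorProduct.one_def]
  grading := Strict.component S
  grading_iSupIndep := iSupIndep_of_grading _ (Strict.component_iSup S)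
    fun hd _ _ hx hy => Strict.component_mul_ne S hd hx hy
  grading_iSup := Strict.component_iSup S
  grading_mul {d x y} hx hy := by
    classical
    refine Strict.component_induction S (motive := fun x => x * y ∈ _) hx (by simp)
      (fun x x' h h' => by rw [add_mul]; exact add_mem h h') fun g h a ha => ?_
    refine Strict.component_induction S (motive := fun y => Strict.of S g h a * y ∈ _) hy (by simp)
      (fun x x' h h' => by rw [mul_add]; exact add_mem h h') fun g' h' a' ha' => ?_
    rw [Strict.of_mul_of]
    split_ifs with h1
    · subst h1
      refine Strict.of_mem_component S (S.mul_mem_right (S.mul_mem_right ?_ _) _)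
      convert ha using 2
      group
    · exact zero_mem _
  grading_mul_ne hd x y hx hy := Strict.component_mul_ne S hd hx hy
  grading_φ k d x hx := by
    refine Strict.component_induction S (motive := fun x => Strict.shift S k x ∈ _) hx (by simp)
      (fun x x' h h' => by rw [map_add]; exact add_mem h h') fun g h a ha => ?_
    rw [Strict.shift_of]
    refine Strict.of_mem_component S ?_
    convert ha using 2
    group
  grading_comul hx := Strict.component_comul S hx

theorem strict_isStrict (S : GWeakHopf K G A) : (strict S).IsStrict := fun _ _ => rfl

/-! ### The equivalence `F : A-mod ⥤ A^str-mod` -/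

open Classical in
/-- The right action `(m ⊗ k).(δ_g ⊗ a ⊗ h) = δ(kh, g) (m.(φ_k(a) c_{k,h}) ⊗ g)` of `A^str` on
`M ⊗ K[G]`, where `m ⊗ k` is `Finsupp.single k m`. -/
def strictAct (S : GWeakHopf K G A) (M : RMod K A) : Strict S →ₗ[K] Module.End K (G →₀ M) :=
  Strict.lift S fun g h =>
    { toFun := fun a => Finsupp.lsum K fun k =>
        if k * h = g then Finsupp.lsingle g ∘ₗ M.act (S.φ k a * S.c k h) else 0
      map_add' := fun a b => by
        refine Finsupp.lhom_ext fun k m => ?_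
        simp only [LinearMap.add_apply, Finsupp.lsum_single]
        split_ifs
        · simp [add_mul]
        · simp
      map_smul' := fun r a => by
        refine Finsupp.lhom_ext fun k m => ?_
        simp only [LinearMap.smul_apply, Finsupp.lsum_single, RingHom.id_apply]
        split_ifs
        · simp
        · simp }

open Classical in
theorem strictAct_of (S : GWeakHopf K G A) (M : RMod K A) (g h : G) (a : A) (k : G) (m : M) :
    strictAct S M (Strict.of S g h a) (Finsupp.single k m) =
      if k * h = g then Finsupp.single g (M.act (S.φ k a * S.c k h) m) else 0 := by
  rw [strictAct, Strict.lift_of]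
  change Finsupp.lsum K _ (Finsupp.single k m) = _
  rw [Finsupp.lsum_single]
  split_ifs <;> rfl

/-- The `A^str`-module `F(M) = M ⊗ K[G]`. -/
def strictObj (S : GWeakHopf K G A) (M : RMod K A) : RMod K (Strict S) where
  carrier := G →₀ M
  act := strictAct S M
  act_one := by
    classical
    refine Finsupp.lhom_ext fun k m => ?_
    rw [Strict.one_def, map_sum, LinearMap.sum_apply, Finset.sum_eq_single k]
    · rw [strictAct_of, if_pos (mul_one k), map_one, S.c_one_right]
      simp [RMod.act_one_apply]
    · intro g _ hg
      rw [strictAct_of, if_neg (by rw [mul_one]; exact hg.symm)]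
    · simp
  act_mul x y := by
    classical
    induction x using Strict.induction with
    | zero => simp
    | add x x' h h' => rw [add_mul, map_add, map_add, h, h', LinearMap.comp_add]
    | of g h a =>
    induction y using Strict.induction with
    | zero => simp
    | add x x' h h' => rw [mul_add, map_add, map_add, h, h', LinearMap.add_comp]
    | of g' h' a' =>
    refine Finsupp.lhom_ext fun k m => ?_
    rw [LinearMap.comp_apply, strictAct_of, Strict.of_mul_of]
    by_cases h1 : k * h = g
    · subst h1
      rw [if_pos rfl, strictAct_of]
      by_cases h2 : k * h * h' = g'
      · subst h2
        rw [if_pos rfl, if_pos rfl, strictAct_of, if_pos (mul_assoc k h h').symm,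
          ← RMod.act_mul_apply]
        congr 3
        simp only [map_mul, mul_assoc]
        rw [S.cocycle]
        simp only [← mul_assoc]
        rw [mul_assoc (S.φ k a) (S.φ k (S.φ h a')), S.φ_φ_mul_c]
        simp only [← mul_assoc]
      · rw [if_neg h2, if_neg h2]
        simp
    · rw [if_neg h1, map_zero]
      split_ifs with h2
      · rw [strictAct_of, if_neg]
        rw [← h2, ← mul_assoc]
        exact fun h3 => h1 (mul_right_cancel h3)
      · simp

/-- The identity map `M ⊗ K[G] → F(M)`. -/
def toStrict (S : GWeakHopf K G A) (M : RMod K A) : (G →₀ M) →ₗ[K] strictObj S M :=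
  (LinearMap.id : (G →₀ M) →ₗ[K] (G →₀ M))

/-- The element `m ⊗ k` of `F(M) = M ⊗ K[G]`. -/
def strictObjMk (S : GWeakHopf K G A) (M : RMod K A) (m : M) (k : G) : strictObj S M :=
  toStrict S M (Finsupp.single k m)

theorem strictMap_act (S : GWeakHopf K G A) {M N : RMod K A} (f : M ⟶ N) (x : Strict S)
    (v : G →₀ M) : Finsupp.mapRange.linearMap (RMod.lin f) (strictAct S M x v) =
      strictAct S N x (Finsupp.mapRange.linearMap (RMod.lin f) v) := by
  classical
  rw [← LinearMap.comp_apply, ← LinearMap.comp_apply]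
  refine LinearMap.congr_fun ?_ v
  induction x using Strict.induction with
  | zero => simp
  | add x x' h h' => rw [map_add, map_add, LinearMap.comp_add, LinearMap.add_comp, h, h']
  | of g h a =>
    refine Finsupp.lhom_ext fun k m => ?_
    rw [LinearMap.comp_apply, LinearMap.comp_apply, strictAct_of,
      Finsupp.mapRange.linearMap_apply, Finsupp.mapRange.linearMap_apply,
      Finsupp.mapRange_single, strictAct_of]
    split_ifs
    · rw [Finsupp.mapRange_single, RMod.lin_act]
    · simp

/-- The functor `F : A-mod ⥤ A^str-mod`, given by `M ↦ M ⊗ K[G]` and `f ↦ f ⊗ id`. -/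
def strictFunctor (S : GWeakHopf K G A) : RMod K A ⥤ RMod K (Strict S) where
  obj := strictObj S
  map {M N} f := RMod.ofLin
    (toStrict S N ∘ₗ Finsupp.mapRange.linearMap (RMod.lin f) : (G →₀ M) →ₗ[K] strictObj S N)
    (strictMap_act S f)
  map_id M := RMod.hom_ext fun v => Finsupp.mapRange_id v
  map_comp f g := RMod.hom_ext fun v => by
    change Finsupp.mapRange.linearMap (RMod.lin g ∘ₗ RMod.lin f) v = _
    rw [Finsupp.mapRange.linearMap_comp]
    rfl

end Strictification

end

end GHopf

/-!
The functor `F : A-mod ⥤ A^str-mod`, `M ↦ M ⊗ K[G]`, is an equivalence of categories: a module `V`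
over `A^str` is recovered from its corner `V.(δ_1 ⊗ 1 ⊗ 1)`, a module over
`(δ_1 ⊗ 1 ⊗ 1) A^str (δ_1 ⊗ 1 ⊗ 1) = A`, and the elements `δ_k ⊗ 1 ⊗ k` identify `V` with
`F` of it (`cornerIso`). Since `Δ(1) = ∑ (δ_k ⊗ 1 ⊗ 1) ⊗ (δ_k ⊗ 1 ⊗ 1)`, the truncated tensor
product `F(M) ⊗̄ F(N)` is spanned by the `(m ⊗ k) ⊗ (n ⊗ k)`, which makes `F` a tensor functor
(`strictFunctorMonoidal`); together with the isomorphisms `ψ_g` (`strictPsiIso`) it is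
`G`-equivariant, and it preserves and reflects the grading.

A `G`-braiding and a `G`-twist can be transported along any such equivalence, for purely
categorical reasons (`transportBraiding`, `transportTwist`). What is specific to `A^str` is that
the transported structure is again given by elements. With `1_d` the unit of the ideal `A_d`, they
are
* `R^str = ∑_{k,g} (δ_k ⊗ R₁ 1_{k⁻¹gk} ⊗ 1) ⊗ (δ_{g⁻¹k} ⊗ R₂ ⊗ k⁻¹g⁻¹k)` (`strictR`);
* `(θ^str)⁻¹ = ∑_{p,d} δ_p ⊗ θ⁻¹ 1_d ⊗ d⁻¹` (`strictThetaInv`).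

On `(m ⊗ k) ⊗ (n ⊗ k)` with `M` of degree `g`, the element `R^str` acts by `(φ_k ⊗ φ_k)(R)`
followed by a compositor (`act₂_strictR`), whereas the transported braiding acts by `R` followed
by the compositor of `ψ_g`. These agree because the given braiding of `A-mod` is preserved by the
action of `G` (`R_equivariant`); the argument for the twist is the same (`θ_equivariant`).

It remains to find duals. The antipode gives every `A`-module `X` a left dual `X^*` with an
evaluation `X ⊗ X^* → 𝟙` (`RMod.dualExactPairing`). The antipode need not be invertible, so right
duals are obtained from the braiding instead. For `X` of degree `g` the inverse braiding turns the
evaluation into a pairing `^g(X^*) ⊗ X → 𝟙`, that is, into a homomorphism `j : X → (^g(X^*))^*`. By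
naturality of the braiding a subobject of `X` on which the pairing vanishes is also killed by the
evaluation, hence is zero (`GBraiding.eq_zero_of_whiskerLeft_evaluation`). So `j` is injective, and
it is bijective by counting dimensions: `X` is a left dual of `^g(X^*)`, which is therefore a right
dual of `X`. General modules are sums of homogeneous ones (`hasDuals_hopf`), and duals in
`A^str-mod` are the images of duals under `F` (`hasDuals_strict`).
-/

namespace GHopf

noncomputable section

/-! ### Transport of a `G`-braiding along an equivalence -/

section Transport

open Functor.LaxMonoidal Functor.OplaxMonoidal Functor.Monoidal

universe v₁ v₂ u₁ u₂

variable {K : Type*} {G : Type*} {C : Type u₁} [Field K] [Group G]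
  [Category.{v₁} C] [Preadditive C] [Linear K C] [MonoidalCategory C] [MonoidalPreadditive C]
  [MonoidalLinear K C]
variable {D : Type u₂} [Category.{v₂} D] [Preadditive D] [Linear K D] [MonoidalCategory D]
  [MonoidalPreadditive D] [MonoidalLinear K D]
variable {E : GEquivariantStructure K G C} {E' : GEquivariantStructure K G D} {F : C ⥤ D}
  [F.Monoidal] (ψ : ∀ g, E.act g ⋙ F ≅ F ⋙ E'.act g)

/-- The components of the compositors `^g(^h X) ≅ ^{gh} X`. -/
def compApp (E : GEquivariantStructure K G C) (g h : G) (X : C) :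
    (E.act g).obj ((E.act h).obj X) ≅ (E.act (g * h)).obj X :=
  (E.actComp g h).app X

/-- The components of `ψ_g : F(^g X) ≅ ^g F(X)`. -/
def psiApp (g : G) (X : C) : F.obj ((E.act g).obj X) ≅ (E'.act g).obj (F.obj X) :=
  (ψ g).app X

theorem psiApp_natural (g : G) {X Y : C} (f : X ⟶ Y) :
    F.map ((E.act g).map f) ≫ (psiApp ψ g Y).hom =
      (psiApp ψ g X).hom ≫ (E'.act g).map (F.map f) :=
  (ψ g).hom.naturality f

theorem compApp_natural (E : GEquivariantStructure K G C) (g h : G) {X Y : C} (f : X ⟶ Y) :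
    (E.act g).map ((E.act h).map f) ≫ (compApp E g h Y).hom =
      (compApp E g h X).hom ≫ (E.act (g * h)).map f :=
  (E.actComp g h).hom.naturality f

theorem psiApp_eqToHom {g h : G} (e : g = h) (X : C) (e₁ : (E.act g).obj X = (E.act h).obj X)
    (e₂ : (E'.act g).obj (F.obj X) = (E'.act h).obj (F.obj X)) :
    F.map (eqToHom e₁) ≫ (psiApp ψ h X).hom = (psiApp ψ g X).hom ≫ eqToHom e₂ := by
  subst e
  simp

theorem act_map_eqToHom (E : GEquivariantStructure K G C) {g h : G} (e : g = h) {X Y : C}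
    (f : X ⟶ Y) (e₁ : (E.act g).obj Y = (E.act h).obj Y)
    (e₂ : (E.act g).obj X = (E.act h).obj X) :
    (E.act g).map f ≫ eqToHom e₁ = eqToHom e₂ ≫ (E.act h).map f := by
  subst e
  simp

theorem psiApp_tensor [∀ g, NatTrans.IsMonoidal (ψ g).hom] (g : G) (X Y : C) :
    μ F ((E.act g).obj X) ((E.act g).obj Y) ≫ F.map (μ (E.act g) X Y) ≫ (psiApp ψ g (X ⊗ Y)).hom =
      ((psiApp ψ g X).hom ⊗ₘ (psiApp ψ g Y).hom) ≫ μ (E'.act g) (F.obj X) (F.obj Y) ≫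
        (E'.act g).map (μ F X Y) := by
  have := NatTrans.IsMonoidal.tensor (τ := (ψ g).hom) X Y
  simp only [Functor.LaxMonoidal.comp_μ, Category.assoc] at this
  exact this

theorem psiApp_tensor_delta [∀ g, NatTrans.IsMonoidal (ψ g).hom] (g : G) (X Y : C) :
    (psiApp ψ g (X ⊗ Y)).hom ≫ (E'.act g).map (δ F X Y) ≫ δ (E'.act g) (F.obj X) (F.obj Y) =
      F.map (δ (E.act g) X Y) ≫ δ F ((E.act g).obj X) ((E.act g).obj Y) ≫
        ((psiApp ψ g X).hom ⊗ₘ (psiApp ψ g Y).hom) := by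
  rw [← cancel_epi (F.map (μ (E.act g) X Y)),
    ← cancel_epi (μ F ((E.act g).obj X) ((E.act g).obj Y))]
  have := psiApp_tensor ψ g X Y
  rw [← Category.assoc, ← Category.assoc, Category.assoc (μ F _ _), this]
  simp only [Category.assoc, map_μ_δ_assoc, μ_δ_assoc, μ_δ]
  simp

theorem psiApp_unit [∀ g, NatTrans.IsMonoidal (ψ g).hom] (g : G) :
    ε F ≫ F.map (ε (E.act g)) ≫ (psiApp ψ g (𝟙_ C)).hom =
      ε (E'.act g) ≫ (E'.act g).map (ε F) := by
  have := NatTrans.IsMonoidal.unit (τ := (ψ g).hom)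
  simp only [Functor.LaxMonoidal.comp_ε, Category.assoc] at this
  exact this

variable (β : GBraiding E)

/-- The image `F(X) ⊗ F(Y) ≅ ^g F(Y) ⊗ F(X)` of a `G`-braiding under a `G`-equivariant functor. -/
def imageBraid {g : G} {X : C} (hX : E.deg g X) (Y : C) :
    F.obj X ⊗ F.obj Y ≅ (E'.act g).obj (F.obj Y) ⊗ F.obj X :=
  μIso F X Y ≪≫ F.mapIso (β.braid hX Y) ≪≫ (μIso F _ _).symm ≪≫
    whiskerRightIso (psiApp ψ g Y) (F.obj X)

theorem imageBraid_hom {g : G} {X : C} (hX : E.deg g X) (Y : C) :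
    (imageBraid ψ β hX Y).hom = μ F X Y ≫ F.map (β.braid hX Y).hom ≫
      δ F ((E.act g).obj Y) X ≫ (psiApp ψ g Y).hom ▷ F.obj X := rfl

theorem δ_imageBraid_hom {g : G} {X : C} (hX : E.deg g X) (Y : C) :
    δ F X Y ≫ (imageBraid ψ β hX Y).hom =
      F.map (β.braid hX Y).hom ≫ δ F ((E.act g).obj Y) X ≫ (psiApp ψ g Y).hom ▷ F.obj X := by
  rw [imageBraid_hom, δ_μ_assoc]

theorem imageBraid_hom_comp_μ {g : G} {X : C} (hX : E.deg g X) (Y : C) :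
    (imageBraid ψ β hX Y).hom ≫ (psiApp ψ g Y).inv ▷ F.obj X ≫ μ F ((E.act g).obj Y) X =
      μ F X Y ≫ F.map (β.braid hX Y).hom := by
  rw [imageBraid_hom]
  simp only [Category.assoc, hom_inv_whiskerRight_assoc, δ_μ, Category.comp_id]

theorem GBraiding.natural {g : G} {X X' Y Y' : C} (hX : E.deg g X) (hX' : E.deg g X')
    (f : X ⟶ X') (h : Y ⟶ Y') :
    (f ⊗ₘ h) ≫ (β.braid hX' Y').hom = (β.braid hX Y).hom ≫ ((E.act g).map h ⊗ₘ f) := by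
  rw [MonoidalCategory.tensorHom_def', Category.assoc, β.natural_left hX hX', ← Category.assoc,
    β.natural_right, Category.assoc, MonoidalCategory.tensorHom_def]

theorem imageBraid_natural {g : G} {X X' Y Y' : C} (hX : E.deg g X) (hX' : E.deg g X')
    (f : X ⟶ X') (h : Y ⟶ Y') :
    (F.map f ⊗ₘ F.map h) ≫ (imageBraid ψ β hX' Y').hom =
      (imageBraid ψ β hX Y).hom ≫ ((E'.act g).map (F.map h) ⊗ₘ F.map f) := by
  simp only [imageBraid_hom, μ_natural_assoc, Category.assoc]
  rw [← Functor.map_comp_assoc, β.natural hX hX', Functor.map_comp, Category.assoc,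
    ← δ_natural_assoc, ← tensorHom_id, ← tensorHom_id, tensorHom_comp_tensorHom,
    tensorHom_comp_tensorHom, psiApp_natural, Category.comp_id, Category.id_comp]

/-- The first hexagon axiom for the image of a `G`-braiding, with the tensor structure of `F`
inserted where objects `F(Y ⊗ Z)` and `F(Y) ⊗ F(Z)` meet. -/
theorem imageBraid_hexagon_right [∀ g, NatTrans.IsMonoidal (ψ g).hom] {g : G} {X : C}
    (hX : E.deg g X) (Y Z : C) :
    (α_ (F.obj X) (F.obj Y) (F.obj Z)).hom ≫ F.obj X ◁ μ F Y Z ≫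
        (imageBraid ψ β hX (Y ⊗ Z)).hom =
      (imageBraid ψ β hX Y).hom ▷ F.obj Z ≫ (α_ _ _ _).hom ≫
        (E'.act g).obj (F.obj Y) ◁ (imageBraid ψ β hX Z).hom ≫ (α_ _ _ _).inv ≫
          (μ (E'.act g) (F.obj Y) (F.obj Z) ≫ (E'.act g).map (μ F Y Z)) ▷ F.obj X := by
  have h0 := congrArg F.map (β.hexagon_right hX Y Z)
  have h1 := congrArg (fun t => t ▷ F.obj X) (psiApp_tensor ψ g Y Z)
  simp only [comp_whiskerRight, MonoidalCategory.tensorHom_def', Category.assoc] at h1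
  simp only [imageBraid_hom, comp_whiskerRight, Category.assoc]
  rw [← Functor.LaxMonoidal.associativity_assoc, ← Functor.map_comp_assoc, h0,
    associator_naturality_left_assoc, ← whisker_exchange_assoc,
    associator_inv_naturality_left_assoc]
  simp only [MonoidalCategory.whiskerLeft_comp, Category.assoc]
  rw [associator_inv_naturality_middle_assoc, ← h1]
  simp only [Functor.map_comp, map_whiskerRight, map_whiskerLeft, map_associator,
    map_associator_inv, Category.assoc, μ_δ_assoc]

/-- The second hexagon axiom for the image of a `G`-braiding. The braiding with `^h F(Z)`, which is
not literally in the image of `F`, is the one with `F(^h Z)` conjugated by `ψ_h`. -/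
theorem imageBraid_hexagon_left [∀ g, NatTrans.IsMonoidal (ψ g).hom]
    (hψ : ∀ (g h : G) (X : C), F.map (compApp E g h X).hom ≫ (psiApp ψ (g * h) X).hom =
      (psiApp ψ g ((E.act h).obj X)).hom ≫ (E'.act g).map (psiApp ψ h X).hom ≫
        (compApp E' g h (F.obj X)).hom) {g h : G} {X Y : C}
    (hX : E.deg g X) (hY : E.deg h Y) (Z : C) :
    (α_ (F.obj X) (F.obj Y) (F.obj Z)).inv ≫ μ F X Y ▷ F.obj Z ≫
        (imageBraid ψ β (E.deg_tensor hX hY) Z).hom =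
      F.obj X ◁ (imageBraid ψ β hY Z).hom ≫ (α_ _ _ _).inv ≫
        (F.obj X ◁ (psiApp ψ h Z).inv ≫ (imageBraid ψ β hX ((E.act h).obj Z)).hom ≫
          (E'.act g).map (psiApp ψ h Z).hom ▷ F.obj X) ▷ F.obj Y ≫
        (α_ _ _ _).hom ≫ (compApp E' g h (F.obj Z)).hom ▷ (F.obj X ⊗ F.obj Y) ≫
          (E'.act (g * h)).obj (F.obj Z) ◁ μ F X Y := by
  have h0 : F.map ((α_ X Y Z).inv ≫ (β.braid (E.deg_tensor hX hY) Z).hom) = F.map (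
      X ◁ (β.braid hY Z).hom ≫ (α_ _ _ _).inv ≫ (β.braid hX ((E.act h).obj Z)).hom ▷ Y ≫
        (α_ _ _ _).hom ≫ (compApp E g h Z).hom ▷ (X ⊗ Y)) :=
    congrArg F.map (β.hexagon_left hX hY Z)
  have h1 := congrArg (fun t => t ▷ (F.obj X ⊗ F.obj Y)) (hψ g h Z)
  simp only [comp_whiskerRight] at h1
  simp only [imageBraid_hom, comp_whiskerRight, MonoidalCategory.whiskerLeft_comp, Category.assoc]
  rw [← Functor.LaxMonoidal.associativity_inv_assoc, ← Functor.map_comp_assoc, h0,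
    associator_inv_naturality_middle_assoc]
  simp only [← comp_whiskerRight_assoc, ← MonoidalCategory.whiskerLeft_comp_assoc, Iso.hom_inv_id,
    MonoidalCategory.whiskerLeft_id, Category.id_comp]
  simp only [comp_whiskerRight, Category.assoc, associator_naturality_left_assoc]
  rw [← reassoc_of% h1, ← whisker_exchange]
  simp only [Functor.map_comp, map_whiskerRight, map_whiskerLeft, map_associator,
    map_associator_inv, Category.assoc, μ_δ_assoc, MonoidalCategory.whiskerLeft_comp]
  rw [whisker_exchange_assoc]

/-- The image of a `G`-braiding is preserved by the action of `G`, up to conjugation by `ψ_k`. -/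
theorem imageBraid_equivariant [∀ g, NatTrans.IsMonoidal (ψ g).hom]
    (hψ : ∀ (g h : G) (X : C), F.map (compApp E g h X).hom ≫ (psiApp ψ (g * h) X).hom =
      (psiApp ψ g ((E.act h).obj X)).hom ≫ (E'.act g).map (psiApp ψ h X).hom ≫
        (compApp E' g h (F.obj X)).hom) (k : G) {g : G} {X : C} (hX : E.deg g X) (Y : C)
    (e : (E'.act (k * g * k⁻¹ * k)).obj (F.obj Y) = (E'.act (k * g)).obj (F.obj Y)) :
    ((psiApp ψ k X).hom ⊗ₘ (psiApp ψ k Y).hom) ≫ μ (E'.act k) (F.obj X) (F.obj Y) ≫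
        (E'.act k).map (imageBraid ψ β hX Y).hom ≫
        δ (E'.act k) ((E'.act g).obj (F.obj Y)) (F.obj X) ≫
        (compApp E' k g (F.obj Y)).hom ▷ (E'.act k).obj (F.obj X) =
      (imageBraid ψ β (E.deg_act k hX) ((E.act k).obj Y)).hom ≫
        (((E'.act (k * g * k⁻¹)).map (psiApp ψ k Y).hom ≫
          (compApp E' (k * g * k⁻¹) k (F.obj Y)).hom ≫ eqToHom e) ⊗ₘ (psiApp ψ k X).hom) := by
  have e' : (E.act (k * g * k⁻¹ * k)).obj Y = (E.act (k * g)).obj Y := by simp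
  have h0 : F.map (μ (E.act k) X Y ≫ (E.act k).map (β.braid hX Y).hom ≫
      δ (E.act k) ((E.act g).obj Y) X ≫ (compApp E k g Y).hom ▷ (E.act k).obj X) = F.map (
      (β.braid (E.deg_act k hX) ((E.act k).obj Y)).hom ≫
        ((compApp E (k * g * k⁻¹) k Y).hom ≫ eqToHom e') ▷ (E.act k).obj X) :=
    congrArg F.map (β.equivariant k hX Y)
  have hd (T : C) : (E'.act k).map ((psiApp ψ g Y).hom ▷ F.obj T) ≫
      δ (E'.act k) ((E'.act g).obj (F.obj Y)) (F.obj T) =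
      δ (E'.act k) (F.obj ((E.act g).obj Y)) (F.obj T) ≫
        (E'.act k).map (psiApp ψ g Y).hom ▷ _ := (δ_natural_left _ _ _).symm
  have h2 := psiApp_eqToHom ψ (show k * g * k⁻¹ * k = k * g by group) Y e' e
  simp only [imageBraid_hom, Functor.map_comp, Category.assoc]
  rw [← reassoc_of% (psiApp_tensor ψ k X Y), ← reassoc_of% (psiApp_natural ψ k),
    reassoc_of% hd, reassoc_of% (psiApp_tensor_delta ψ k)]
  rw [← tensorHom_id, ← tensorHom_id, ← tensorHom_id, tensorHom_comp_tensorHom,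
    tensorHom_comp_tensorHom, tensorHom_comp_tensorHom]
  simp only [Category.id_comp, Category.comp_id]
  rw [← hψ, ← reassoc_of% hψ, ← h2]
  have h3 (T T' : C) (f : T ⟶ T') (M : D) (p : F.obj T' ⟶ M) : δ F T ((E.act k).obj X) ≫
      ((F.map f ≫ p) ⊗ₘ (psiApp ψ k X).hom) =
      F.map (f ▷ (E.act k).obj X) ≫ δ F T' _ ≫ (p ⊗ₘ (psiApp ψ k X).hom) := by
    rw [← δ_natural_left_assoc, ← tensorHom_id, tensorHom_comp_tensorHom, Category.id_comp]
  simp only [Functor.map_comp, comp_whiskerRight] at h0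
  rw [h3, h3, h3, reassoc_of% h0]

theorem comp_tensorHom_left {X X' X'' Y Y' : C} (f : X ⟶ X') (p : X' ⟶ X'') (q : Y ⟶ Y') :
    (f ≫ p) ⊗ₘ q = f ▷ Y ≫ (p ⊗ₘ q) := by
  rw [← tensorHom_id, tensorHom_comp_tensorHom, Category.id_comp]

theorem comp_tensorHom_right {X X' Y Y' Y'' : C} (q : X ⟶ X') (f : Y ⟶ Y') (p : Y' ⟶ Y'') :
    q ⊗ₘ (f ≫ p) = X ◁ f ≫ (q ⊗ₘ p) := by
  rw [← id_tensorHom, tensorHom_comp_tensorHom, Category.id_comp]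

theorem tensorHom_comp_whiskerRight {X X' X'' Y Y' : C} (f : X ⟶ X') (p : X' ⟶ X'')
    (q : Y ⟶ Y') : (f ⊗ₘ q) ≫ p ▷ Y' = (f ≫ p) ⊗ₘ q := by
  rw [← tensorHom_id, tensorHom_comp_tensorHom, Category.comp_id]

theorem tensorHom_comp_whiskerLeft {X X' Y Y' Y'' : C} (q : X ⟶ X') (f : Y ⟶ Y')
    (p : Y' ⟶ Y'') : (q ⊗ₘ f) ≫ X' ◁ p = q ⊗ₘ (f ≫ p) := by
  rw [← id_tensorHom, tensorHom_comp_tensorHom, Category.comp_id]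

variable [F.IsEquivalence] (hdeg : ∀ (g : G) (X : C), E'.deg g (F.obj X) → E.deg g X)

theorem deg_preimage (hdeg : ∀ (g : G) (X : C), E'.deg g (F.obj X) → E.deg g X) {g : G} {X : D}
    (hX : E'.deg g X) : E.deg g (F.objPreimage X) :=
  hdeg _ _ ((E'.deg_iso g).of_iso (F.objObjPreimageIso X).symm hX)

/-- The isomorphism `X ⊗ Y ≅ ^g Y ⊗ X` obtained from the image of a `G`-braiding by means of chosen
preimages of `X` and `Y` under the equivalence `F`. -/
def transportBraid {g : G} {X : D} (hX : E'.deg g X) (Y : D) :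
    X ⊗ Y ≅ (E'.act g).obj Y ⊗ X :=
  ((F.objObjPreimageIso X).symm ⊗ᵢ (F.objObjPreimageIso Y).symm) ≪≫
    imageBraid ψ β (deg_preimage hdeg hX) (F.objPreimage Y) ≪≫
      ((E'.act g).mapIso (F.objObjPreimageIso Y) ⊗ᵢ F.objObjPreimageIso X)

/-- The transported isomorphism is determined by the image of the `G`-braiding, for any
comparison of `X'` and `Y'` with objects in the image of `F`: the chosen preimages do not matter.
All axioms of a `G`-braiding on `D` follow from this and the corresponding properties of
`imageBraid`. -/
theorem transportBraid_natural {g : G} {X : C} {X' : D} {Y : C} {Y' : D} (hX : E.deg g X)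
    (hX' : E'.deg g X') (f : F.obj X ⟶ X') (h : F.obj Y ⟶ Y') :
    (f ⊗ₘ h) ≫ (transportBraid ψ β hdeg hX' Y').hom =
      (imageBraid ψ β hX Y).hom ≫ ((E'.act g).map h ⊗ₘ f) := by
  obtain ⟨f', hf⟩ := F.map_surjective (f ≫ (F.objObjPreimageIso X').inv)
  obtain ⟨h', hh⟩ := F.map_surjective (h ≫ (F.objObjPreimageIso Y').inv)
  simp only [transportBraid, Iso.trans_hom, tensorIso_hom, Iso.symm_hom,
    tensorHom_comp_tensorHom_assoc]
  rw [← hf, ← hh, reassoc_of% (imageBraid_natural ψ β hX), tensorHom_comp_tensorHom,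
    Functor.mapIso_hom, ← Functor.map_comp, hf, hh]
  simp

theorem transportBraid_obj {g : G} {X : C} (hX : E.deg g X) (hX' : E'.deg g (F.obj X)) (Y : C) :
    (transportBraid ψ β hdeg hX' (F.obj Y)).hom = (imageBraid ψ β hX Y).hom := by
  simpa using transportBraid_natural ψ β hdeg hX hX' (𝟙 (F.obj X)) (𝟙 (F.obj Y))

/-- The `G`-braiding on `D` transported along an equivalence `F : C ⥤ D`. -/
def transportBraiding [∀ g, NatTrans.IsMonoidal (ψ g).hom]
    (hψ : ∀ (g h : G) (X : C), F.map (compApp E g h X).hom ≫ (psiApp ψ (g * h) X).hom =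
      (psiApp ψ g ((E.act h).obj X)).hom ≫ (E'.act g).map (psiApp ψ h X).hom ≫
        (compApp E' g h (F.obj X)).hom) : GBraiding E' where
  braid hX Y := transportBraid ψ β hdeg hX Y
  natural_left {g X X'} hX hX' f Y := by
    rw [← cancel_epi ((F.objObjPreimageIso X).hom ⊗ₘ (F.objObjPreimageIso Y).hom),
      ← tensorHom_id, tensorHom_comp_tensorHom_assoc,
      transportBraid_natural ψ β hdeg (deg_preimage hdeg hX),
      reassoc_of% (transportBraid_natural ψ β hdeg (deg_preimage hdeg hX) hX), ← id_tensorHom,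
      tensorHom_comp_tensorHom]
    simp
  natural_right {g X} hX {Y Y'} f := by
    rw [← cancel_epi ((F.objObjPreimageIso X).hom ⊗ₘ (F.objObjPreimageIso Y).hom),
      ← id_tensorHom, tensorHom_comp_tensorHom_assoc,
      transportBraid_natural ψ β hdeg (deg_preimage hdeg hX),
      reassoc_of% (transportBraid_natural ψ β hdeg (deg_preimage hdeg hX) hX), ← tensorHom_id,
      tensorHom_comp_tensorHom]
    simp
  hexagon_right {g X} hX Y Z := by
    set e := F.objObjPreimageIso
    have hX' := deg_preimage hdeg hX
    rw [← cancel_epi (((e X).hom ⊗ₘ (e Y).hom) ⊗ₘ (e Z).hom), associator_naturality_assoc]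
    have h1 : (e X).hom ⊗ₘ ((e Y).hom ⊗ₘ (e Z).hom) =
        F.obj _ ◁ μ F (F.objPreimage Y) (F.objPreimage Z) ≫
          ((e X).hom ⊗ₘ (δ F _ _ ≫ ((e Y).hom ⊗ₘ (e Z).hom))) := by
      rw [← comp_tensorHom_right, μ_δ_assoc]
    rw [h1, Category.assoc, transportBraid_natural ψ β hdeg hX',
      reassoc_of% (imageBraid_hexagon_right ψ β hX'),
      reassoc_of% (tensorHom_comp_whiskerRight ((e X).hom ⊗ₘ (e Y).hom)),
      transportBraid_natural ψ β hdeg hX', comp_tensorHom_left, Category.assoc,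
      associator_naturality_assoc,
      reassoc_of% (tensorHom_comp_whiskerLeft ((E'.act g).map (e Y).hom)),
      transportBraid_natural ψ β hdeg hX', comp_tensorHom_right, Category.assoc,
      associator_inv_naturality_assoc, tensorHom_comp_whiskerRight, ← comp_tensorHom_left,
      Category.assoc, ← Functor.map_comp, μ_δ_assoc, μ_natural]
  hexagon_left {g h X Y} hX hY Z := by
    set e := F.objObjPreimageIso
    have hX' := deg_preimage hdeg hX
    have hY' := deg_preimage hdeg hY
    rw [← cancel_epi ((e X).hom ⊗ₘ ((e Y).hom ⊗ₘ (e Z).hom)), associator_inv_naturality_assoc]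
    have h1 : ((e X).hom ⊗ₘ (e Y).hom) ⊗ₘ (e Z).hom =
        μ F (F.objPreimage X) (F.objPreimage Y) ▷ F.obj _ ≫
          ((δ F _ _ ≫ ((e X).hom ⊗ₘ (e Y).hom)) ⊗ₘ (e Z).hom) := by
      rw [← comp_tensorHom_left, μ_δ_assoc]
    have h2 : (e X).hom ⊗ₘ (E'.act h).map (e Z).hom =
        F.obj _ ◁ (psiApp ψ h (F.objPreimage Z)).inv ≫
          ((e X).hom ⊗ₘ ((psiApp ψ h (F.objPreimage Z)).hom ≫ (E'.act h).map (e Z).hom)) := by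
      rw [← comp_tensorHom_right, Iso.inv_hom_id_assoc]
    rw [h1, Category.assoc, transportBraid_natural ψ β hdeg (E.deg_tensor hX' hY'),
      reassoc_of% (imageBraid_hexagon_left ψ β hψ hX' hY'),
      ← comp_tensorHom_right, μ_δ_assoc,
      reassoc_of% (tensorHom_comp_whiskerLeft (e X).hom),
      transportBraid_natural ψ β hdeg hY', comp_tensorHom_right, Category.assoc,
      associator_inv_naturality_assoc, reassoc_of% tensorHom_comp_whiskerRight, h2, Category.assoc,
      transportBraid_natural ψ β hdeg hX', Functor.map_comp]
    simp only [comp_tensorHom_left, comp_whiskerRight, Category.assoc]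
    rw [associator_naturality_assoc]
    have h3 : (compApp E' g h (F.obj (F.objPreimage Z))).hom ▷ (F.obj _ ⊗ F.obj _) ≫
        ((E'.act (g * h)).map (e Z).hom ⊗ₘ (e X).hom ⊗ₘ (e Y).hom) =
        ((E'.act g).map ((E'.act h).map (e Z).hom) ⊗ₘ (e X).hom ⊗ₘ (e Y).hom) ≫
          (compApp E' g h Z).hom ▷ (X ⊗ Y) := by
      rw [tensorHom_comp_whiskerRight, compApp_natural, comp_tensorHom_left]
    rw [h3]
    rfl
  equivariant k {g X} hX Y := by
    set e := F.objObjPreimageIso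
    have hX' := deg_preimage hdeg hX
    have e' : (E'.act (k * g * k⁻¹ * k)).obj Y = (E'.act (k * g)).obj Y := by simp
    change μ (E'.act k) X Y ≫ (E'.act k).map (transportBraid ψ β hdeg hX Y).hom ≫
      δ (E'.act k) ((E'.act g).obj Y) X ≫ (compApp E' k g Y).hom ▷ (E'.act k).obj X =
      (transportBraid ψ β hdeg (E'.deg_act k hX) ((E'.act k).obj Y)).hom ≫
        ((compApp E' (k * g * k⁻¹) k Y).hom ≫ eqToHom e') ▷ (E'.act k).obj X
    rw [← cancel_epi ((E'.act k).map (e X).hom ⊗ₘ (E'.act k).map (e Y).hom),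
      ← cancel_epi ((psiApp ψ k (F.objPreimage X)).hom ⊗ₘ (psiApp ψ k (F.objPreimage Y)).hom),
      μ_natural_assoc, ← Functor.map_comp_assoc, transportBraid_natural ψ β hdeg hX',
      tensorHom_comp_tensorHom_assoc,
      reassoc_of% (transportBraid_natural ψ β hdeg (E.deg_act k hX')),
      tensorHom_comp_whiskerRight, Functor.map_comp, Functor.map_comp]
    have h1 := imageBraid_equivariant ψ β hψ k hX' (F.objPreimage Y) (by simp)
    simp only [Category.assoc]
    rw [← δ_natural_assoc, tensorHom_comp_whiskerRight, compApp_natural, comp_tensorHom_left,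
      reassoc_of% h1, tensorHom_comp_tensorHom, reassoc_of% (compApp_natural E'),
      act_map_eqToHom E' (by group) _ e' (by simp)]
    simp

end Transport

/-! ### Transport of a `G`-twist along an equivalence -/

section TransportTwist

open Functor.LaxMonoidal Functor.OplaxMonoidal Functor.Monoidal

universe v₁ v₂ u₁ u₂

variable {K : Type*} {G : Type*} {C : Type u₁} [Field K] [Group G]
  [Category.{v₁} C] [Preadditive C] [Linear K C] [MonoidalCategory C] [MonoidalPreadditive C]
  [MonoidalLinear K C]
variable {D : Type u₂} [Category.{v₂} D] [Preadditive D] [Linear K D] [MonoidalCategory D]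
  [MonoidalPreadditive D] [MonoidalLinear K D]
variable {E : GEquivariantStructure K G C} {E' : GEquivariantStructure K G D} {F : C ⥤ D}
  [F.Monoidal] (ψ : ∀ g, E.act g ⋙ F ≅ F ⋙ E'.act g) {β : GBraiding E} (τ : GTwist β)

/-- The image `F(X) ≅ ^g F(X)` of a `G`-twist under a `G`-equivariant functor. -/
def imageTwist {g : G} {X : C} (hX : E.deg g X) : F.obj X ≅ (E'.act g).obj (F.obj X) :=
  F.mapIso (τ.twist hX) ≪≫ psiApp ψ g X

theorem imageTwist_hom {g : G} {X : C} (hX : E.deg g X) :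
    (imageTwist ψ τ hX).hom = F.map (τ.twist hX).hom ≫ (psiApp ψ g X).hom := rfl

theorem imageTwist_natural {g : G} {X X' : C} (hX : E.deg g X) (hX' : E.deg g X') (f : X ⟶ X') :
    F.map f ≫ (imageTwist ψ τ hX').hom = (imageTwist ψ τ hX).hom ≫ (E'.act g).map (F.map f) := by
  rw [imageTwist_hom, imageTwist_hom, ← Functor.map_comp_assoc, τ.natural hX hX', Functor.map_comp,
    Category.assoc, psiApp_natural, Category.assoc]

theorem imageTwist_equivariant
    (hψ : ∀ (g h : G) (X : C), F.map (compApp E g h X).hom ≫ (psiApp ψ (g * h) X).hom =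
      (psiApp ψ g ((E.act h).obj X)).hom ≫ (E'.act g).map (psiApp ψ h X).hom ≫
        (compApp E' g h (F.obj X)).hom) (k : G) {g : G} {X : C} (hX : E.deg g X)
    (e : (E'.act (k * g * k⁻¹ * k)).obj (F.obj X) = (E'.act (k * g)).obj (F.obj X)) :
    (psiApp ψ k X).hom ≫ (E'.act k).map (imageTwist ψ τ hX).hom ≫ (compApp E' k g (F.obj X)).hom =
      (imageTwist ψ τ (E.deg_act k hX)).hom ≫ (E'.act (k * g * k⁻¹)).map (psiApp ψ k X).hom ≫
        (compApp E' (k * g * k⁻¹) k (F.obj X)).hom ≫ eqToHom e := by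
  have e' : (E.act (k * g * k⁻¹ * k)).obj X = (E.act (k * g)).obj X := by simp
  have h0 : F.map ((E.act k).map (τ.twist hX).hom ≫ (compApp E k g X).hom) =
      F.map ((τ.twist (E.deg_act k hX)).hom ≫ (compApp E (k * g * k⁻¹) k X).hom ≫ eqToHom e') :=
    congrArg F.map (τ.equivariant k hX)
  simp only [imageTwist_hom, Functor.map_comp, Category.assoc] at h0 ⊢
  rw [← reassoc_of% hψ, ← psiApp_eqToHom ψ (by group) X e', ← reassoc_of% h0, hψ,
    reassoc_of% (psiApp_natural ψ k)]

/-- The tensor axiom for the image of a `G`-twist. The second braiding is with `F(^g Y)`, since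
`^g F(Y)` is not literally in the image of `F`. -/
theorem imageTwist_tensor [∀ g, NatTrans.IsMonoidal (ψ g).hom]
    (hψ : ∀ (g h : G) (X : C), F.map (compApp E g h X).hom ≫ (psiApp ψ (g * h) X).hom =
      (psiApp ψ g ((E.act h).obj X)).hom ≫ (E'.act g).map (psiApp ψ h X).hom ≫
        (compApp E' g h (F.obj X)).hom) {g h : G} {X Y : C} (hX : E.deg g X) (hY : E.deg h Y)
    (e : (E'.act (g * h * g⁻¹ * g)).obj (F.obj X) = (E'.act (g * h)).obj (F.obj X)) :
    μ F X Y ≫ (imageTwist ψ τ (E.deg_tensor hX hY)).hom =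
      μ F X Y ≫ F.map (β.braid hX Y).hom ≫ δ F ((E.act g).obj Y) X ≫
        (imageBraid ψ β (E.deg_act g hY) X).hom ≫
        (((E'.act (g * h * g⁻¹)).map (imageTwist ψ τ hX).hom ≫
            (compApp E' (g * h * g⁻¹) g (F.obj X)).hom ≫ eqToHom e) ⊗ₘ
          ((psiApp ψ g Y).hom ≫ (E'.act g).map (imageTwist ψ τ hY).hom ≫
            (compApp E' g h (F.obj Y)).hom)) ≫
        μ (E'.act (g * h)) (F.obj X) (F.obj Y) ≫ (E'.act (g * h)).map (μ F X Y) := by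
  have e' : (E.act (g * h * g⁻¹ * g)).obj X = (E.act (g * h)).obj X := by simp
  have h0 : F.map (τ.twist (E.deg_tensor hX hY)).hom = F.map (
      (β.braid hX Y).hom ≫ (β.braid (E.deg_act g hY) X).hom ≫
        (((E.act (g * h * g⁻¹)).map (τ.twist hX).hom ≫ (compApp E (g * h * g⁻¹) g X).hom ≫
            eqToHom e') ⊗ₘ
          ((E.act g).map (τ.twist hY).hom ≫ (compApp E g h Y).hom)) ≫ μ (E.act (g * h)) X Y) :=
    congrArg F.map (τ.tensor hX hY)
  simp only [imageTwist_hom, imageBraid_hom, Functor.map_comp, Category.assoc] at h0 ⊢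
  have h1 : (psiApp ψ (g * h * g⁻¹) ((E.act g).obj X)).hom ≫
      (E'.act (g * h * g⁻¹)).map (psiApp ψ g X).hom ≫
        (compApp E' (g * h * g⁻¹) g (F.obj X)).hom ≫ eqToHom e =
      F.map ((compApp E (g * h * g⁻¹) g X).hom ≫ eqToHom e') ≫ (psiApp ψ (g * h) X).hom := by
    rw [← reassoc_of% hψ, ← psiApp_eqToHom ψ (by group) X e', Functor.map_comp, Category.assoc]
  rw [h0, δ_μ_assoc, ← reassoc_of% (comp_tensorHom_left (psiApp ψ (g * h * g⁻¹) X).hom),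
    ← reassoc_of% (psiApp_natural ψ), h1, ← reassoc_of% (psiApp_natural ψ), ← hψ]
  rw [← tensorHom_comp_tensorHom_assoc, ← tensorHom_comp_tensorHom_assoc, ← psiApp_tensor ψ,
    μ_natural_assoc, μ_natural_assoc, δ_μ_assoc, ← tensorHom_comp_tensorHom, Functor.map_comp]
  simp only [Category.assoc]

variable [F.IsEquivalence] (hdeg : ∀ (g : G) (X : C), E'.deg g (F.obj X) → E.deg g X)

/-- The isomorphism `X ≅ ^g X` obtained from the image of a `G`-twist by means of a chosen preimage
of `X` under the equivalence `F`. -/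
def transportTwistIso {g : G} {X : D} (hX : E'.deg g X) : X ≅ (E'.act g).obj X :=
  (F.objObjPreimageIso X).symm ≪≫ imageTwist ψ τ (deg_preimage hdeg hX) ≪≫
    (E'.act g).mapIso (F.objObjPreimageIso X)

/-- The transported isomorphism is determined by the image of the `G`-twist, for any comparison
of `X'` with an object in the image of `F`. -/
theorem transportTwistIso_natural {g : G} {X : C} {X' : D} (hX : E.deg g X)
    (hX' : E'.deg g X') (f : F.obj X ⟶ X') :
    f ≫ (transportTwistIso ψ τ hdeg hX').hom =
      (imageTwist ψ τ hX).hom ≫ (E'.act g).map f := by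
  obtain ⟨f', hf⟩ := F.map_surjective (f ≫ (F.objObjPreimageIso X').inv)
  simp only [transportTwistIso, Iso.trans_hom, Iso.symm_hom]
  rw [← Category.assoc, ← hf, reassoc_of% (imageTwist_natural ψ τ hX), Functor.mapIso_hom,
    ← Functor.map_comp, hf]
  simp

theorem transportTwistIso_obj {g : G} {X : C} (hX : E.deg g X) (hX' : E'.deg g (F.obj X)) :
    (transportTwistIso ψ τ hdeg hX').hom = (imageTwist ψ τ hX).hom := by
  simpa using transportTwistIso_natural ψ τ hdeg hX hX' (𝟙 (F.obj X))

/-- The components of the isomorphisms `X ≅ ^1 X`. -/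
def oneApp (E : GEquivariantStructure K G C) (X : C) : X ≅ (E.act 1).obj X :=
  E.actOne.app X

theorem oneApp_natural (E : GEquivariantStructure K G C) {X Y : C} (f : X ⟶ Y) :
    (E.act 1).map f ≫ (oneApp E Y).inv = (oneApp E X).inv ≫ f :=
  E.actOne.inv.naturality f

theorem psiApp_one_inv
    (hψ1 : ∀ X : C, F.map (oneApp E X).hom ≫ (psiApp ψ 1 X).hom = (oneApp E' (F.obj X)).hom)
    (X : C) : (psiApp ψ 1 X).hom ≫ (oneApp E' (F.obj X)).inv = F.map (oneApp E X).inv := by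
  rw [Iso.comp_inv_eq, ← hψ1, ← Functor.map_comp_assoc, Iso.inv_hom_id,
    CategoryTheory.Functor.map_id, Category.id_comp]

/-- The duality axiom for the transported twist. A dual pair `(X, Y)` in `D` lifts to a dual pair
of preimages because `F` is fully faithful; `ε ≫ F(η_ M N) ≫ δ` is then its coevaluation. -/
theorem transportTwist_dual [∀ g, NatTrans.IsMonoidal (ψ g).hom]
    (hψ : ∀ (g h : G) (X : C), F.map (compApp E g h X).hom ≫ (psiApp ψ (g * h) X).hom =
      (psiApp ψ g ((E.act h).obj X)).hom ≫ (E'.act g).map (psiApp ψ h X).hom ≫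
        (compApp E' g h (F.obj X)).hom)
    (hψ1 : ∀ X : C, F.map (oneApp E X).hom ≫ (psiApp ψ 1 X).hom = (oneApp E' (F.obj X)).hom)
    {g : G} {X Y : D} [ExactPairing X Y] (hX : E'.deg g X) (hY : E'.deg g⁻¹ Y) {M N : C}
    (eX : F.obj M ≅ X) (eY : F.obj N ≅ Y) (hM : E.deg g M) (hN : E.deg g⁻¹ N)
    (d : (E'.act (g * g⁻¹)).obj Y = (E'.act 1).obj Y) :
    η_ X Y ≫ (transportTwistIso ψ τ hdeg hX).hom ▷ Y =
      ε (E'.act g) ≫ (E'.act g).map (η_ X Y) ≫ δ (E'.act g) X Y ≫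
        (E'.act g).obj X ◁ ((E'.act g).map (transportTwistIso ψ τ hdeg hY).hom ≫
          (compApp E' g g⁻¹ Y).hom ≫ eqToHom d ≫ (oneApp E' Y).inv) := by
  let p1 : ExactPairing (F.obj M) (F.obj N) := exactPairingCongr eX eY
  let p2 : ExactPairing M N := .ofFullyFaithful F M N
  have d1 : (E.act (g * g⁻¹)).obj N = (E.act 1).obj N := by simp
  have d2 : (E'.act (g * g⁻¹)).obj (F.obj N) = (E'.act 1).obj (F.obj N) := by simp
  have h1 : η_ (F.obj M) (F.obj N) = η_ X Y ≫ X ◁ eY.inv ≫ eX.inv ▷ F.obj N :=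
    Category.assoc _ _ _
  have h2 : F.map (η_ M N) = η F ≫ η_ (F.obj M) (F.obj N) ≫ μ F M N := F.map_preimage _
  have h3 : η_ X Y = ε F ≫ F.map (η_ M N) ≫ δ F M N ≫ (eX.hom ⊗ₘ eY.hom) := by
    rw [h2, h1]
    simp only [Category.assoc, ε_η_assoc, μ_δ_assoc, MonoidalCategory.tensorHom_def]
    rw [← comp_whiskerRight_assoc, Iso.inv_hom_id, id_whiskerRight, Category.id_comp,
      ← MonoidalCategory.whiskerLeft_comp, Iso.inv_hom_id, MonoidalCategory.whiskerLeft_id,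
      Category.comp_id]
  have h0 : F.map (η_ M N ≫ (τ.twist hM).hom ▷ N) = F.map (
      ε (E.act g) ≫ (E.act g).map (η_ M N) ≫ δ (E.act g) M N ≫
        (E.act g).obj M ◁ ((E.act g).map (τ.twist hN).hom ≫ (compApp E g g⁻¹ N).hom ≫
          eqToHom d1 ≫ (oneApp E N).inv)) :=
    congrArg F.map (τ.dual hM hN)
  have h4 : (psiApp ψ g N).hom ≫ (E'.act g).map (imageTwist ψ τ hN).hom ≫
      (compApp E' g g⁻¹ (F.obj N)).hom ≫ eqToHom d2 ≫ (oneApp E' (F.obj N)).inv =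
      F.map ((E.act g).map (τ.twist hN).hom ≫ (compApp E g g⁻¹ N).hom ≫
          eqToHom d1 ≫ (oneApp E N).inv) := by
    simp only [imageTwist_hom, Functor.map_comp, Category.assoc]
    rw [← reassoc_of% (psiApp_natural ψ), ← reassoc_of% hψ,
      ← reassoc_of% (psiApp_eqToHom ψ (by group) N d1), psiApp_one_inv ψ hψ1]
  have h5 : (E'.act g).map eY.hom ≫ (E'.act g).map (transportTwistIso ψ τ hdeg hY).hom ≫
          (compApp E' g g⁻¹ Y).hom ≫ eqToHom d ≫ (oneApp E' Y).inv =
      ((E'.act g).map (imageTwist ψ τ hN).hom ≫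
      (compApp E' g g⁻¹ (F.obj N)).hom ≫ eqToHom d2 ≫ (oneApp E' (F.obj N)).inv) ≫ eY.hom := by
    rw [← Functor.map_comp_assoc, transportTwistIso_natural ψ τ hdeg hN, Functor.map_comp,
      Category.assoc, reassoc_of% (compApp_natural E'),
      reassoc_of% (act_map_eqToHom E' (show g * g⁻¹ = 1 by group) eY.hom d d2),
      oneApp_natural]
    simp only [Category.assoc]
  rw [h3]
  simp only [Functor.map_comp, Category.assoc]
  rw [← reassoc_of% (psiApp_unit ψ g), ← reassoc_of% (psiApp_natural ψ g), ← δ_natural_assoc,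
    reassoc_of% (psiApp_tensor_delta ψ g), tensorHom_comp_whiskerRight,
    transportTwistIso_natural ψ τ hdeg hM, imageTwist_hom, Category.assoc, comp_tensorHom_left,
    δ_natural_left_assoc, ← Functor.map_comp_assoc, h0, tensorHom_comp_whiskerLeft, h5,
    tensorHom_comp_tensorHom, ← Category.assoc (psiApp ψ g N).hom, h4, comp_tensorHom_right,
    δ_natural_right_assoc, comp_tensorHom_left]
  simp only [Functor.map_comp, Category.assoc]

/-- The `G`-twist on `D` transported along an equivalence `F : C ⥤ D`. -/
def transportTwist [∀ g, NatTrans.IsMonoidal (ψ g).hom]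
    (hψ : ∀ (g h : G) (X : C), F.map (compApp E g h X).hom ≫ (psiApp ψ (g * h) X).hom =
      (psiApp ψ g ((E.act h).obj X)).hom ≫ (E'.act g).map (psiApp ψ h X).hom ≫
        (compApp E' g h (F.obj X)).hom)
    (hψ1 : ∀ X : C, F.map (oneApp E X).hom ≫ (psiApp ψ 1 X).hom = (oneApp E' (F.obj X)).hom) :
    GTwist (transportBraiding ψ β hdeg hψ) where
  twist hX := transportTwistIso ψ τ hdeg hX
  natural {g X X'} hX hX' f := by
    rw [← cancel_epi (F.objObjPreimageIso X).hom,
      reassoc_of% (transportTwistIso_natural ψ τ hdeg (deg_preimage hdeg hX) hX), ← Category.assoc,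
      transportTwistIso_natural ψ τ hdeg (deg_preimage hdeg hX), Functor.map_comp]
  equivariant k {g X} hX := by
    have e' : (E'.act (k * g * k⁻¹ * k)).obj X = (E'.act (k * g)).obj X := by simp
    have hX' := deg_preimage hdeg hX
    change (E'.act k).map (transportTwistIso ψ τ hdeg hX).hom ≫ (compApp E' k g X).hom =
      (transportTwistIso ψ τ hdeg (E'.deg_act k hX)).hom ≫
        (compApp E' (k * g * k⁻¹) k X).hom ≫ eqToHom e'
    rw [← cancel_epi ((E'.act k).map (F.objObjPreimageIso X).hom),
      ← cancel_epi (psiApp ψ k (F.objPreimage X)).hom, ← Functor.map_comp_assoc,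
      transportTwistIso_natural ψ τ hdeg hX', ← Category.assoc (psiApp ψ k _).hom
        ((E'.act k).map (F.objObjPreimageIso X).hom),
      reassoc_of% (transportTwistIso_natural ψ τ hdeg (E.deg_act k hX')), Functor.map_comp,
      Functor.map_comp, Category.assoc, compApp_natural,
      reassoc_of% (imageTwist_equivariant ψ τ hψ k hX' (by simp)), Category.assoc,
      reassoc_of% (compApp_natural E'), act_map_eqToHom E' (by group) _ e' (by simp)]
  tensor {g h X Y} hX hY := by
    have e' : (E'.act (g * h * g⁻¹ * g)).obj X = (E'.act (g * h)).obj X := by simp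
    have hX' := deg_preimage hdeg hX
    have hY' := deg_preimage hdeg hY
    set e := F.objObjPreimageIso
    change (transportTwistIso ψ τ hdeg (E'.deg_tensor hX hY)).hom =
      (transportBraid ψ β hdeg hX Y).hom ≫
        (transportBraid ψ β hdeg (E'.deg_act g hY) X).hom ≫
        (((E'.act (g * h * g⁻¹)).map (transportTwistIso ψ τ hdeg hX).hom ≫
            (compApp E' (g * h * g⁻¹) g X).hom ≫ eqToHom e') ⊗ₘ
          ((E'.act g).map (transportTwistIso ψ τ hdeg hY).hom ≫ (compApp E' g h Y).hom)) ≫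
        μ (E'.act (g * h)) X Y
    have h1 : (e X).hom ⊗ₘ (e Y).hom = μ F (F.objPreimage X) (F.objPreimage Y) ≫
        δ F _ _ ≫ ((e X).hom ⊗ₘ (e Y).hom) := by rw [μ_δ_assoc]
    rw [← cancel_epi ((e X).hom ⊗ₘ (e Y).hom),
      reassoc_of% (transportBraid_natural ψ β hdeg hX'), h1, Category.assoc,
      transportTwistIso_natural ψ τ hdeg (E.deg_tensor hX' hY'),
      reassoc_of% (imageTwist_tensor ψ τ hψ hX' hY' (by simp)), imageBraid_hom ψ β hX']
    simp only [Category.assoc]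
    have h2 : (psiApp ψ g (F.objPreimage Y)).hom ▷ F.obj (F.objPreimage X) ≫
        ((E'.act g).map (e Y).hom ⊗ₘ (e X).hom) =
        ((psiApp ψ g (F.objPreimage Y)).hom ≫ (E'.act g).map (e Y).hom) ⊗ₘ (e X).hom := by
      rw [comp_tensorHom_left]
    rw [reassoc_of% h2, reassoc_of% (transportBraid_natural ψ β hdeg (E.deg_act g hY')),
      tensorHom_comp_tensorHom_assoc, ← Functor.map_comp_assoc,
      transportTwistIso_natural ψ τ hdeg hX', Category.assoc, ← Functor.map_comp_assoc,
      transportTwistIso_natural ψ τ hdeg hY', ← Functor.map_comp, μ_δ_assoc, ← μ_natural,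
      tensorHom_comp_tensorHom_assoc]
    simp only [Functor.map_comp, Category.assoc, compApp_natural]
    rw [reassoc_of% (compApp_natural E'), act_map_eqToHom E' (by group) _ e' (by simp)]
  dual {g X Y} _ hX hY := transportTwist_dual ψ τ hdeg hψ hψ1 hX hY
    (F.objObjPreimageIso X) (F.objObjPreimageIso Y) (deg_preimage hdeg hX) (deg_preimage hdeg hY) _

end TransportTwist

/-! ### Modules over an algebra and over a Hopf algebra -/

namespace RMod

section General

variable {K H : Type u} [Field K] [Ring H] [Algebra K H]

/-- A bijective homomorphism is an isomorphism. -/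
theorem isIso_of_bijective {V W : RMod K H} (f : V ⟶ W) (hf : Function.Bijective (lin f)) :
    IsIso f := by
  let e := LinearEquiv.ofBijective (lin f) hf
  have h : f = (mkIso e.toLinearMap e.symm.toLinearMap e.symm_apply_apply e.apply_symm_apply
    (lin_act f)).hom := rfl
  rw [h]
  infer_instance

theorem lin_hom_inv_apply {V W : RMod K H} (e : V ≅ W) (v : V) : lin e.inv (lin e.hom v) = v := by
  rw [← LinearMap.comp_apply, ← lin_comp, e.hom_inv_id]
  rfl

theorem lin_inv_hom_apply {V W : RMod K H} (e : V ≅ W) (w : W) : lin e.hom (lin e.inv w) = w := by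
  rw [← LinearMap.comp_apply, ← lin_comp, e.inv_hom_id]
  rfl

end General

section Hopf

variable {K A : Type u} [Field K] [Ring A] [HopfAlgebra K A]

/-- Over a Hopf algebra, `M ⊗̄ N` is the whole tensor product. -/
theorem incl_pr_hopf (M N : RMod K A) (x : M ⊗[K] N) : incl M N (pr M N x) = x := by
  rw [incl_pr, Bialgebra.comul_one, Algebra.TensorProduct.one_def, act₂_tmul, M.act_one, N.act_one,
    TensorProduct.map_id]
  rfl

end Hopf

end RMod

/-! ### The modules `F(M)` -/

section StrictObj

variable {K G A : Type u} [Field K] [Group G] [Fintype G] [Ring A] [HopfAlgebra K A]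
  (S : GWeakHopf K G A)

/-- The linear map `m ↦ m ⊗ k`. -/
def strictMk (M : RMod K A) (k : G) : M →ₗ[K] strictObj S M :=
  toStrict S M ∘ₗ Finsupp.lsingle k

/-- The linear map `M ⊗ K[G] → N`, `m ⊗ k ↦ f_k(m)`. -/
def strictLift (M : RMod K A) {N : Type u} [AddCommGroup N] [Module K N] (f : G → M →ₗ[K] N) :
    strictObj S M →ₗ[K] N :=
  (Finsupp.lsum K f : (G →₀ M) →ₗ[K] N)

@[simp]
theorem strictLift_mk (M : RMod K A) {N : Type u} [AddCommGroup N] [Module K N]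
    (f : G → M →ₗ[K] N) (k : G) (m : M) : strictLift S M f (strictMk S M k m) = f k m :=
  Finsupp.lsum_single _ _ _ _

theorem strictObj_induction {M : RMod K A} {motive : strictObj S M → Prop} (x : strictObj S M)
    (zero : motive 0) (add : ∀ x y, motive x → motive y → motive (x + y))
    (mk : ∀ k m, motive (strictMk S M k m)) : motive x :=
  Finsupp.induction_linear (motive := motive) x zero add mk

theorem strictObj_lin_ext {M : RMod K A} {N : Type u} [AddCommGroup N] [Module K N]
    {f f' : strictObj S M →ₗ[K] N} (h : ∀ k m, f (strictMk S M k m) = f' (strictMk S M k m)) :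
    f = f' :=
  Finsupp.lhom_ext (φ := (f : (G →₀ M) →ₗ[K] N)) (ψ := (f' : (G →₀ M) →ₗ[K] N)) h

theorem strictObj_hom_ext {M : RMod K A} {V : RMod K (Strict S)} {f f' : strictObj S M ⟶ V}
    (h : ∀ k m, RMod.lin f (strictMk S M k m) = RMod.lin f' (strictMk S M k m)) : f = f' :=
  RMod.hom_ext (LinearMap.congr_fun (strictObj_lin_ext S h))

theorem strictMk_injective (M : RMod K A) (k : G) : Function.Injective (strictMk S M k) :=
  Finsupp.single_injective k

open Classical in
theorem strictObj_act_of (M : RMod K A) (g h : G) (a : A) (k : G) (m : M) :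
    (strictObj S M).act (Strict.of S g h a) (strictMk S M k m) =
      if k * h = g then strictMk S M g (M.act (S.φ k a * S.c k h) m) else 0 :=
  strictAct_of S M g h a k m

open Classical in
theorem strictObj_act_unit (M : RMod K A) (g : G) (k : G) (m : M) :
    (strictObj S M).act (Strict.of S g 1 1) (strictMk S M k m) =
      if k = g then strictMk S M k m else 0 := by
  rw [strictObj_act_of, mul_one]
  split_ifs with h
  · rw [map_one, S.c_one_right, h]
    simp [RMod.act_one_apply]
  · rfl

/-- The homomorphism `f ⊗ id : F(M) → F(N)`, typed with `strictObj`. -/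
def strictMap {M N : RMod K A} (f : M ⟶ N) : strictObj S M ⟶ strictObj S N :=
  (strictFunctor S).map f

theorem strictMap_mk {M N : RMod K A} (f : M ⟶ N) (k : G) (m : M) :
    RMod.lin (strictMap S f) (strictMk S M k m) = strictMk S N k (RMod.lin f m) :=
  Finsupp.mapRange_single (hf := map_zero _)

/-- A linear map `f` out of `F(M)` is `A^str`-linear if it respects the action of `δ_g ⊗ a ⊗ h` on
`m ⊗ k` for `g = kh`, and if this element kills `f(m ⊗ k)` for `g ≠ kh`. -/
theorem strict_ofLin_act (M : RMod K A) {V : RMod K (Strict S)} (f : strictObj S M →ₗ[K] V)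
    (h : ∀ (k h : G) (a : A) (m : M),
      f ((strictObj S M).act (Strict.of S (k * h) h a) (strictMk S M k m)) =
        V.act (Strict.of S (k * h) h a) (f (strictMk S M k m)))
    (h0 : ∀ (k g h : G) (a : A) (m : M), k * h ≠ g →
        V.act (Strict.of S g h a) (f (strictMk S M k m)) = 0)
    (x : Strict S) (v : strictObj S M) : f ((strictObj S M).act x v) = V.act x (f v) := by
  rw [← LinearMap.comp_apply, ← LinearMap.comp_apply]
  refine LinearMap.congr_fun ?_ v
  induction x using Strict.induction with
  | zero => simp
  | add x x' h h' => rw [map_add, map_add, LinearMap.comp_add, LinearMap.add_comp, h, h']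
  | of g p a =>
    refine strictObj_lin_ext S fun k m => ?_
    rw [LinearMap.comp_apply, LinearMap.comp_apply]
    by_cases hk : k * p = g
    · rw [← hk, h]
    · rw [strictObj_act_of, if_neg hk, map_zero, h0 k g p a m hk]

theorem strictMap_id (M : RMod K A) : strictMap S (𝟙 M) = 𝟙 (strictObj S M) :=
  (strictFunctor S).map_id M

theorem strictMap_add {M N : RMod K A} (f f' : M ⟶ N) :
    strictMap S (f + f') = strictMap S f + strictMap S f' :=
  strictObj_hom_ext S fun k m => by
    simp only [RMod.lin_add, LinearMap.add_apply, strictMap_mk, map_add]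

theorem strictMap_smul {M N : RMod K A} (r : K) (f : M ⟶ N) :
    strictMap S (r • f) = r • strictMap S f :=
  strictObj_hom_ext S fun k m => by
    simp only [RMod.lin_smul, LinearMap.smul_apply, strictMap_mk, map_smul]

instance : (strictFunctor S).Additive where
  map_add := strictMap_add S _ _

instance : (strictFunctor S).Linear K where
  map_smul f r := strictMap_smul S r f

/-! ### The isomorphism `F(M) ⊗̄ F(N) ≅ F(M ⊗ N)` -/

/-- The linear map `M ⊗ N → F(M) ⊗ F(N)`, `m ⊗ n ↦ (m ⊗ k) ⊗ (n ⊗ k)`. -/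
def diagMk (M N : RMod K A) (k : G) : M ⊗[K] N →ₗ[K] strictObj S M ⊗[K] strictObj S N :=
  TensorProduct.map (strictMk S M k) (strictMk S N k)

theorem act₂_comul_one_diagMk (M N : RMod K A) (k : G) (t : M ⊗[K] N) :
    RMod.act₂ (strictObj S M) (strictObj S N) (comul (R := K) 1) (diagMk S M N k t) =
      diagMk S M N k t := by
  classical
  induction t using TensorProduct.induction_on with
  | zero => simp
  | add a b ha hb => simp only [map_add, ha, hb]
  | tmul m n =>
    rw [Strict.comul_one, map_sum, LinearMap.sum_apply, Finset.sum_eq_single k]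
    · simp [diagMk, strictObj_act_unit]
    · intro g _ hg
      simp [diagMk, strictObj_act_unit, hg.symm]
    · simp

theorem incl_pr_diagMk (M N : RMod K A) (k : G) (t : M ⊗[K] N) :
    RMod.incl _ _ (RMod.pr (strictObj S M) (strictObj S N) (diagMk S M N k t)) =
      diagMk S M N k t := by
  rw [RMod.incl_pr, act₂_comul_one_diagMk]

/-- The multiplication by `Δ(1)` kills the off-diagonal part of `F(M) ⊗ F(N)`. -/
theorem act₂_comul_one_mk_ne (M N : RMod K A) {k l : G} (h : k ≠ l) (m : M) (n : N) :
    RMod.act₂ (strictObj S M) (strictObj S N) (comul (R := K) 1)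
      (strictMk S M k m ⊗ₜ strictMk S N l n) = 0 := by
  classical
  rw [Strict.comul_one, map_sum, LinearMap.sum_apply]
  refine Finset.sum_eq_zero fun g _ => ?_
  rw [RMod.act₂_tmul, TensorProduct.map_tmul, strictObj_act_unit, strictObj_act_unit]
  by_cases hk : k = g
  · rw [if_neg (fun h2 => h (hk.trans h2.symm) : ¬l = g), TensorProduct.tmul_zero]
  · rw [if_neg hk, TensorProduct.zero_tmul]

theorem act₂_comul_diagMk (M N : RMod K A) (k h : G) (a : A) (t : M ⊗[K] N) :
    RMod.act₂ (strictObj S M) (strictObj S N) (comul (R := K) (Strict.of S (k * h) h a))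
      (diagMk S M N k t) = diagMk S M N (k * h) (RMod.act₂ M N
        (comul (R := K) (S.φ k a * S.c k h)) t) := by
  classical
  rw [Strict.comul_of, Bialgebra.comul_mul, S.comul_φ, S.comul_c, Bialgebra.comul_one, mul_one]
  induction comul (R := K) a using TensorProduct.induction_on with
  | zero => simp
  | add a b ha hb => simp only [map_add, add_mul, LinearMap.add_apply, ha, hb]
  | tmul a b =>
    induction t using TensorProduct.induction_on with
    | zero => simp
    | add a b ha hb => simp only [map_add, ha, hb]
    | tmul m n => simp [diagMk, strictObj_act_of]

theorem act₂_comul_diagMk_ne (M N : RMod K A) {k g h : G} (hk : k * h ≠ g) (a : A)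
    (t : M ⊗[K] N) :
    RMod.act₂ (strictObj S M) (strictObj S N) (comul (R := K) (Strict.of S g h a))
      (diagMk S M N k t) = 0 := by
  classical
  rw [Strict.comul_of]
  induction comul (R := K) a using TensorProduct.induction_on with
  | zero => simp
  | add a b ha hb => simp only [map_add, LinearMap.add_apply, ha, hb, add_zero]
  | tmul a b =>
    induction t using TensorProduct.induction_on with
    | zero => simp
    | add a b ha hb => simp only [map_add, ha, hb, add_zero]
    | tmul m n => simp [diagMk, strictObj_act_of, hk]

/-- The homomorphism `F(M ⊗ N) → F(M) ⊗̄ F(N)`, `m ⊗ n ⊗ k ↦ (m ⊗ k) ⊗ (n ⊗ k)`. -/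
def strictDelta (M N : RMod K A) :
    strictObj S (RMod.tensor M N) ⟶ RMod.tensor (strictObj S M) (strictObj S N) :=
  RMod.ofLin (strictLift S (RMod.tensor M N) fun k =>
      RMod.pr (strictObj S M) (strictObj S N) ∘ₗ diagMk S M N k ∘ₗ RMod.incl M N)
    (strict_ofLin_act S _ _ (fun k h a x => by
      classical
      rw [strictObj_act_of, if_pos rfl, strictLift_mk, strictLift_mk]
      refine RMod.incl_injective _ _ ?_
      simp only [LinearMap.comp_apply]
      rw [incl_pr_diagMk, RMod.incl_act, RMod.incl_act, incl_pr_diagMk, act₂_comul_diagMk])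
    (fun k g h a x hk => RMod.incl_injective _ _ (by
      rw [strictLift_mk, map_zero, RMod.incl_act, LinearMap.comp_apply, LinearMap.comp_apply,
        incl_pr_diagMk]
      exact act₂_comul_diagMk_ne S M N hk a _)))

theorem strictDelta_mk (M N : RMod K A) (k : G) (x : RMod.tensor M N) :
    RMod.lin (strictDelta S M N) (strictMk S (RMod.tensor M N) k x) =
      RMod.pr (strictObj S M) (strictObj S N) (diagMk S M N k (RMod.incl M N x)) :=
  strictLift_mk _ _ _ _ _

theorem incl_strictDelta (M N : RMod K A) (k : G) (x : RMod.tensor M N) :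
    RMod.incl _ _ (RMod.lin (strictDelta S M N) (strictMk S (RMod.tensor M N) k x)) =
      diagMk S M N k (RMod.incl M N x) := by
  rw [strictDelta_mk, incl_pr_diagMk]

open Classical in
/-- The linear map `F(M) ⊗ F(N) → F(M ⊗ N)`, `(m ⊗ k) ⊗ (n ⊗ l) ↦ δ(k, l) m ⊗ n ⊗ k`, inverse to
`strictDelta` on `F(M) ⊗̄ F(N)`. -/
def strictMuLin (M N : RMod K A) :
    strictObj S M ⊗[K] strictObj S N →ₗ[K] strictObj S (RMod.tensor M N) :=
  TensorProduct.lift (strictLift S M fun k => LinearMap.flip (strictLift S N fun l =>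
    LinearMap.flip (if k = l then (TensorProduct.mk K M N).compr₂
      (strictMk S (RMod.tensor M N) k ∘ₗ RMod.pr M N) else 0)))

open Classical in
theorem strictMuLin_tmul (M N : RMod K A) (k l : G) (m : M) (n : N) :
    strictMuLin S M N (strictMk S M k m ⊗ₜ strictMk S N l n) =
      if k = l then strictMk S (RMod.tensor M N) k (RMod.pr M N (m ⊗ₜ n)) else 0 := by
  rw [strictMuLin, TensorProduct.lift.tmul, strictLift_mk, LinearMap.flip_apply, strictLift_mk,
    LinearMap.flip_apply]
  split_ifs <;> rfl

theorem strictMuLin_diagMk (M N : RMod K A) (k : G) (t : M ⊗[K] N) :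
    strictMuLin S M N (diagMk S M N k t) = strictMk S (RMod.tensor M N) k (RMod.pr M N t) := by
  induction t using TensorProduct.induction_on with
  | zero => simp
  | add a b ha hb => simp only [map_add, ha, hb]
  | tmul m n => rw [diagMk, TensorProduct.map_tmul, strictMuLin_tmul, if_pos rfl]

theorem strictDelta_strictMuLin (M N : RMod K A) (t : strictObj S M ⊗[K] strictObj S N) :
    RMod.lin (strictDelta S M N) (strictMuLin S M N t) = RMod.pr _ _ t := by
  rw [← LinearMap.comp_apply]
  refine LinearMap.congr_fun ?_ t
  refine TensorProduct.ext (strictObj_lin_ext S fun k m => strictObj_lin_ext S fun l n => ?_)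
  change RMod.lin (strictDelta S M N) (strictMuLin S M N (strictMk S M k m ⊗ₜ strictMk S N l n)) =
    RMod.pr _ _ (strictMk S M k m ⊗ₜ strictMk S N l n)
  rw [strictMuLin_tmul]
  refine RMod.incl_injective _ _ ?_
  split_ifs with h
  · subst h
    rw [incl_strictDelta, RMod.incl_pr_hopf, ← incl_pr_diagMk]
    rfl
  · rw [map_zero, map_zero, RMod.incl_pr, act₂_comul_one_mk_ne S M N h]

instance (M N : RMod K A) : IsIso (strictDelta S M N) := by
  refine RMod.isIso_of_bijective _ ⟨Function.LeftInverse.injective (g := fun x =>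
    strictMuLin S M N (RMod.incl _ _ x)) ?_, fun y => ⟨strictMuLin S M N (RMod.incl _ _ y), ?_⟩⟩
  · intro x
    have h : strictMuLin S M N ∘ₗ RMod.incl _ _ ∘ₗ RMod.lin (strictDelta S M N) =
        LinearMap.id := strictObj_lin_ext S fun k x => ?_
    · exact LinearMap.congr_fun h x
    rw [LinearMap.comp_apply, LinearMap.comp_apply, incl_strictDelta, strictMuLin_diagMk,
      RMod.pr_incl]
    rfl
  · rw [strictDelta_strictMuLin, RMod.pr_incl]

theorem strictDelta_natural {M M' N N' : RMod K A} (f : M ⟶ M') (f' : N ⟶ N') :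
    strictDelta S M N ≫ RMod.tmap (strictMap S f) (strictMap S f') =
      strictMap S (RMod.tmap f f') ≫ strictDelta S M' N' :=
  strictObj_hom_ext S fun k x => RMod.incl_injective _ _ (by
    simp only [RMod.lin_comp, LinearMap.comp_apply]
    rw [RMod.incl_tmap, incl_strictDelta]
    rw [strictMap_mk, incl_strictDelta, RMod.incl_tmap]
    generalize RMod.incl _ _ x = y
    induction y using TensorProduct.induction_on with
    | zero => simp
    | add a b ha hb => simp only [map_add, ha, hb]
    | tmul m n => simp only [diagMk, TensorProduct.map_tmul, strictMap_mk])

end StrictObj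

/-! ### The tensor functor `F` -/

section StrictTensor

variable {K G A : Type u} [Field K] [Group G] [Fintype G] [Ring A] [HopfAlgebra K A]
  (S : GWeakHopf K G A)

theorem counitalSource_hopf (x : A) : counitalSource K x = counit (R := K) x • (1 : A) := by
  simp [counitalSource, Algebra.TensorProduct.one_def]

/-- Over a Hopf algebra the tensor unit is `K • 1`. -/
theorem unitIncl_hopf (z : RMod.unit K A) : RMod.unitIncl z = RMod.unitCounit z • (1 : A) := by
  conv_lhs => rw [← RMod.unitPr_unitIncl z, RMod.unitIncl_unitPr, counitalSource_hopf]
  rfl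

theorem unitIncl_act_hopf (z : RMod.unit K A) (a : A) :
    RMod.unitIncl ((RMod.unit K A).act a z) =
      (RMod.unitCounit z * counit (R := K) a) • (1 : A) := by
  rw [RMod.unit_act, RMod.unitIncl_unitPr, counitalSource_hopf, Bialgebra.counit_mul]
  rfl

/-- The linear map `F(𝟙) → 𝟙`, `z ⊗ k ↦ δ_k ⊗ z ⊗ 1`. -/
def strictEtaLin : strictObj S (RMod.unit K A) →ₗ[K] RMod.unit K (Strict S) :=
  strictLift S _ fun k => RMod.unitPr ∘ₗ Strict.of S k 1 ∘ₗ RMod.unitIncl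

theorem unitIncl_strictEtaLin (k : G) (z : RMod.unit K A) :
    RMod.unitIncl (strictEtaLin S (strictMk S _ k z)) = Strict.of S k 1 (RMod.unitIncl z) := by
  rw [strictEtaLin, strictLift_mk, LinearMap.comp_apply, LinearMap.comp_apply,
    RMod.unitIncl_unitPr, Strict.counitalSource_of, unitIncl_hopf]
  simp

/-- The homomorphism `F(𝟙) → 𝟙`, `z ⊗ k ↦ δ_k ⊗ z ⊗ 1`. -/
def strictEta : strictObj S (RMod.unit K A) ⟶ RMod.unit K (Strict S) :=
  RMod.ofLin (strictEtaLin S) (strict_ofLin_act S _ _ (fun k h a z => by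
    classical
    refine RMod.unitIncl_injective ?_
    rw [strictObj_act_of, if_pos rfl, unitIncl_strictEtaLin, unitIncl_act_hopf, RMod.unit_act,
      RMod.unitIncl_unitPr, unitIncl_strictEtaLin, Strict.of_mul_of, if_pos rfl,
      Strict.counitalSource_of, unitIncl_hopf]
    simp [Bialgebra.counit_mul, S.counit_φ, Strict.counit_c, mul_smul]) (fun k g h a z hk => by
    classical
    refine RMod.unitIncl_injective ?_
    rw [RMod.unit_act, RMod.unitIncl_unitPr, unitIncl_strictEtaLin, Strict.of_mul_of, if_neg hk,
      map_zero, map_zero]))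

theorem unitIncl_strictEta (k : G) (z : RMod.unit K A) :
    RMod.unitIncl (RMod.lin (strictEta S) (strictMk S _ k z)) =
      Strict.of S k 1 (RMod.unitIncl z) := unitIncl_strictEtaLin S k z

instance : IsIso (strictEta S) := by
  let r : Strict S →ₗ[K] strictObj S (RMod.unit K A) :=
    Strict.lift S fun g _ => strictMk S (RMod.unit K A) g ∘ₗ RMod.unitPr
  refine RMod.isIso_of_bijective _ ⟨Function.LeftInverse.injective (g := fun z =>
    r (RMod.unitIncl z)) fun x => ?_, fun z => ⟨r (RMod.unitIncl z), ?_⟩⟩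
  · have h : r ∘ₗ RMod.unitIncl ∘ₗ RMod.lin (strictEta S) = LinearMap.id :=
      strictObj_lin_ext S fun k z => ?_
    · exact LinearMap.congr_fun h x
    rw [LinearMap.comp_apply, LinearMap.comp_apply, unitIncl_strictEta, Strict.lift_of,
      LinearMap.comp_apply, RMod.unitPr_unitIncl]
    rfl
  · have h : RMod.lin (strictEta S) ∘ₗ r = RMod.unitPr := Strict.lin_ext S fun g h a => ?_
    · conv_rhs => rw [← RMod.unitPr_unitIncl z]
      exact LinearMap.congr_fun h _
    refine RMod.unitIncl_injective ?_
    rw [LinearMap.comp_apply, Strict.lift_of, LinearMap.comp_apply, unitIncl_strictEta,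
      RMod.unitIncl_unitPr, RMod.unitIncl_unitPr, counitalSource_hopf, Strict.counitalSource_of,
      map_smul]

theorem strictDelta_assoc (U V W : RMod K A) :
    strictDelta S (RMod.tensor U V) W ≫
        RMod.tmap (strictDelta S U V) (𝟙 (strictObj S W)) ≫ (RMod.assoc _ _ _).hom =
      strictMap S (RMod.assoc U V W).hom ≫ strictDelta S U (RMod.tensor V W) ≫
        RMod.tmap (𝟙 (strictObj S U)) (strictDelta S V W) :=
  strictObj_hom_ext S fun k x => RMod.incl_injective _ _ <| RMod.lTensor_incl_injective _ _ (by
    simp only [RMod.lin_comp, LinearMap.comp_apply]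
    rw [RMod.inclRight_assoc, RMod.incl_tmap, RMod.incl_tmap, incl_strictDelta, strictMap_mk,
      incl_strictDelta]
    have h1 (y : RMod.tensor U V ⊗[K] W) :
        (RMod.incl (strictObj S U) (strictObj S V)).rTensor (strictObj S W)
          (TensorProduct.map (RMod.lin (strictDelta S U V)) (RMod.lin (𝟙 (strictObj S W)))
            (diagMk S (RMod.tensor U V) W k y)) =
        TensorProduct.map (diagMk S U V k) (strictMk S W k) ((RMod.incl U V).rTensor W y) := by
      induction y using TensorProduct.induction_on with
      | zero => simp
      | add S S' h h' => simp only [map_add, h, h']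
      | tmul u v => simp [diagMk, incl_strictDelta]
    have h2 (y : U ⊗[K] RMod.tensor V W) :
        (RMod.incl (strictObj S V) (strictObj S W)).lTensor (strictObj S U)
          (TensorProduct.map (RMod.lin (𝟙 (strictObj S U))) (RMod.lin (strictDelta S V W))
            (diagMk S U (RMod.tensor V W) k y)) =
        TensorProduct.map (strictMk S U k) (diagMk S V W k) ((RMod.incl V W).lTensor U y) := by
      induction y using TensorProduct.induction_on with
      | zero => simp
      | add S S' h h' => simp only [map_add, h, h']
      | tmul u v => simp [diagMk, incl_strictDelta]
    rw [h1, h2, RMod.inclRight_assoc]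
    simp only [diagMk]
    rw [TensorProduct.map_map_assoc])

theorem strictDelta_left_unit (M : RMod K A) :
    (RMod.leftUnit (strictObj S M)).inv = strictMap S (RMod.leftUnit M).inv ≫
      strictDelta S (RMod.unit K A) M ≫ RMod.tmap (strictEta S) (𝟙 (strictObj S M)) :=
  strictObj_hom_ext S fun k x => RMod.incl_injective _ _ (by
    classical
    simp only [RMod.lin_comp, LinearMap.comp_apply]
    rw [RMod.incl_tmap, strictMap_mk, incl_strictDelta]
    change RMod.incl _ _ (RMod.pr _ _ (RMod.unitPr 1 ⊗ₜ strictMk S M k x)) =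
      TensorProduct.map _ _ (diagMk S _ _ k (RMod.incl _ _ (RMod.pr _ _ (RMod.unitPr 1 ⊗ₜ x))))
    rw [RMod.incl_pr_hopf, RMod.incl_pr, Strict.comul_one, map_sum, LinearMap.sum_apply,
      Finset.sum_eq_single k]
    · simp only [RMod.act₂_tmul, TensorProduct.map_tmul, diagMk, strictObj_act_unit, if_true,
        RMod.act_unitPr, one_mul]
      congr 1
      refine RMod.unitIncl_injective ?_
      rw [unitIncl_strictEta, RMod.unitIncl_unitPr, RMod.unitIncl_unitPr, counitalSource_one,
        Strict.counitalSource_of, Bialgebra.counit_one, one_smul]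
    · intro g _ hg
      simp [strictObj_act_unit, hg.symm]
    · simp)

theorem strictDelta_right_unit (M : RMod K A) :
    (RMod.rightUnit (strictObj S M)).inv = strictMap S (RMod.rightUnit M).inv ≫
      strictDelta S M (RMod.unit K A) ≫ RMod.tmap (𝟙 (strictObj S M)) (strictEta S) :=
  strictObj_hom_ext S fun k x => RMod.incl_injective _ _ (by
    classical
    simp only [RMod.lin_comp, LinearMap.comp_apply]
    rw [RMod.incl_tmap, strictMap_mk, incl_strictDelta]
    change RMod.incl _ _ (RMod.pr _ _ (strictMk S M k x ⊗ₜ RMod.unitPr 1)) =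
      TensorProduct.map _ _ (diagMk S _ _ k (RMod.incl _ _ (RMod.pr _ _ (x ⊗ₜ RMod.unitPr 1))))
    rw [RMod.incl_pr_hopf, RMod.incl_pr, Strict.comul_one, map_sum, LinearMap.sum_apply,
      Finset.sum_eq_single k]
    · simp only [RMod.act₂_tmul, TensorProduct.map_tmul, diagMk, strictObj_act_unit, if_true,
        RMod.act_unitPr, one_mul]
      congr 1
      refine RMod.unitIncl_injective ?_
      rw [unitIncl_strictEta, RMod.unitIncl_unitPr, RMod.unitIncl_unitPr, counitalSource_one,
        Strict.counitalSource_of, Bialgebra.counit_one, one_smul]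
    · intro g _ hg
      simp [strictObj_act_unit, hg.symm]
    · simp)

/-- The oplax tensor structure on `F`, given by the isomorphisms `strictEta` and `strictDelta`. -/
@[reducible]
def strictOplax : (strictFunctor S).OplaxMonoidal where
  η := strictEta S
  δ := strictDelta S
  δ_natural_left f N := by
    have h := strictDelta_natural S f (𝟙 N)
    rw [strictMap_id] at h
    exact h
  δ_natural_right M f := by
    have h := strictDelta_natural S (𝟙 M) f
    rw [strictMap_id] at h
    exact h
  oplax_associativity := strictDelta_assoc S
  oplax_left_unitality := strictDelta_left_unit S
  oplax_right_unitality := strictDelta_right_unit S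

/-- `F` is a tensor functor. -/
@[reducible]
def strictMonoidal : (strictFunctor S).Monoidal :=
  letI := strictOplax S
  haveI : IsIso (Functor.OplaxMonoidal.η (strictFunctor S)) :=
    inferInstanceAs (IsIso (strictEta S))
  haveI (M N : RMod K A) : IsIso (Functor.OplaxMonoidal.δ (strictFunctor S) M N) :=
    inferInstanceAs (IsIso (strictDelta S M N))
  Functor.Monoidal.ofOplaxMonoidal (strictFunctor S)

instance strictFunctorMonoidal : (strictFunctor S).Monoidal := strictMonoidal S

theorem strictFunctor_δ (M N : RMod K A) :
    Functor.OplaxMonoidal.δ (strictFunctor S) M N = strictDelta S M N := rfl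

theorem strictFunctor_μ_diag (M N : RMod K A) (k : G) (t : M ⊗[K] N) :
    RMod.lin (Functor.LaxMonoidal.μ (strictFunctor S) M N)
      (RMod.pr (strictObj S M) (strictObj S N) (diagMk S M N k t)) =
    strictMk S (RMod.tensor M N) k (RMod.pr M N t) := by
  have h : RMod.lin (Functor.LaxMonoidal.μ (strictFunctor S) M N)
      (RMod.lin (strictDelta S M N) (strictMk S (RMod.tensor M N) k (RMod.pr M N t))) =
      strictMk S (RMod.tensor M N) k (RMod.pr M N t) := by
    have h1 := Functor.Monoidal.δ_μ (strictFunctor S) M N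
    rw [strictFunctor_δ] at h1
    exact LinearMap.congr_fun (congrArg RMod.lin h1) _
  rw [strictDelta_mk, RMod.incl_pr_hopf] at h
  exact h

/-! ### The isomorphisms `F(^g M) ≅ ^g F(M)` -/

/-- The isomorphism `ψ_g : F(^g M) ≅ ^g F(M)`, `m ⊗ k ↦ m.c_{g⁻¹,k} ⊗ g⁻¹k`. -/
def strictPsi (g : G) (M : RMod K A) : strictObj S (RMod.twist S.toWeakAction g M) ≅
    RMod.twist (strict S).toWeakAction g (strictObj S M) :=
  RMod.mkIso
    (RMod.toTw _ g _ ∘ₗ strictLift S _ fun k =>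
      strictMk S M (g⁻¹ * k) ∘ₗ M.act (S.c g⁻¹ k : A) ∘ₗ RMod.fromTw _ g M)
    ((strictLift S M fun k => strictMk S _ (g * k) ∘ₗ RMod.toTw S.toWeakAction g M ∘ₗ
      M.act ((S.c g⁻¹ (g * k))⁻¹ : Aˣ)) ∘ₗ RMod.fromTw _ g _)
    (fun x => by
      induction x using strictObj_induction with
      | zero => simp
      | add x y hx hy => rw [map_add, map_add, hx, hy]
      | mk k m =>
      simp only [LinearMap.comp_apply, strictLift_mk, RMod.fromTw_toTw]
      rw [mul_inv_cancel_left, ← RMod.act_mul_apply, Units.mul_inv, RMod.act_one_apply,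
        RMod.toTw_fromTw])
    (fun x => RMod.fromTw_injective _ _ _ (by
      obtain ⟨x, rfl⟩ : ∃ y, RMod.toTw _ g _ y = x := ⟨_, RMod.toTw_fromTw _ g _ x⟩
      simp only [LinearMap.comp_apply, RMod.fromTw_toTw]
      induction x using strictObj_induction with
      | zero => simp
      | add x y hx hy => rw [map_add, map_add, hx, hy]
      | mk k m =>
      simp only [LinearMap.comp_apply, strictLift_mk, RMod.fromTw_toTw]
      rw [inv_mul_cancel_left, ← RMod.act_mul_apply, Units.inv_mul, RMod.act_one_apply]))
    (strict_ofLin_act S _ _ (fun k h a m => RMod.fromTw_injective _ _ _ (by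
      classical
      simp only [LinearMap.comp_apply, RMod.fromTw_toTw, RMod.fromTw_act]
      rw [strictObj_act_of, if_pos rfl, strictLift_mk, strictLift_mk]
      simp only [LinearMap.comp_apply, RMod.fromTw_act]
      change _ = (strictObj S M).act (Strict.shift S g⁻¹ (Strict.of S (k * h) h a)) _
      rw [Strict.shift_of, strictObj_act_of, if_pos (mul_assoc _ _ _), ← RMod.act_mul_apply,
        ← RMod.act_mul_apply, map_mul (S.φ g⁻¹), mul_assoc (S.φ g⁻¹ _), S.cocycle,
        ← mul_assoc (S.φ g⁻¹ _), S.φ_φ_mul_c]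
      simp only [mul_assoc]))
    (fun k p h a m hk => RMod.fromTw_injective _ _ _ (by
      classical
      simp only [LinearMap.comp_apply, RMod.fromTw_toTw, RMod.fromTw_act]
      rw [strictLift_mk]
      change (strictObj S M).act (Strict.shift S g⁻¹ (Strict.of S p h a)) _ = _
      rw [Strict.shift_of, LinearMap.comp_apply, strictObj_act_of, if_neg, map_zero]
      rw [mul_assoc]
      exact fun h1 => hk (mul_left_cancel h1))))

theorem fromTw_strictPsi (g : G) (M : RMod K A) (k : G) (m : RMod.twist S.toWeakAction g M) :
    RMod.fromTw _ g _ (RMod.lin (strictPsi S g M).hom (strictMk S _ k m)) =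
      strictMk S M (g⁻¹ * k) (M.act (S.c g⁻¹ k : A) (RMod.fromTw _ g M m)) :=
  strictLift_mk _ _ _ _ _

theorem strictPsi_natural (g : G) {M N : RMod K A} (f : M ⟶ N) :
    strictMap S (RMod.twistMap S.toWeakAction g f) ≫ (strictPsi S g N).hom =
      (strictPsi S g M).hom ≫ RMod.twistMap (strict S).toWeakAction g (strictMap S f) :=
  strictObj_hom_ext S fun k m => RMod.fromTw_injective _ _ _ (by
    simp only [RMod.lin_comp, LinearMap.comp_apply]
    rw [strictMap_mk, fromTw_strictPsi, RMod.fromTw_twistMap, RMod.fromTw_twistMap,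
      fromTw_strictPsi, strictMap_mk, RMod.lin_act])

theorem strictPsi_unit (g : G) :
    strictMap S (RMod.twistUnit S g).hom ≫ (strictPsi S g (RMod.unit K A)).hom ≫
        RMod.twistMap (strict S).toWeakAction g (strictEta S) =
      strictEta S ≫ (RMod.twistUnit (strict S) g).hom :=
  strictObj_hom_ext S fun k z => RMod.fromTw_injective _ _ _ <| RMod.unitIncl_injective (by
    simp only [RMod.lin_comp, LinearMap.comp_apply]
    rw [RMod.unitIncl_twistUnit, RMod.fromTw_twistMap, strictMap_mk, fromTw_strictPsi,
      unitIncl_strictEta, unitIncl_strictEta, unitIncl_act_hopf, RMod.unitCounit_twistUnit,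
      Strict.counit_c, mul_one, unitIncl_hopf]
    exact (Strict.shift_of S _ _ _ _).symm)

theorem strictPsi_tensor (g : G) (M N : RMod K A) :
    strictMap S (RMod.twistTensor S g M N).hom ≫ (strictPsi S g (RMod.tensor M N)).hom ≫
        RMod.twistMap (strict S).toWeakAction g (strictDelta S M N) =
      strictDelta S _ _ ≫ RMod.tmap (strictPsi S g M).hom (strictPsi S g N).hom ≫
        (RMod.twistTensor (strict S) g (strictObj S M) (strictObj S N)).hom :=
  strictObj_hom_ext S fun k x => RMod.fromTw_injective _ _ _ <| RMod.incl_injective _ _ (by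
    simp only [RMod.lin_comp, LinearMap.comp_apply]
    rw [RMod.incl_twistTensor, RMod.incl_tmap, incl_strictDelta, RMod.fromTw_twistMap,
      strictMap_mk, fromTw_strictPsi, incl_strictDelta, RMod.incl_act, RMod.incl_twistTensor,
      S.comul_c, Bialgebra.comul_one, mul_one]
    generalize RMod.incl _ _ x = y
    induction y using TensorProduct.induction_on with
    | zero => simp
    | add a b ha hb => simp only [map_add, ha, hb]
    | tmul m n => simp [diagMk, RMod.fromTw₂, fromTw_strictPsi])

theorem strictPsi_comp (g h : G) (M : RMod K A) :
    strictMap S (RMod.twistCompIso S.toWeakAction g h M).hom ≫ (strictPsi S (g * h) M).hom =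
      (strictPsi S g (RMod.twist S.toWeakAction h M)).hom ≫
        RMod.twistMap (strict S).toWeakAction g (strictPsi S h M).hom ≫
        (RMod.twistCompIso (strict S).toWeakAction g h (strictObj S M)).hom :=
  strictObj_hom_ext S fun k m => RMod.fromTw_injective _ _ _ (by
    simp only [RMod.lin_comp, LinearMap.comp_apply]
    rw [strictMap_mk, fromTw_strictPsi, RMod.fromTw_twistCompIso, RMod.fromTw_twistCompIso,
      RMod.fromTw_twistMap, fromTw_strictPsi, fromTw_strictPsi, RMod.fromTw_act,
      ← RMod.act_mul_apply, ← RMod.act_mul_apply]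
    -- the compositors of `A^str` are trivial
    change _ = (strictObj S M).act 1 _
    rw [RMod.act_one_apply, S.cocycle, mul_inv_rev, mul_assoc])

/-- The unit compatibility of `ψ`, where `c_{1,k} = 1`. -/
theorem strictPsi_one (M : RMod K A) :
    strictMap S (RMod.twistOneIso S.toWeakAction M).hom ≫ (strictPsi S 1 M).hom =
      (RMod.twistOneIso (strict S).toWeakAction (strictObj S M)).hom :=
  strictObj_hom_ext S fun k m => RMod.fromTw_injective _ _ _ (by
    simp only [RMod.lin_comp, LinearMap.comp_apply]
    rw [strictMap_mk, fromTw_strictPsi]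
    change strictMk S M (1⁻¹ * k) (M.act (S.c 1⁻¹ k : A) m) = strictMk S M k m
    rw [inv_one, S.c_one_left, one_mul, Units.val_one, RMod.act_one_apply])

/-- The natural isomorphisms `ψ_g`. -/
def strictPsiIso (g : G) : S.equivariant.act g ⋙ strictFunctor S ≅
    strictFunctor S ⋙ (strict S).equivariant.act g :=
  NatIso.ofComponents (strictPsi S g) (fun f => strictPsi_natural S g f)

instance (g : G) : NatTrans.IsMonoidal (strictPsiIso S g).hom where
  unit := by
    have h : (strictFunctor S).map (Functor.LaxMonoidal.ε (S.equivariant.act g)) ≫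
        (strictPsiIso S g).hom.app _ ≫
        ((strict S).equivariant.act g).map (Functor.OplaxMonoidal.η (strictFunctor S)) =
        Functor.OplaxMonoidal.η (strictFunctor S) ≫
          Functor.LaxMonoidal.ε ((strict S).equivariant.act g) := strictPsi_unit S g
    rw [Functor.LaxMonoidal.comp_ε, Functor.LaxMonoidal.comp_ε, Category.assoc,
      ← cancel_epi (Functor.OplaxMonoidal.η (strictFunctor S)), Functor.Monoidal.η_ε_assoc,
      ← reassoc_of% h, Functor.Monoidal.map_η_ε]
    exact (Category.comp_id _).symm
  tensor M N := by
    have h : (strictFunctor S).map (Functor.LaxMonoidal.μ (S.equivariant.act g) M N) ≫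
        (strictPsiIso S g).hom.app _ ≫
        ((strict S).equivariant.act g).map (Functor.OplaxMonoidal.δ (strictFunctor S) M N) =
        Functor.OplaxMonoidal.δ (strictFunctor S) _ _ ≫
          ((strictPsiIso S g).hom.app M ⊗ₘ (strictPsiIso S g).hom.app N) ≫
          Functor.LaxMonoidal.μ ((strict S).equivariant.act g) _ _ := strictPsi_tensor S g M N
    rw [Functor.LaxMonoidal.comp_μ, Functor.LaxMonoidal.comp_μ, Category.assoc,
      ← cancel_epi (Functor.OplaxMonoidal.δ (strictFunctor S) _ _), Functor.Monoidal.δ_μ_assoc,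
      ← reassoc_of% h, Functor.Monoidal.map_δ_μ]
    exact (Category.comp_id _).symm

theorem strictPsiIso_comp (g h : G) (M : RMod K A) :
    (strictFunctor S).map (compApp S.equivariant g h M).hom ≫
        (psiApp (strictPsiIso S) (g * h) M).hom =
      (psiApp (strictPsiIso S) g ((S.equivariant.act h).obj M)).hom ≫
        ((strict S).equivariant.act g).map (psiApp (strictPsiIso S) h M).hom ≫
        (compApp (strict S).equivariant g h ((strictFunctor S).obj M)).hom :=
  strictPsi_comp S g h M

theorem strictPsiIso_one (M : RMod K A) :
    (strictFunctor S).map (oneApp S.equivariant M).hom ≫ (psiApp (strictPsiIso S) 1 M).hom =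
      (oneApp (strict S).equivariant ((strictFunctor S).obj M)).hom :=
  strictPsi_one S M

end StrictTensor

/-! ### `F` is an equivalence of categories -/

section StrictEquivalence

variable {K G A : Type u} [Field K] [Group G] [Fintype G] [Ring A] [HopfAlgebra K A]
  (S : GWeakHopf K G A)

/-- `F` preserves the grading. -/
theorem strict_deg_obj {g : G} {M : RMod K A} (hM : S.deg g M) :
    (strict S).deg g (strictObj S M) := fun d hd x hx v => by
  classical
  refine Strict.component_induction S
    (motive := fun x => (strictObj S M).act x v = 0) hx (by simp)
    (fun x y hx hy => by rw [map_add, LinearMap.add_apply, hx, hy, add_zero]) fun p h a ha => ?_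
  induction v using strictObj_induction with
  | zero => simp
  | add v w hv hw => rw [map_add, hv, hw, add_zero]
  | mk k m =>
  rw [strictObj_act_of]
  split_ifs with hk
  · have h1 := S.grading_φ k ha
    have h2 : k * ((p * h⁻¹)⁻¹ * d * (p * h⁻¹)) * k⁻¹ = d := by
      rw [← hk]
      group
    rw [h2] at h1
    rw [hM d hd _ (S.mul_mem_right h1 _), map_zero]
  · rfl

/-- `F` reflects the grading. -/
theorem deg_of_strict_deg {g : G} {M : RMod K A} (hM : (strict S).deg g (strictObj S M)) :
    S.deg g M := fun h hh a ha m => by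
  classical
  refine strictMk_injective S M 1 ?_
  have h1 := hM h hh (Strict.of S 1 1 a) (Strict.of_mem_component S (by simpa using ha))
    (strictMk S M 1 m)
  rw [strictObj_act_of, if_pos (mul_one 1), S.φ_one, S.c_one_one, Units.val_one, mul_one] at h1
  rw [h1, map_zero]

/-- The linear map `F(M) → M`, `m ⊗ k ↦ δ(k, 1) m`. -/
def strictCoord (M : RMod K A) : strictObj S M →ₗ[K] M :=
  (Finsupp.lapply 1 : (G →₀ M) →ₗ[K] M)

open Classical in
theorem strictCoord_mk (M : RMod K A) (k : G) (m : M) :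
    strictCoord S M (strictMk S M k m) = if k = 1 then m else 0 := by
  change (Finsupp.single k m : G →₀ M) 1 = _
  rw [Finsupp.single_apply]

theorem strictObj_act_shift (M : RMod K A) (k : G) (v : strictObj S M) :
    (strictObj S M).act (Strict.of S k k 1) v = strictMk S M k (strictCoord S M v) := by
  classical
  induction v using strictObj_induction with
  | zero => simp
  | add v w hv hw => rw [map_add, map_add, map_add, hv, hw]
  | mk l m =>
    rw [strictObj_act_of, strictCoord_mk]
    by_cases h : l = 1
    · rw [if_pos h, if_pos (by rw [h, one_mul]), h, S.c_one_left]
      simp [RMod.act_one_apply]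
    · rw [if_neg h, if_neg (by simpa using h), map_zero]

theorem strictMk_eq_act (M : RMod K A) (k : G) (m : M) :
    strictMk S M k m = (strictObj S M).act (Strict.of S k k 1) (strictMk S M 1 m) := by
  classical
  rw [strictObj_act_shift, strictCoord_mk, if_pos rfl]

theorem strictMk_one_act (M : RMod K A) (a : A) (m : M) :
    strictMk S M 1 (M.act a m) = (strictObj S M).act (Strict.of S 1 1 a) (strictMk S M 1 m) := by
  classical
  rw [strictObj_act_of, if_pos (mul_one 1), S.φ_one, S.c_one_one, Units.val_one, mul_one]

theorem strictMk_one_coord (M : RMod K A) (v : strictObj S M) :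
    strictMk S M 1 (strictCoord S M v) = (strictObj S M).act (Strict.of S 1 1 1) v :=
  (strictObj_act_shift S M 1 v).symm

/-- The preimage of a homomorphism `F(M) → F(N)`: its component `M ⊗ 1 → N ⊗ 1`. -/
def strictPreimage {M N : RMod K A} (f : strictObj S M ⟶ strictObj S N) : M ⟶ N :=
  RMod.ofLin (strictCoord S N ∘ₗ RMod.lin f ∘ₗ strictMk S M 1) fun a m => by
    classical
    refine strictMk_injective S N 1 ?_
    simp only [LinearMap.comp_apply]
    rw [strictMk_one_act, strictMk_one_act, RMod.lin_act, strictMk_one_coord, strictMk_one_coord,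
      ← RMod.act_mul_apply, ← RMod.act_mul_apply, Strict.of_mul_unit, if_pos rfl,
      Strict.unit_mul_of, if_pos (one_mul 1)]

theorem strictMap_strictPreimage {M N : RMod K A} (f : strictObj S M ⟶ strictObj S N) :
    strictMap S (strictPreimage S f) = f :=
  strictObj_hom_ext S fun k m => by
    rw [strictMap_mk, strictMk_eq_act S M k m, RMod.lin_act, strictObj_act_shift]
    rfl

instance : (strictFunctor S).Full where
  map_surjective f := ⟨strictPreimage S f, strictMap_strictPreimage S f⟩

instance : (strictFunctor S).Faithful where
  map_injective {M N f f'} h := RMod.hom_ext fun m => strictMk_injective S N 1 (by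
    have h' : strictMap S f = strictMap S f' := h
    rw [← strictMap_mk, ← strictMap_mk, h'])

theorem of_one_mul_of_one (a b : A) :
    Strict.of S 1 1 a * Strict.of S 1 1 b = Strict.of S 1 1 (a * b) := by
  classical
  rw [Strict.of_mul_of, if_pos (mul_one 1), S.φ_one, S.c_one_one, mul_one, Units.val_one, mul_one]

/-- The `A`-module `V.(δ_1 ⊗ 1 ⊗ 1)`, on which `a` acts as `δ_1 ⊗ a ⊗ 1`. The projection back to
`V.(δ_1 ⊗ 1 ⊗ 1)` in the action serves only to give it the right codomain. -/
def corner (V : RMod K (Strict S)) : RMod K A where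
  carrier := LinearMap.range (V.act (Strict.of S 1 1 1))
  act :=
    { toFun := fun a => (V.act (Strict.of S 1 1 1)).rangeRestrict ∘ₗ V.act (Strict.of S 1 1 a) ∘ₗ
        (LinearMap.range (V.act (Strict.of S 1 1 1))).subtype
      map_add' := fun a b => by simp [LinearMap.add_comp, LinearMap.comp_add]
      map_smul' := fun r a => by simp [LinearMap.smul_comp, LinearMap.comp_smul] }
  act_one := by
    ext ⟨_, x, rfl⟩
    simp [← RMod.act_mul_apply, of_one_mul_of_one]
  act_mul a b := by
    refine LinearMap.ext ?_
    rintro ⟨_, x, rfl⟩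
    refine Subtype.ext ?_
    change V.act (Strict.of S 1 1 1) (V.act (Strict.of S 1 1 (a * b))
      (V.act (Strict.of S 1 1 1) x)) = V.act (Strict.of S 1 1 1) (V.act (Strict.of S 1 1 b)
        (V.act (Strict.of S 1 1 1) (V.act (Strict.of S 1 1 a) (V.act (Strict.of S 1 1 1) x))))
    simp only [← RMod.act_mul_apply, of_one_mul_of_one, one_mul, mul_one]

/-- The inclusion `V.(δ_1 ⊗ 1 ⊗ 1) → V`. -/
def cornerIncl (V : RMod K (Strict S)) : corner S V →ₗ[K] V :=
  (LinearMap.range (V.act (Strict.of S 1 1 1))).subtype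

/-- The projection `V → V.(δ_1 ⊗ 1 ⊗ 1)`. -/
def cornerPr (V : RMod K (Strict S)) : V →ₗ[K] corner S V :=
  (V.act (Strict.of S 1 1 1)).rangeRestrict

theorem cornerIncl_injective (V : RMod K (Strict S)) : Function.Injective (cornerIncl S V) :=
  Subtype.val_injective

theorem cornerIncl_cornerPr (V : RMod K (Strict S)) (v : V) :
    cornerIncl S V (cornerPr S V v) = V.act (Strict.of S 1 1 1) v := rfl

theorem act_cornerIncl (V : RMod K (Strict S)) (v : corner S V) :
    V.act (Strict.of S 1 1 1) (cornerIncl S V v) = cornerIncl S V v := by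
  obtain ⟨_, x, rfl⟩ := v
  change V.act (Strict.of S 1 1 1) (V.act (Strict.of S 1 1 1) x) = V.act (Strict.of S 1 1 1) x
  rw [← RMod.act_mul_apply, of_one_mul_of_one, one_mul]

theorem cornerIncl_act (V : RMod K (Strict S)) (a : A) (v : corner S V) :
    cornerIncl S V ((corner S V).act a v) = V.act (Strict.of S 1 1 a) (cornerIncl S V v) := by
  change V.act (Strict.of S 1 1 1) (V.act (Strict.of S 1 1 a) (cornerIncl S V v)) = _
  rw [← RMod.act_mul_apply, of_one_mul_of_one, mul_one]

/-- The isomorphism `F(V.(δ_1 ⊗ 1 ⊗ 1)) ≅ V`, `m ⊗ k ↦ m.(δ_k ⊗ 1 ⊗ k)`. Its inverse is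
`v ↦ ∑ v.(δ_1 ⊗ c_{k⁻¹,k}⁻¹ ⊗ k⁻¹) ⊗ k`. -/
def cornerIso (V : RMod K (Strict S)) : strictObj S (corner S V) ≅ V :=
  RMod.mkIso
    (strictLift S (corner S V) fun k => V.act (Strict.of S k k 1) ∘ₗ cornerIncl S V)
    (∑ k, strictMk S (corner S V) k ∘ₗ cornerPr S V ∘ₗ
      V.act (Strict.of S 1 k⁻¹ ((S.c k⁻¹ k)⁻¹ : Aˣ)))
    (fun x => by
      classical
      induction x using strictObj_induction with
      | zero => simp
      | add x y hx hy => rw [map_add, map_add, hx, hy]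
      | mk k m =>
      rw [strictLift_mk, LinearMap.sum_apply, Finset.sum_eq_single k]
      · simp only [LinearMap.comp_apply]
        congr 1
        refine cornerIncl_injective S V ?_
        rw [cornerIncl_cornerPr, ← RMod.act_mul_apply, ← RMod.act_mul_apply, Strict.of_mul_unit,
          if_pos rfl, Strict.of_mul_of, if_pos (mul_inv_cancel k), one_mul, Strict.φ_c_inv_inv,
          mul_inv_cancel, Units.inv_mul, act_cornerIncl]
      · intro l _ hl
        simp only [LinearMap.comp_apply]
        rw [← RMod.act_mul_apply, Strict.of_mul_of, if_neg]
        · simp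
        · exact fun h => hl (inv_injective (eq_inv_of_mul_eq_one_right h) ▸ by simp)
      · simp)
    (fun v => by
      classical
      rw [LinearMap.sum_apply, map_sum]
      conv_rhs => rw [← RMod.act_one_apply V v, Strict.one_def, map_sum, LinearMap.sum_apply]
      refine Finset.sum_congr rfl fun k _ => ?_
      simp only [LinearMap.comp_apply]
      rw [strictLift_mk, LinearMap.comp_apply, cornerIncl_cornerPr, ← RMod.act_mul_apply,
        ← RMod.act_mul_apply, Strict.unit_mul_of, if_pos (one_mul k), Strict.of_mul_of,
        if_pos (one_mul k), map_one, mul_one, Units.inv_mul, inv_mul_cancel])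
    (strict_ofLin_act S _ _ (fun k h a m => by
      classical
      rw [strictObj_act_of, if_pos rfl, strictLift_mk, strictLift_mk, LinearMap.comp_apply,
        LinearMap.comp_apply, cornerIncl_act, ← RMod.act_mul_apply, ← RMod.act_mul_apply,
        Strict.of_mul_of, if_pos (one_mul _), Strict.of_mul_of, if_pos rfl, S.c_one_left, map_one]
      simp)
    (fun k p h a m hk => by
      classical
      rw [strictLift_mk, LinearMap.comp_apply, ← RMod.act_mul_apply, Strict.of_mul_of, if_neg hk]
      simp))

instance : (strictFunctor S).EssSurj where
  mem_essImage V := ⟨corner S V, ⟨cornerIso S V⟩⟩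

instance strictFunctor_isEquivalence : (strictFunctor S).IsEquivalence where

end StrictEquivalence

/-! ### The equivariance of the `R`-matrix and of the twist -/

section RibbonAlgebra

variable {K G A : Type u} [Field K] [Group G] [Fintype G] [Ring A] [HopfAlgebra K A]
  {S : GWeakHopf K G A} (rib : GRibbonAlgebra S)

/-- The `G`-braiding of `A-mod` as a homomorphism `M ⊗ N → ^g N ⊗ M`. -/
def braidHom {g : G} {M : RMod K A} (hM : S.deg g M) (N : RMod K A) :
    RMod.tensor M N ⟶ RMod.tensor (RMod.twist S.toWeakAction g N) M :=
  (rib.braiding.braid hM N).hom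

theorem incl_braidHom {g : G} {M : RMod K A} (hM : S.deg g M) (N : RMod K A)
    (x : RMod.tensor M N) :
    TensorProduct.map (RMod.fromTw _ g N) LinearMap.id (RMod.incl _ _
      (RMod.lin (braidHom rib hM N) x)) =
      TensorProduct.comm K M N (RMod.act₂ M N rib.R (RMod.incl M N x)) :=
  rib.braiding_apply hM N x

theorem fromTw₂_twistTensor_inv (k : G) (M N : RMod K A)
    (x : RMod.twist S.toWeakAction k (RMod.tensor M N)) :
    RMod.fromTw₂ _ k M N (RMod.incl _ _ (RMod.lin (RMod.twistTensor S k M N).inv x)) =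
      RMod.incl M N (RMod.fromTw _ k _ x) := by
  rw [← RMod.incl_twistTensor, RMod.lin_inv_hom_apply]

theorem braidHom_equivariant (k : G) {g : G} {M : RMod K A} (hM : S.deg g M) (N : RMod K A)
    (e : RMod.twist S.toWeakAction (k * g * k⁻¹ * k) N = RMod.twist S.toWeakAction (k * g) N) :
    (RMod.twistTensor S k M N).hom ≫ RMod.twistMap S.toWeakAction k (braidHom rib hM N) ≫
        (RMod.twistTensor S k (RMod.twist S.toWeakAction g N) M).inv ≫
        RMod.tmap (RMod.twistCompIso S.toWeakAction k g N).hom (𝟙 (RMod.twist _ k M)) =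
      braidHom rib (S.deg_act k hM) (RMod.twist S.toWeakAction k N) ≫
        RMod.tmap ((RMod.twistCompIso S.toWeakAction (k * g * k⁻¹) k N).hom ≫ eqToHom e)
          (𝟙 (RMod.twist _ k M)) :=
  rib.braiding.equivariant k hM N

/-- The equivariance of the `G`-braiding in terms of the `R`-matrix: on `M ⊗ N` with `M` of degree
`g`, the elements `R` and `(φ_k ⊗ φ_k)(R)` act in the same way up to compositors. This is the
equivariance axiom for `k⁻¹`, applied to the modules `^{k⁻¹}M` and `^{k⁻¹}N`. -/
theorem R_equivariant (k : G) {g : G} {M : RMod K A} (hM : S.deg g M) (N : RMod K A)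
    (t : M ⊗[K] N) :
    TensorProduct.map LinearMap.id (N.act (S.c g⁻¹ k : A)) (RMod.act₂ M N rib.R t) =
      TensorProduct.map LinearMap.id (N.act (S.c k (k⁻¹ * g⁻¹ * k) : A)) (RMod.act₂ M N
        (TensorProduct.map (S.φ k).toLinearMap (S.φ k).toLinearMap rib.R) t) := by
  have e : RMod.twist S.toWeakAction (k⁻¹ * g * k⁻¹⁻¹ * k⁻¹) N =
      RMod.twist S.toWeakAction (k⁻¹ * g) N := by simp
  let x : RMod.tensor (RMod.twist S.toWeakAction k⁻¹ M) (RMod.twist S.toWeakAction k⁻¹ N) :=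
    RMod.pr _ _ (RMod.toTw₂ _ k⁻¹ M N t)
  have hx : RMod.fromTw₂ _ k⁻¹ M N (RMod.incl _ _ x) = t := by
    rw [RMod.incl_pr_hopf, RMod.fromTw₂_toTw₂]
  have h := congrArg (fun f => TensorProduct.map (RMod.fromTw _ (k⁻¹ * g) N)
    (RMod.fromTw _ k⁻¹ M) (RMod.incl _ _ (RMod.lin f x))) (braidHom_equivariant rib k⁻¹ hM N e)
  simp only [RMod.lin_comp, LinearMap.comp_apply, RMod.incl_tmap] at h
  have h1 (z : RMod.twist S.toWeakAction k⁻¹ (RMod.twist S.toWeakAction g N) ⊗[K]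
      RMod.twist S.toWeakAction k⁻¹ M) :
      TensorProduct.map (RMod.fromTw _ (k⁻¹ * g) N) (RMod.fromTw _ k⁻¹ M)
        (TensorProduct.map (RMod.lin (RMod.twistCompIso S.toWeakAction k⁻¹ g N).hom)
          (RMod.lin (𝟙 (RMod.twist S.toWeakAction k⁻¹ M))) z) =
      TensorProduct.map (N.act (S.c g⁻¹ k : A)) LinearMap.id (TensorProduct.map
        (RMod.fromTw _ g N) LinearMap.id (RMod.fromTw₂ _ k⁻¹ _ M z)) := by
    induction z using TensorProduct.induction_on with
    | zero => simp
    | add a b ha hb => simp only [map_add, ha, hb]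
    | tmul n m => simp [RMod.fromTw₂, RMod.fromTw_twistCompIso]
  have h2 (z : RMod.twist S.toWeakAction (k⁻¹ * g * k⁻¹⁻¹) (RMod.twist S.toWeakAction k⁻¹ N) ⊗[K]
      RMod.twist S.toWeakAction k⁻¹ M) :
      TensorProduct.map (RMod.fromTw _ (k⁻¹ * g) N) (RMod.fromTw _ k⁻¹ M)
        (TensorProduct.map (RMod.lin (eqToHom e) ∘ₗ
          RMod.lin (RMod.twistCompIso S.toWeakAction (k⁻¹ * g * k⁻¹⁻¹) k⁻¹ N).hom)
          (RMod.lin (𝟙 (RMod.twist S.toWeakAction k⁻¹ M))) z) =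
      TensorProduct.map (N.act (S.c k (k⁻¹ * g⁻¹ * k) : A)) LinearMap.id
        (RMod.fromTw₂ _ k⁻¹ N M (TensorProduct.map (RMod.fromTw _ _ _) LinearMap.id z)) := by
    induction z using TensorProduct.induction_on with
    | zero => simp
    | add a b ha hb => simp only [map_add, ha, hb]
    | tmul n m =>
      simp [RMod.fromTw₂, RMod.fromTw_twistCompIso, RMod.fromTw_eqToHom, mul_assoc]
  have h3 (z : RMod.twist S.toWeakAction k⁻¹ M ⊗[K] RMod.twist S.toWeakAction k⁻¹ N) :
      RMod.fromTw₂ _ k⁻¹ N M (TensorProduct.comm K _ _ z) =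
        TensorProduct.comm K _ _ (RMod.fromTw₂ _ k⁻¹ M N z) := by
    induction z using TensorProduct.induction_on with
    | zero => simp
    | add a b ha hb => simp only [map_add, ha, hb]
    | tmul n m => rfl
  rw [h1, h2, fromTw₂_twistTensor_inv, RMod.fromTw_twistMap, incl_braidHom, incl_braidHom, h3,
    RMod.fromTw₂_act₂, RMod.incl_twistTensor, hx, inv_inv] at h
  have h4 := congrArg (TensorProduct.comm K N M) h
  simpa only [TensorProduct.map_comm, TensorProduct.comm_comm] using h4

/-- The `G`-twist of `A-mod` as a homomorphism `M → ^g M`. -/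
def twistHom {g : G} {M : RMod K A} (hM : S.deg g M) : M ⟶ RMod.twist S.toWeakAction g M :=
  (rib.twist.twist hM).hom

theorem fromTw_twistHom {g : G} {M : RMod K A} (hM : S.deg g M) (m : M) :
    RMod.fromTw _ g M (RMod.lin (twistHom rib hM) m) = M.act (rib.θ⁻¹ : Aˣ) m :=
  rib.twist_apply hM m

/-- The equivariance of the `G`-twist in terms of the element `θ`. -/
theorem θ_equivariant (k : G) {g : G} {M : RMod K A} (hM : S.deg g M) (m : M) :
    M.act (S.c g⁻¹ k : A) (M.act (rib.θ⁻¹ : Aˣ) m) =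
      M.act (S.c k (k⁻¹ * g⁻¹ * k) : A) (M.act (S.φ k (rib.θ⁻¹ : Aˣ)) m) := by
  have e : RMod.twist S.toWeakAction (k⁻¹ * g * k⁻¹⁻¹ * k⁻¹) M =
      RMod.twist S.toWeakAction (k⁻¹ * g) M := by simp
  have h0 : RMod.twistMap S.toWeakAction k⁻¹ (twistHom rib hM) ≫
      (RMod.twistCompIso S.toWeakAction k⁻¹ g M).hom =
      twistHom rib (S.deg_act k⁻¹ hM) ≫
        (RMod.twistCompIso S.toWeakAction (k⁻¹ * g * k⁻¹⁻¹) k⁻¹ M).hom ≫ eqToHom e :=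
    rib.twist.equivariant k⁻¹ hM
  have h := congrArg (fun f => RMod.fromTw _ (k⁻¹ * g) M
    (RMod.lin f (RMod.toTw _ k⁻¹ M m))) h0
  simp only [RMod.lin_comp, LinearMap.comp_apply] at h
  rw [RMod.fromTw_eqToHom _ (by group), RMod.fromTw_twistCompIso, RMod.fromTw_twistCompIso,
    RMod.fromTw_twistMap, fromTw_twistHom, fromTw_twistHom, RMod.fromTw_act, RMod.fromTw_toTw,
    inv_inv] at h
  rw [h]
  simp [mul_assoc]

end RibbonAlgebra

/-! ### The units of the components of `A` -/

section Units

variable {K G A : Type u} [Field K] [Group G] [Fintype G] [Ring A] [HopfAlgebra K A]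
  (S : GWeakHopf K G A)

theorem sum_gunit_univ : ∑ g, S.gunit g = 1 := by
  rw [← S.sum_gunit]
  exact (Finset.sum_subset (Finset.subset_univ _) fun g _ hg =>
    Finsupp.notMem_support_iff.1 hg).symm

theorem gunit_mul_ne {g h : G} (hgh : g ≠ h) {a : A} (ha : a ∈ S.grading h) :
    S.gunit g * a = 0 := S.grading_mul_ne hgh (S.gunit_mem g) ha

theorem φ_gunit (k g : G) : S.φ k (S.gunit g) = S.gunit (k * g * k⁻¹) := by
  have h1 : S.φ k (S.gunit g) ∈ S.grading (k * g * k⁻¹) := S.grading_φ k (S.gunit_mem g)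
  have h2 := congrArg (fun x => S.gunit (k * g * k⁻¹) * S.φ k x) (sum_gunit_univ S)
  simp only [map_sum, Finset.mul_sum, map_one, mul_one] at h2
  rw [Finset.sum_eq_single g, S.gunit_mul h1] at h2
  · exact h2
  · exact fun h _ hh => gunit_mul_ne S (fun h3 => hh (by simpa using h3.symm))
      (S.grading_φ k (S.gunit_mem h))
  · simp

end Units

/-! ### The `R`-matrix of `A^str` -/

section StrictRibbon

variable {K G A : Type u} [Field K] [Group G] [Fintype G] [Ring A] [HopfAlgebra K A]
  (S : GWeakHopf K G A)

/-- The summand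
`(δ_k ⊗ T₁ 1_{k⁻¹gk} ⊗ 1) ⊗ (δ_{g⁻¹k} ⊗ T₂ ⊗ k⁻¹g⁻¹k)` of the `R`-matrix of `A^str`, where `1_d`
is the unit of `A_d`. -/
def strictRTerm (k g : G) : A ⊗[K] A →ₗ[K] Strict S ⊗[K] Strict S :=
  TensorProduct.map (Strict.of S k 1 ∘ₗ LinearMap.mulRight K (S.gunit (k⁻¹ * g * k)))
    (Strict.of S (g⁻¹ * k) (k⁻¹ * g⁻¹ * k))

/-- The `R`-matrix of `A^str` obtained from an `R`-matrix of `A`. -/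
def strictR (T : A ⊗[K] A) : Strict S ⊗[K] Strict S := ∑ k, ∑ g, strictRTerm S k g T

theorem comul_one_mul_strictRTerm (k g : G) (T : A ⊗[K] A) :
    comul (R := K) (1 : Strict S) * strictRTerm S k g T = strictRTerm S k g T := by
  classical
  induction T using TensorProduct.induction_on with
  | zero => simp
  | add a b ha hb => simp only [map_add, mul_add, ha, hb]
  | tmul a b =>
    rw [Strict.comul_one, Finset.sum_mul, Finset.sum_eq_single k]
    · rw [strictRTerm, TensorProduct.map_tmul, Algebra.TensorProduct.tmul_mul_tmul,
        LinearMap.comp_apply, Strict.unit_mul_of, Strict.unit_mul_of, if_pos (mul_one k),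
        if_pos (by group)]
    · intro l _ hl
      rw [strictRTerm, TensorProduct.map_tmul, Algebra.TensorProduct.tmul_mul_tmul,
        LinearMap.comp_apply, Strict.unit_mul_of, if_neg (by simpa using hl),
        TensorProduct.zero_tmul]
    · simp

theorem comul_one_mul_strictR (T : A ⊗[K] A) :
    comul (R := K) (1 : Strict S) * strictR S T = strictR S T := by
  simp only [strictR, Finset.mul_sum, comul_one_mul_strictRTerm]

theorem strictRTerm_mul_comul_one (k g : G) (T : A ⊗[K] A) :
    strictRTerm S k g T * TensorProduct.map LinearMap.id ((strict S).φ g⁻¹).toLinearMap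
      (TensorProduct.comm K _ _ (comul (R := K) (1 : Strict S))) = strictRTerm S k g T := by
  classical
  have h : TensorProduct.map LinearMap.id ((strict S).φ g⁻¹).toLinearMap
      (TensorProduct.comm K _ _ (comul (R := K) (1 : Strict S))) =
      ∑ l, Strict.of S l 1 1 ⊗ₜ[K] Strict.of S (g⁻¹ * l) 1 1 := by
    rw [Strict.comul_one, map_sum, map_sum]
    refine Finset.sum_congr rfl fun l _ => ?_
    rw [TensorProduct.comm_tmul, TensorProduct.map_tmul]
    exact congrArg _ (Strict.shift_of S _ _ _ _)
  rw [h]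
  induction T using TensorProduct.induction_on with
  | zero => simp
  | add a b ha hb => simp only [map_add, add_mul, ha, hb]
  | tmul a b =>
    rw [Finset.mul_sum, Finset.sum_eq_single k]
    · rw [strictRTerm, TensorProduct.map_tmul, Algebra.TensorProduct.tmul_mul_tmul,
        LinearMap.comp_apply, Strict.of_mul_unit, Strict.of_mul_unit, if_pos rfl, if_pos rfl]
    · intro l _ hl
      rw [strictRTerm, TensorProduct.map_tmul, Algebra.TensorProduct.tmul_mul_tmul,
        LinearMap.comp_apply, Strict.of_mul_unit, if_neg hl.symm, TensorProduct.zero_tmul]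
    · simp

theorem tmul_one_mul_strictRTerm_ne (k : G) {d g : G} (hd : d ≠ g) {x : Strict S}
    (hx : x ∈ (strict S).grading d) (T : A ⊗[K] A) :
    (x ⊗ₜ[K] 1) * strictRTerm S k g T = 0 := by
  induction T using TensorProduct.induction_on with
  | zero => simp
  | add a b ha hb => rw [map_add, mul_add, ha, hb, add_zero]
  | tmul a b =>
    rw [strictRTerm, TensorProduct.map_tmul, Algebra.TensorProduct.tmul_mul_tmul,
      Strict.component_mul_ne S hd hx, TensorProduct.zero_tmul]
    refine Strict.of_mem_component S ?_
    simpa using S.mul_mem_left (S.gunit_mem _) a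

theorem strictR_mul_comul_one (T : A ⊗[K] A) {g : G} {x : Strict S}
    (hx : x ∈ (strict S).grading g) :
    (x ⊗ₜ[K] 1) * strictR S T * TensorProduct.map LinearMap.id ((strict S).φ g⁻¹).toLinearMap
      (TensorProduct.comm K _ _ (comul (R := K) (1 : Strict S))) = (x ⊗ₜ[K] 1) * strictR S T := by
  simp only [strictR, Finset.mul_sum, Finset.sum_mul]
  refine Finset.sum_congr rfl fun k _ => Finset.sum_congr rfl fun d _ => ?_
  by_cases h : g = d
  · rw [h, mul_assoc, strictRTerm_mul_comul_one]
  · rw [tmul_one_mul_strictRTerm_ne S k h hx, zero_mul]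

theorem act_φ_mul_gunit {g : G} {M : RMod K A} (hM : S.deg g M) (k : G) (a : A) (m : M) :
    M.act (S.φ k (a * S.gunit (k⁻¹ * g * k))) m = M.act (S.φ k a) m := by
  rw [map_mul, φ_gunit, RMod.act_mul_apply]
  convert S.act_gunit hM _ using 3
  group

theorem act_φ_mul_gunit_ne {g d : G} (hd : d ≠ g) {M : RMod K A} (hM : S.deg g M) (k : G)
    (a : A) (m : M) : M.act (S.φ k (a * S.gunit (k⁻¹ * d * k))) m = 0 := by
  refine hM d hd _ ?_ m
  convert S.grading_φ k (S.mul_mem_left (S.gunit_mem (k⁻¹ * d * k)) a) using 1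
  group

/-- The action of the `R`-matrix of `A^str` on the elements `(m ⊗ k) ⊗ (n ⊗ k)` for `M` of degree
`g`: only the summand with indices `k` and `g` contributes. -/
theorem act₂_strictR {g : G} {M : RMod K A} (hM : S.deg g M) (N : RMod K A) (T : A ⊗[K] A)
    (k : G) (t : M ⊗[K] N) :
    RMod.act₂ (strictObj S M) (strictObj S N) (strictR S T) (diagMk S M N k t) =
      TensorProduct.map (strictMk S M k)
        (strictMk S N (g⁻¹ * k) ∘ₗ N.act (S.c k (k⁻¹ * g⁻¹ * k) : A))
        (RMod.act₂ M N (TensorProduct.map (S.φ k).toLinearMap (S.φ k).toLinearMap T) t) := by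
  classical
  induction t using TensorProduct.induction_on with
  | zero => simp
  | add a b ha hb => simp only [map_add, ha, hb]
  | tmul m n =>
  have h0 (T : A ⊗[K] A) (l d : G) (h : ¬ (l = k ∧ d = g)) :
      RMod.act₂ (strictObj S M) (strictObj S N) (strictRTerm S l d T)
        (strictMk S M k m ⊗ₜ strictMk S N k n) = 0 := by
    induction T using TensorProduct.induction_on with
    | zero => simp
    | add a b ha hb => simp only [map_add, LinearMap.add_apply, ha, hb, add_zero]
    | tmul a b =>
      rw [strictRTerm, TensorProduct.map_tmul, RMod.act₂_tmul, TensorProduct.map_tmul,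
        LinearMap.comp_apply, strictObj_act_of, mul_one]
      split_ifs with hk
      · subst hk
        rw [LinearMap.mulRight_apply, S.c_one_right, Units.val_one, mul_one,
          act_φ_mul_gunit_ne S (fun h1 => h ⟨rfl, h1⟩) hM, map_zero, TensorProduct.zero_tmul]
      · rw [TensorProduct.zero_tmul]
  rw [strictR, map_sum, LinearMap.sum_apply, diagMk, TensorProduct.map_tmul,
    Finset.sum_eq_single k, map_sum, LinearMap.sum_apply, Finset.sum_eq_single g]
  · induction T using TensorProduct.induction_on with
    | zero => simp
    | add a b ha hb => simp only [map_add, LinearMap.add_apply, ha, hb]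
    | tmul a b =>
      rw [strictRTerm, TensorProduct.map_tmul, RMod.act₂_tmul, TensorProduct.map_tmul,
        LinearMap.comp_apply, strictObj_act_of, strictObj_act_of, if_pos (mul_one k),
        if_pos (by group), LinearMap.mulRight_apply, S.c_one_right, Units.val_one, mul_one,
        act_φ_mul_gunit S hM, RMod.act_mul_apply]
      rfl
  · exact fun d _ hd => h0 T k d fun h => hd h.2
  · simp
  · intro l _ hl
    rw [map_sum, LinearMap.sum_apply]
    exact Finset.sum_eq_zero fun d _ => h0 T l d fun h => hl h.1
  · simp

/-! ### The twist of `A^str` -/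

/-- The inverse of the twist of `A^str` obtained from the inverse `t` of a twist of `A`. -/
def strictThetaInv (t : A) : Strict S :=
  ∑ p, ∑ d, Strict.of S p d⁻¹ (t * S.gunit d)

/-- The twist of `A^str` obtained from a twist `t` of `A`. -/
def strictTheta (t : A) : Strict S :=
  ∑ p, ∑ d, Strict.of S p d (S.φ d (((S.c d⁻¹ d)⁻¹ : Aˣ) * (t * S.gunit d)))

/-- The coefficients of `strictTheta` are homogeneous: this makes the products of the summands of
`strictTheta` and `strictThetaInv` with different `d` vanish. -/
theorem φ_theta_mem (d : G) (t : A) :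
    S.φ d (((S.c d⁻¹ d)⁻¹ : Aˣ) * (t * S.gunit d)) ∈ S.grading d := by
  convert S.grading_φ d (S.mul_mem_left (S.mul_mem_left (S.gunit_mem d) t) _) using 1
  group

open Classical in
/-- A criterion for a product of two double sums in `A^str` to be `1 = ∑ δ_q ⊗ 1_d ⊗ 1`. -/
theorem sum_mul_sum_eq_one (X Y : G → G → Strict S) (σ : G → G)
    (h : ∀ p d q d', X p d * Y q d' =
      if d' = d then (if p * σ d = q then Strict.of S q 1 (S.gunit d) else 0) else 0) :
    (∑ p, ∑ d, X p d) * (∑ q, ∑ d, Y q d) = 1 := by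
  have h1 (d : G) : (∑ q, ∑ p, if p * σ d = q then Strict.of S q 1 (S.gunit d) else 0) =
      ∑ q, Strict.of S q 1 (S.gunit d) := by
    rw [Finset.sum_comm]
    simp only [Finset.sum_ite_eq, Finset.mem_univ, if_true]
    exact Fintype.sum_equiv (Equiv.mulRight (σ d)) _ _ fun _ => rfl
  simp only [Finset.sum_mul, Finset.mul_sum, h, Finset.sum_ite_eq, Finset.mem_univ, if_true]
  rw [Finset.sum_comm]
  simp only [h1]
  rw [Finset.sum_comm]
  simp only [← map_sum, sum_gunit_univ]
  rfl

theorem strictThetaInv_mul_strictTheta (t s : A) (h : t * s = 1) :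
    strictThetaInv S t * strictTheta S s = 1 := by
  classical
  refine sum_mul_sum_eq_one S _ _ id fun p d q d' => ?_
  rw [Strict.of_mul_of]
  by_cases hd : d' = d
  · subst hd
    rw [if_pos rfl, inv_mul_cancel, S.φ_φ, inv_mul_cancel, S.φ_one]
    congr 2
    rw [Units.mul_inv_cancel_left, mul_assoc, Units.inv_mul_cancel_right, mul_assoc,
      S.gunit_comm, mul_assoc, S.mul_gunit (S.gunit_mem d'), ← mul_assoc, h, one_mul]
  · rw [if_neg hd]
    split_ifs
    · rw [mul_assoc t, gunit_mul_ne S _ (S.grading_φ d⁻¹ (φ_theta_mem S d' s))]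
      · simp
      · intro h1
        refine hd (mul_right_cancel (b := d) (mul_left_cancel (a := d⁻¹) ?_))
        rw [← mul_assoc]
        simpa using h1.symm
    · rfl

theorem strictTheta_mul_strictThetaInv (t s : A) (h : s * t = 1) :
    strictTheta S s * strictThetaInv S t = 1 := by
  classical
  refine sum_mul_sum_eq_one S _ _ Inv.inv fun p d q d' => ?_
  rw [Strict.of_mul_of]
  by_cases hd : d' = d
  · subst hd
    rw [if_pos rfl, mul_inv_cancel, ← map_mul]
    congr 2
    rw [mul_assoc, mul_assoc s, ← S.gunit_comm, ← mul_assoc (S.gunit d'),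
      S.mul_gunit (S.gunit_mem d'), S.gunit_comm, ← mul_assoc s, h, one_mul, map_mul,
      Strict.φ_c_inv_inv, φ_gunit, ← S.gunit_comm, mul_assoc, mul_assoc, Units.inv_mul, mul_one]
    congr 1
    group
  · rw [if_neg hd]
    split_ifs
    · rw [S.grading_mul_ne (fun h1 => hd ?_) (φ_theta_mem S d s)
        (S.grading_φ d (S.mul_mem_left (S.gunit_mem d') t))]
      · simp
      · have h2 : d * d' = d * d := eq_mul_of_mul_inv_eq h1.symm
        exact mul_left_cancel h2
    · rfl

/-- The twist of `A^str` obtained from a twist of `A`. -/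
def strictThetaUnit (θ : Aˣ) : (Strict S)ˣ where
  val := strictTheta S θ
  inv := strictThetaInv S (θ⁻¹ : Aˣ)
  val_inv := strictTheta_mul_strictThetaInv S _ _ (Units.mul_inv θ)
  inv_val := strictThetaInv_mul_strictTheta S _ _ (Units.inv_mul θ)

theorem act_strictThetaInv {g : G} {M : RMod K A} (hM : S.deg g M) (t : A) (k : G) (m : M) :
    (strictObj S M).act (strictThetaInv S t) (strictMk S M k m) =
      strictMk S M (g⁻¹ * k) (M.act (S.c k (k⁻¹ * g⁻¹ * k) : A) (M.act (S.φ k t) m)) := by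
  classical
  have h (p d : G) (h0 : ¬ (p = g⁻¹ * k ∧ d = k⁻¹ * g * k)) :
      (strictObj S M).act (Strict.of S p d⁻¹ (t * S.gunit d)) (strictMk S M k m) = 0 := by
    rw [strictObj_act_of]
    split_ifs with hk
    · obtain ⟨e, rfl⟩ : ∃ e, d = k⁻¹ * e * k := ⟨k * d * k⁻¹, by group⟩
      rw [RMod.act_mul_apply, act_φ_mul_gunit_ne S (fun h1 => h0 ?_) hM, map_zero, map_zero]
      subst h1
      exact ⟨by rw [← hk]; group, rfl⟩
    · rfl
  rw [strictThetaInv, map_sum, LinearMap.sum_apply, Finset.sum_eq_single (g⁻¹ * k), map_sum,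
    LinearMap.sum_apply, Finset.sum_eq_single (k⁻¹ * g * k)]
  · rw [strictObj_act_of, if_pos (by group), RMod.act_mul_apply, act_φ_mul_gunit S hM]
    congr 4
    group
  · exact fun d _ hd => h _ d fun h1 => hd h1.2
  · simp
  · intro p _ hp
    rw [map_sum, LinearMap.sum_apply]
    exact Finset.sum_eq_zero fun d _ => h p d fun h1 => hp h1.1
  · simp

/-! ### The `G`-weak ribbon algebra `A^str` -/

variable {S} (rib : GRibbonAlgebra S)

/-- The `G`-braiding of `A^str-mod` transported along `F`. -/
def strictBraiding : GBraiding (strict S).equivariant :=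
  transportBraiding (strictPsiIso S) rib.braiding (fun _ _ => deg_of_strict_deg S)
    (strictPsiIso_comp S)

/-- The `G`-twist of `A^str-mod` transported along `F`. -/
def strictTwist : GTwist (strictBraiding rib) :=
  transportTwist (strictPsiIso S) rib.twist (fun _ _ => deg_of_strict_deg S)
    (strictPsiIso_comp S) (strictPsiIso_one S)

/-- The image under `F` of the `G`-braiding of `A-mod`. -/
def imageBraidHom {g : G} {M : RMod K A} (hM : S.deg g M) (N : RMod K A) :
    RMod.tensor (strictObj S M) (strictObj S N) ⟶
      RMod.tensor (RMod.twist (strict S).toWeakAction g (strictObj S N)) (strictObj S M) :=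
  (imageBraid (strictPsiIso S) rib.braiding hM N).hom

theorem strictDelta_imageBraidHom {g : G} {M : RMod K A} (hM : S.deg g M) (N : RMod K A) :
    strictDelta S M N ≫ imageBraidHom rib hM N = strictMap S (braidHom rib hM N) ≫
      strictDelta S (RMod.twist S.toWeakAction g N) M ≫
        RMod.tmap (strictPsi S g N).hom (𝟙 (strictObj S M)) :=
  δ_imageBraid_hom (strictPsiIso S) rib.braiding hM N

/-- The image under `F` of the `G`-braiding of `A-mod` is given by the `R`-matrix of `A^str`. -/
theorem incl_imageBraidHom {g : G} {M : RMod K A} (hM : S.deg g M) (N : RMod K A)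
    (x : RMod.tensor (strictObj S M) (strictObj S N)) :
    TensorProduct.map (RMod.fromTw (strict S).toWeakAction g (strictObj S N)) LinearMap.id
        (RMod.incl _ _ (RMod.lin (imageBraidHom rib hM N) x)) =
      TensorProduct.comm K _ _ (RMod.act₂ (strictObj S M) (strictObj S N) (strictR S rib.R)
        (RMod.incl _ _ x)) := by
  obtain ⟨y, rfl⟩ : ∃ y, RMod.lin (strictDelta S M N) y = x :=
    ⟨strictMuLin S M N (RMod.incl _ _ x), by rw [strictDelta_strictMuLin, RMod.pr_incl]⟩
  rw [← LinearMap.comp_apply (RMod.lin (imageBraidHom rib hM N)), ← RMod.lin_comp,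
    strictDelta_imageBraidHom]
  induction y using strictObj_induction with
  | zero => simp
  | add y y' h h' => simp only [map_add, h, h']
  | mk k y =>
  simp only [RMod.lin_comp, LinearMap.comp_apply]
  rw [incl_strictDelta, strictMap_mk, RMod.incl_tmap, incl_strictDelta, act₂_strictR S hM]
  have h1 (z : RMod.twist S.toWeakAction g N ⊗[K] M) :
      TensorProduct.map (RMod.fromTw (strict S).toWeakAction g (strictObj S N)) LinearMap.id
        (TensorProduct.map (RMod.lin (strictPsi S g N).hom) (RMod.lin (𝟙 (strictObj S M)))
          (diagMk S (RMod.twist S.toWeakAction g N) M k z)) =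
      TensorProduct.map (strictMk S N (g⁻¹ * k)) (strictMk S M k)
        (TensorProduct.map (N.act (S.c g⁻¹ k : A)) LinearMap.id
          (TensorProduct.map (RMod.fromTw _ g N) LinearMap.id z)) := by
    induction z using TensorProduct.induction_on with
    | zero => simp
    | add a b ha hb => simp only [map_add, ha, hb]
    | tmul n m => simp [diagMk, fromTw_strictPsi]
  have h2 (z : M ⊗[K] N) : TensorProduct.map (strictMk S M k)
      (strictMk S N (g⁻¹ * k) ∘ₗ N.act (S.c k (k⁻¹ * g⁻¹ * k) : A)) z =
      TensorProduct.map (strictMk S M k) (strictMk S N (g⁻¹ * k))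
        (TensorProduct.map LinearMap.id (N.act (S.c k (k⁻¹ * g⁻¹ * k) : A)) z) := by
    induction z using TensorProduct.induction_on with
    | zero => simp
    | add a b ha hb => simp only [map_add, ha, hb]
    | tmul n m => rfl
  rw [h1, incl_braidHom, h2, ← R_equivariant rib k hM, TensorProduct.map_comm,
    TensorProduct.map_comm]

/-- The `G`-braiding of `A^str-mod` as a homomorphism. -/
def strictBraidHom {g : G} {V : RMod K (Strict S)} (hV : (strict S).deg g V)
    (W : RMod K (Strict S)) :
    RMod.tensor V W ⟶ RMod.tensor (RMod.twist (strict S).toWeakAction g W) V :=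
  ((strictBraiding rib).braid hV W).hom

/-- The `G`-twist of `A^str-mod` as a homomorphism. -/
def strictTwistHom {g : G} {V : RMod K (Strict S)} (hV : (strict S).deg g V) :
    V ⟶ RMod.twist (strict S).toWeakAction g V :=
  ((strictTwist rib).twist hV).hom

/-- The `G`-weak ribbon algebra `A^str`. -/
def strictRibbon : GRibbonAlgebra (strict S) where
  R := strictR S rib.R
  comul_one_mul_R := comul_one_mul_strictR S rib.R
  R_mul_comul_one hx := strictR_mul_comul_one S rib.R hx
  θ := strictThetaUnit S rib.θ
  braiding := strictBraiding rib
  -- by naturality the braiding can be computed on `F` of the corners of `V` and `W`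
  braiding_apply {g V} hV W x := by
    let e := cornerIso S V
    let e' := cornerIso S W
    have hM : S.deg g (corner S V) :=
      deg_of_strict_deg S (((strict S).deg_iso g).of_iso e.symm hV)
    have hb : RMod.tmap e.hom e'.hom ≫ strictBraidHom rib hV W =
        imageBraidHom rib hM (corner S W) ≫
          RMod.tmap (RMod.twistMap (strict S).toWeakAction g e'.hom) e.hom :=
      transportBraid_natural (strictPsiIso S) rib.braiding (fun _ _ => deg_of_strict_deg S) hM hV
        e.hom e'.hom
    obtain ⟨y, rfl⟩ : ∃ y, RMod.lin (RMod.tmap e.hom e'.hom) y = x :=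
      ⟨RMod.lin (RMod.tmap e.inv e'.inv) x, by
        rw [← LinearMap.comp_apply, ← RMod.lin_comp, RMod.tmap_comp, e.inv_hom_id, e'.inv_hom_id,
          RMod.tmap_id]
        rfl⟩
    have h1 := congrArg (fun f => TensorProduct.map
      (RMod.fromTw (strict S).toWeakAction g W) LinearMap.id (RMod.incl _ _ (RMod.lin f y))) hb
    simp only [RMod.lin_comp, LinearMap.comp_apply] at h1
    refine h1.trans ?_
    rw [RMod.incl_tmap, RMod.incl_tmap, ← RMod.map_act₂]
    have h2 (z : RMod.twist (strict S).toWeakAction g (strictObj S (corner S W)) ⊗[K]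
        strictObj S (corner S V)) :
        TensorProduct.map (RMod.fromTw (strict S).toWeakAction g W) LinearMap.id
          (TensorProduct.map (RMod.lin (RMod.twistMap (strict S).toWeakAction g e'.hom))
            (RMod.lin e.hom) z) =
        TensorProduct.map (RMod.lin e'.hom) (RMod.lin e.hom)
          (TensorProduct.map (RMod.fromTw (strict S).toWeakAction g _) LinearMap.id z) := by
      induction z using TensorProduct.induction_on with
      | zero => simp
      | add a b ha hb => simp only [map_add, ha, hb]
      | tmul n m => rfl
    rw [h2, incl_imageBraidHom, TensorProduct.map_comm]
  twist := strictTwist rib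
  twist_apply {g V} hV v := by
    let e := cornerIso S V
    have hM : S.deg g (corner S V) :=
      deg_of_strict_deg S (((strict S).deg_iso g).of_iso e.symm hV)
    have ht : e.hom ≫ strictTwistHom rib hV =
        (strictMap S (twistHom rib hM) ≫ (strictPsi S g _).hom) ≫
          RMod.twistMap (strict S).toWeakAction g e.hom :=
      transportTwistIso_natural (strictPsiIso S) rib.twist (fun _ _ => deg_of_strict_deg S) hM hV
        e.hom
    obtain ⟨x, rfl⟩ : ∃ x, RMod.lin e.hom x = v := ⟨_, RMod.lin_inv_hom_apply e v⟩
    rw [← RMod.lin_act]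
    have h1 := congrArg (fun f => RMod.fromTw (strict S).toWeakAction g V (RMod.lin f x)) ht
    simp only [RMod.lin_comp, LinearMap.comp_apply] at h1
    refine h1.trans ?_
    rw [RMod.fromTw_twistMap]
    congr 1
    clear h1
    induction x using strictObj_induction with
    | zero => simp
    | add x x' h h' => simp only [map_add, h, h']
    | mk k m =>
    rw [strictMap_mk, fromTw_strictPsi, fromTw_twistHom, θ_equivariant rib k hM]
    exact (act_strictThetaInv S hM _ k m).symm

end StrictRibbon

/-! ### Dual pairs in abstract tensor categories -/

section AbstractDuals

universe v₁ v₂ u₁ u₂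

open Functor.LaxMonoidal Functor.OplaxMonoidal

variable {C : Type u₁} [Category.{v₁} C] [MonoidalCategory C]

section MapExactPairing

variable {D : Type u₂} [Category.{v₂} D] [MonoidalCategory D]

/-- A tensor functor preserves dual pairs. -/
@[reducible]
def mapExactPairing (F : C ⥤ D) [F.Monoidal] (X Y : C) [ExactPairing X Y] :
    ExactPairing (F.obj X) (F.obj Y) where
  coevaluation' := ε F ≫ F.map (η_ X Y) ≫ δ F X Y
  evaluation' := μ F Y X ≫ F.map (ε_ X Y) ≫ η F
  coevaluation_evaluation' := by
    calc _ = F.obj Y ◁ ε F ≫ (μ F Y (𝟙_ C) ≫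
          F.map (Y ◁ η_ X Y ≫ (α_ Y X Y).inv ≫ ε_ X Y ▷ Y) ≫ δ F (𝟙_ C) Y) ≫
            η F ▷ F.obj Y := by
          simp only [Functor.map_comp, Functor.Monoidal.map_whiskerLeft,
            Functor.Monoidal.map_whiskerRight, Functor.Monoidal.map_associator_inv, Category.assoc,
            Functor.Monoidal.μ_δ_assoc, Functor.Monoidal.μ_δ, Category.comp_id,
            MonoidalCategory.whiskerLeft_comp, comp_whiskerRight]
      _ = _ := by
          rw [ExactPairing.coevaluation_evaluation X Y, F.map_comp,
            Functor.LaxMonoidal.right_unitality, Functor.OplaxMonoidal.left_unitality]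
          simp only [Category.assoc]
  evaluation_coevaluation' := by
    calc _ = ε F ▷ F.obj X ≫ (μ F (𝟙_ C) X ≫
          F.map (η_ X Y ▷ X ≫ (α_ X Y X).hom ≫ X ◁ ε_ X Y) ≫ δ F X (𝟙_ C)) ≫
            F.obj X ◁ η F := by
          simp only [Functor.map_comp, Functor.Monoidal.map_whiskerLeft,
            Functor.Monoidal.map_whiskerRight, Functor.Monoidal.map_associator, Category.assoc,
            Functor.Monoidal.μ_δ_assoc, Functor.Monoidal.μ_δ, Category.comp_id,
            MonoidalCategory.whiskerLeft_comp, comp_whiskerRight]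
      _ = _ := by
          rw [ExactPairing.evaluation_coevaluation X Y, F.map_comp,
            Functor.LaxMonoidal.left_unitality, Functor.OplaxMonoidal.right_unitality]
          simp only [Category.assoc]

end MapExactPairing

variable [Preadditive C] [MonoidalPreadditive C]

/-- An evaluation `X ⊗ L ⟶ 𝟙` vanishes on no nonzero subobject of `X`. -/
theorem eq_zero_of_whiskerRight_evaluation {L X U : C} [ExactPairing L X] (i : U ⟶ X)
    (h : i ▷ L ≫ ε_ L X = 0) : i = 0 := by
  have h1 : i ▷ 𝟙_ C ≫ X ◁ η_ L X ≫ (α_ X L X).inv ≫ ε_ L X ▷ X = 0 := by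
    rw [← whisker_exchange_assoc, associator_inv_naturality_left_assoc, ← comp_whiskerRight, h]
    simp
  rw [ExactPairing.coevaluation_evaluation] at h1
  have h2 := congrArg (fun f => (ρ_ U).inv ≫ f ≫ (λ_ X).hom) h1
  simpa using h2

/-- The morphism `X ⟶ Q` corresponding to a pairing `Z ⊗ X ⟶ 𝟙`, where `Q` is a left dual
of `Z`. -/
def ofPairing {Q Z X : C} [ExactPairing Q Z] (p : Z ⊗ X ⟶ 𝟙_ C) : X ⟶ Q :=
  tensorLeftHomEquiv X Q Z (𝟙_ C) p ≫ (ρ_ Q).hom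

/-- The kernel of the morphism given by a pairing is annihilated by the pairing. -/
theorem whiskerLeft_comp_eq_zero_of_comp_ofPairing {Q Z X U : C} [ExactPairing Q Z]
    (p : Z ⊗ X ⟶ 𝟙_ C) (i : U ⟶ X) (h : i ≫ ofPairing (Q := Q) (Z := Z) p = 0) : Z ◁ i ≫ p = 0 := by
  have h1 : i ≫ tensorLeftHomEquiv X Q Z (𝟙_ C) p = 0 := by
    rw [← cancel_mono (ρ_ Q).hom, Category.assoc, Limits.zero_comp]
    exact h
  have h2 := tensorLeftHomEquiv_symm_naturality (Y := Q) (Y' := Z) i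
    (tensorLeftHomEquiv X Q Z (𝟙_ C) p)
  rw [h1, Equiv.symm_apply_apply] at h2
  rw [← h2]
  simp [tensorLeftHomEquiv]

variable {K : Type*} {G : Type*} [Field K] [Group G] [Linear K C] [MonoidalLinear K C]

/-- The pairing `^g L ⊗ X ⟶ 𝟙` obtained from an evaluation `X ⊗ L ⟶ 𝟙` and the inverse braiding
vanishes on no nonzero subobject of `X`. -/
theorem GBraiding.eq_zero_of_whiskerLeft_evaluation {E : GEquivariantStructure K G C}
    (β : GBraiding E) {g : G} {L X U : C} [ExactPairing L X] (hX : E.deg g X) (hU : E.deg g U) (i : U ⟶ X)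
    (h : (E.act g).obj L ◁ i ≫ (β.braid hX L).inv ≫ ε_ L X = 0) : i = 0 := by
  refine eq_zero_of_whiskerRight_evaluation (L := L) i ?_
  have h1 : i ▷ L = (β.braid hU L).hom ≫ (E.act g).obj L ◁ i ≫ (β.braid hX L).inv := by
    rw [← Category.assoc, ← β.natural_left hU hX, Category.assoc, Iso.hom_inv_id, Category.comp_id]
  rw [h1]
  simp only [Category.assoc]
  rw [h, Limits.comp_zero]

end AbstractDuals

/-! ### Left duals of modules over a Hopf algebra -/

namespace RMod

section LeftDual

variable {K A : Type u} [Field K] [Ring A] [HopfAlgebra K A]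

theorem whiskerLeft_pr (U : RMod K A) {V W : RMod K A} (f : V ⟶ W) (u : U) (v : V) :
    lin (U ◁ f) (pr U V (u ⊗ₜ[K] v)) = pr U W (u ⊗ₜ[K] lin f v) :=
  incl_injective U W (by
    rw [incl_whiskerLeft, incl_pr_hopf, incl_pr_hopf, LinearMap.lTensor_tmul])

theorem whiskerRight_pr {U V : RMod K A} (f : U ⟶ V) (W : RMod K A) (u : U) (w : W) :
    lin (f ▷ W) (pr U W (u ⊗ₜ[K] w)) = pr V W (lin f u ⊗ₜ[K] w) :=
  incl_injective V W (by
    rw [incl_whiskerRight, incl_pr_hopf, incl_pr_hopf, LinearMap.rTensor_tmul])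

theorem associator_pr (U V W : RMod K A) (u : U) (v : V) (w : W) :
    lin (α_ U V W).hom (pr (tensor U V) W (pr U V (u ⊗ₜ[K] v) ⊗ₜ[K] w)) =
      pr U (tensor V W) (u ⊗ₜ[K] pr V W (v ⊗ₜ[K] w)) := by
  refine inclRight_injective U V W ((inclRight_assoc U V W _).trans ?_)
  rw [incl_pr_hopf, LinearMap.rTensor_tmul, incl_pr_hopf, inclRight, LinearMap.comp_apply,
    incl_pr_hopf, LinearMap.lTensor_tmul, incl_pr_hopf]
  rfl

theorem associator_inv_pr (U V W : RMod K A) (u : U) (v : V) (w : W) :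
    lin (α_ U V W).inv (pr U (tensor V W) (u ⊗ₜ[K] pr V W (v ⊗ₜ[K] w))) =
      pr (tensor U V) W (pr U V (u ⊗ₜ[K] v) ⊗ₜ[K] w) := by
  rw [← associator_pr]
  exact lin_hom_inv_apply (α_ U V W) _

theorem leftUnitor_pr (V : RMod K A) (z : unit K A) (v : V) :
    lin (λ_ V).hom (pr (unit K A) V (z ⊗ₜ[K] v)) = unitCounit z • v := by
  refine (congrArg (contractLeft unitCounit) (incl_pr_hopf (unit K A) V _)).trans ?_
  rw [contractLeft_tmul]

theorem rightUnitor_pr (V : RMod K A) (z : unit K A) (v : V) :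
    lin (ρ_ V).hom (pr V (unit K A) (v ⊗ₜ[K] z)) = unitCounit z • v := by
  refine (congrArg (contractRight unitCounit) (incl_pr_hopf V (unit K A) _)).trans ?_
  rw [contractRight_tmul]

theorem leftUnitor_inv_apply (V : RMod K A) (v : V) :
    lin (λ_ V).inv v = pr (unit K A) V (unitPr 1 ⊗ₜ[K] v) := rfl

theorem rightUnitor_inv_apply (V : RMod K A) (v : V) :
    lin (ρ_ V).inv v = pr V (unit K A) (v ⊗ₜ[K] unitPr 1) := rfl

theorem tensor_hom_ext {U V W : RMod K A} {f f' : tensor U V ⟶ W}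
    (h : ∀ u v, lin f (pr U V (u ⊗ₜ[K] v)) = lin f' (pr U V (u ⊗ₜ[K] v))) : f = f' := by
  have h1 : lin f ∘ₗ pr U V = lin f' ∘ₗ pr U V := TensorProduct.ext' h
  refine hom_ext fun x => ?_
  rw [← pr_incl U V x]
  exact LinearMap.congr_fun h1 _

theorem unit_act_unitPr_one (a : A) :
    (unit K A).act a (unitPr 1) = counit (R := K) a • unitPr 1 := by
  rw [act_unitPr, one_mul]
  exact unitIncl_injective (by
    rw [map_smul, unitIncl_unitPr, unitIncl_unitPr, counitalSource_hopf, counitalSource_one])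

theorem unitCounit_act_hopf (z : unit K A) (a : A) :
    unitCounit ((unit K A).act a z) = unitCounit z * counit (R := K) a := by
  rw [unitCounit_act, Bialgebra.counit_mul]
  rfl

/-- The dual space of a right module, with the right action `(f.a)(v) = f(v.S(a))`, where `S` is
the antipode. -/
def dual (V : RMod K A) : RMod K A where
  carrier := Module.Dual K V
  act :=
    { toFun := fun a => (V.act (HopfAlgebra.antipode K a)).dualMap
      map_add' := fun a b => by ext; simp
      map_smul' := fun r a => by ext; simp }
  act_one := by
    ext f v
    simp [act_one_apply]
  act_mul a b := by
    ext f v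
    simp [HopfAlgebra.antipode_mul_antidistrib, act_mul_apply]

variable (V : RMod K A)

/-- The application of elements of the dual module to elements of the module. -/
def dualEval : dual V →ₗ[K] V →ₗ[K] K := (LinearMap.id : Module.Dual K V →ₗ[K] Module.Dual K V)

theorem dual_ext {f f' : dual V} (h : ∀ v, dualEval V f v = dualEval V f' v) : f = f' :=
  LinearMap.ext (f := (show Module.Dual K V from f)) h

theorem dualEval_act (a : A) (f : dual V) (v : V) :
    dualEval V ((dual V).act a f) v = dualEval V f (V.act (HopfAlgebra.antipode K a) v) := rfl

theorem finrank_dual : Module.finrank K (dual V) = Module.finrank K V :=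
  Subspace.dual_finrank_eq

/-- The linear form `v ⊗ f ↦ f(v)` on `V ⊗ V^*`. -/
def dualPairing : V ⊗[K] dual V →ₗ[K] K := TensorProduct.lift (dualEval V).flip

theorem dualPairing_tmul (v : V) (f : dual V) : dualPairing V (v ⊗ₜ[K] f) = dualEval V f v := rfl

theorem dualPairing_act₂ (T : A ⊗[K] A) (v : V) (f : dual V) :
    dualPairing V (act₂ V (dual V) T (v ⊗ₜ[K] f)) = dualEval V f
      (V.act (LinearMap.mul' K A ((HopfAlgebra.antipode K).lTensor A T)) v) := by
  induction T using TensorProduct.induction_on with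
  | zero => simp
  | add S T h h' => simp only [map_add, LinearMap.add_apply, h, h']
  | tmul a b =>
    rw [act₂_tmul, TensorProduct.map_tmul, dualPairing_tmul, dualEval_act, LinearMap.lTensor_tmul,
      LinearMap.mul'_apply, act_mul_apply]

theorem dualPairing_comul (a : A) (x : V ⊗[K] dual V) :
    dualPairing V (act₂ V (dual V) (comul (R := K) a) x) =
      counit (R := K) a * dualPairing V x := by
  induction x using TensorProduct.induction_on with
  | zero => simp
  | add S T h h' => simp only [map_add, h, h', mul_add]
  | tmul v f =>
    rw [dualPairing_act₂, HopfAlgebra.mul_antipode_lTensor_comul_apply,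
      Algebra.algebraMap_eq_smul_one, map_smul, LinearMap.smul_apply, act_one_apply, map_smul,
      dualPairing_tmul, smul_eq_mul]

/-- The evaluation `V ⊗ V^* → 𝟙`. -/
def dualEvaluation : tensor V (dual V) ⟶ unit K A :=
  ofLin (LinearMap.toSpanSingleton K (unit K A) (unitPr 1) ∘ₗ dualPairing V ∘ₗ incl V (dual V))
    fun a x => by
      simp only [LinearMap.comp_apply, LinearMap.toSpanSingleton_apply]
      rw [incl_act, dualPairing_comul, map_smul, unit_act_unitPr_one, smul_smul, mul_comm]

theorem dualEvaluation_pr (v : V) (f : dual V) :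
    lin (dualEvaluation V) (pr V (dual V) (v ⊗ₜ[K] f)) = dualEval V f v • unitPr 1 := by
  change dualPairing V (incl V (dual V) (pr V (dual V) (v ⊗ₜ[K] f))) • unitPr 1 = _
  rw [incl_pr_hopf, dualPairing_tmul]

/-- The linear map `V^* ⊗ V → End(V)`, `f ⊗ w ↦ (v ↦ f(v) w)`. -/
def dualHom : dual V ⊗[K] V →ₗ[K] V →ₗ[K] V := dualTensorHom K V V

theorem dualHom_tmul (f : dual V) (w v : V) : dualHom V (f ⊗ₜ[K] w) v = dualEval V f v • w := rfl

theorem dualHom_injective : Function.Injective (dualHom V) :=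
  (dualTensorHom_bijective (R := K) (M := V) (N := V)).1

/-- The elements `bⁱ` of the basis of `V^*` dual to a fixed basis `(bᵢ)` of `V`. -/
def dualCoord (i : Fin (Module.finrank K V)) : dual V := (Module.finBasis K V).coord i

theorem sum_dualEval_smul (v : V) :
    ∑ i, dualEval V (dualCoord V i) v • Module.finBasis K V i = v :=
  (Module.finBasis K V).sum_repr v

theorem sum_smul_dualCoord (f : dual V) :
    ∑ i, dualEval V f (Module.finBasis K V i) • dualCoord V i = f :=
  (Module.finBasis K V).sum_dual_apply_smul_coord f

/-- The element `∑ bⁱ ⊗ bᵢ` of `V^* ⊗ V` for a basis `(bᵢ)` of `V`. -/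
def dualCanonical : dual V ⊗[K] V := ∑ i, dualCoord V i ⊗ₜ[K] Module.finBasis K V i

/-- The canonical element is invariant: under `V^* ⊗ V ≅ End(V)` it corresponds to the identity and
`(f.a₁) ⊗ (v.a₂)` to the composition with the action of `S(a₁) a₂`. -/
theorem act₂_dualCanonical (a : A) :
    act₂ (dual V) V (comul (R := K) a) (dualCanonical V) =
      counit (R := K) a • dualCanonical V := by
  have key (T : A ⊗[K] A) : dualHom V (act₂ (dual V) V T (dualCanonical V)) =
      V.act (LinearMap.mul' K A ((HopfAlgebra.antipode K).rTensor A T)) := by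
    induction T using TensorProduct.induction_on with
    | zero => simp
    | add S T h h' => simp only [map_add, LinearMap.add_apply, h, h']
    | tmul a b =>
      refine LinearMap.ext fun v => ?_
      rw [dualCanonical, map_sum, map_sum, LinearMap.sum_apply]
      simp only [act₂_tmul, TensorProduct.map_tmul, dualHom_tmul, dualEval_act,
        LinearMap.rTensor_tmul, LinearMap.mul'_apply]
      simp only [← map_smul]
      rw [← map_sum, sum_dualEval_smul, act_mul_apply]
  refine dualHom_injective V ?_
  have h1 := key 1
  rw [Algebra.TensorProduct.one_def, act₂_tmul, act_one, act_one, TensorProduct.map_id,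
    LinearMap.id_apply, LinearMap.rTensor_tmul, LinearMap.mul'_apply, HopfAlgebra.antipode_one,
    mul_one, act_one] at h1
  rw [key, HopfAlgebra.mul_antipode_rTensor_comul_apply, map_smul, h1,
    Algebra.algebraMap_eq_smul_one, map_smul, act_one]

/-- The coevaluation `𝟙 → V^* ⊗ V`. -/
def dualCoevaluation : unit K A ⟶ tensor (dual V) V :=
  ofLin (LinearMap.toSpanSingleton K _ (pr (dual V) V (dualCanonical V)) ∘ₗ unitCounit)
    fun a z => by
      simp only [LinearMap.comp_apply, LinearMap.toSpanSingleton_apply]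
      rw [unitCounit_act_hopf, map_smul, ← pr_act₂, act₂_dualCanonical, map_smul, smul_smul]

theorem dualCoevaluation_apply (z : unit K A) : lin (dualCoevaluation V) z =
    ∑ i, unitCounit z • pr (dual V) V (dualCoord V i ⊗ₜ[K] Module.finBasis K V i) := by
  change unitCounit z • pr (dual V) V (dualCanonical V) = _
  rw [dualCanonical, map_sum, Finset.smul_sum]

theorem dual_zigzag_left :
    V ◁ dualCoevaluation V ≫ (α_ V (dual V) V).inv ≫ dualEvaluation V ▷ V =
      (ρ_ V).hom ≫ (λ_ V).inv := by
  refine tensor_hom_ext fun v z => ?_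
  simp only [lin_comp, LinearMap.comp_apply]
  rw [rightUnitor_pr, leftUnitor_inv_apply]
  refine (congrArg (fun x => lin (dualEvaluation V ▷ V) (lin (α_ V (dual V) V).inv x))
    (whiskerLeft_pr V (dualCoevaluation V) v z)).trans ?_
  rw [dualCoevaluation_apply, TensorProduct.tmul_sum]
  simp only [TensorProduct.tmul_smul, map_sum, map_smul]
  conv_rhs => rw [← sum_dualEval_smul V v, TensorProduct.tmul_sum, map_sum]
  rw [Finset.smul_sum]
  refine Finset.sum_congr rfl fun i _ => congrArg _ ?_
  refine (congrArg (lin (dualEvaluation V ▷ V)) (associator_inv_pr _ _ _ _ _ _)).trans ?_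
  refine (whiskerRight_pr _ _ _ _).trans ?_
  rw [dualEvaluation_pr, TensorProduct.smul_tmul]

theorem dual_zigzag_right :
    dualCoevaluation V ▷ dual V ≫ (α_ (dual V) V (dual V)).hom ≫ dual V ◁ dualEvaluation V =
      (λ_ (dual V)).hom ≫ (ρ_ (dual V)).inv := by
  refine tensor_hom_ext fun z f => ?_
  simp only [lin_comp, LinearMap.comp_apply]
  rw [leftUnitor_pr, rightUnitor_inv_apply]
  refine (congrArg (fun x => lin (dual V ◁ dualEvaluation V) (lin (α_ (dual V) V (dual V)).hom x))
    (whiskerRight_pr (dualCoevaluation V) (dual V) z f)).trans ?_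
  rw [dualCoevaluation_apply, TensorProduct.sum_tmul]
  simp only [← TensorProduct.smul_tmul', map_sum, map_smul]
  conv_rhs => rw [← sum_smul_dualCoord V f, TensorProduct.sum_tmul, map_sum, Finset.smul_sum]
  refine Finset.sum_congr rfl fun i _ => ?_
  refine congrArg (unitCounit z • ·) ?_
  refine (congrArg (lin (dual V ◁ dualEvaluation V)) (associator_pr _ _ _ _ _ _)).trans ?_
  refine (whiskerLeft_pr _ _ _ _).trans ?_
  rw [dualEvaluation_pr, TensorProduct.tmul_smul, TensorProduct.smul_tmul']

/-- The dual module is a left dual: `V^* ⊗ V` receives the coevaluation, and the evaluation is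
defined on `V ⊗ V^*`. -/
instance dualExactPairing : ExactPairing (dual V) V where
  coevaluation' := dualCoevaluation V
  evaluation' := dualEvaluation V
  coevaluation_evaluation' := dual_zigzag_left V
  evaluation_coevaluation' := dual_zigzag_right V

end LeftDual

end RMod

/-! ### Right duals of modules over a `G`-ribbon algebra -/

namespace RMod

section KerPi

variable {K H : Type u} [Field K] [Ring H] [Algebra K H]

/-- The kernel of a homomorphism. -/
def ker {V W : RMod K H} (f : V ⟶ W) : RMod K H where
  carrier := LinearMap.ker (lin f)
  act :=
    { toFun := fun a => (V.act a).restrict fun v hv => by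
        rw [LinearMap.mem_ker, lin_act, LinearMap.mem_ker.1 hv, map_zero]
      map_add' := fun a b => by ext; simp
      map_smul' := fun r a => by ext; simp }
  act_one := by
    ext v
    simp [act_one_apply]
  act_mul a b := by
    ext v
    simp [act_mul_apply]

/-- The inclusion of the kernel. -/
def kerι {V W : RMod K H} (f : V ⟶ W) : ker f ⟶ V :=
  ofLin (LinearMap.ker (lin f)).subtype fun _ _ => rfl

theorem kerι_comp {V W : RMod K H} (f : V ⟶ W) : kerι f ≫ f = 0 := hom_ext Subtype.property

theorem injective_of_kerι {V W : RMod K H} (f : V ⟶ W) (h : kerι f = 0) :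
    Function.Injective (lin f) := by
  rw [← LinearMap.ker_eq_bot, LinearMap.ker_eq_bot']
  intro v hv
  have h1 : lin (kerι f) ⟨v, hv⟩ = 0 := by
    rw [h]
    rfl
  exact h1

/-- The product of a finite family of modules. -/
def pi {ι : Type u} [Finite ι] (Z : ι → RMod K H) : RMod K H where
  carrier := ∀ i, Z i
  act :=
    { toFun := fun a => LinearMap.pi fun i => (Z i).act a ∘ₗ LinearMap.proj i
      map_add' := fun a b => by
        refine LinearMap.ext fun z => funext fun i => ?_
        simp
      map_smul' := fun r a => by
        refine LinearMap.ext fun z => funext fun i => ?_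
        simp }
  act_one := by
    refine LinearMap.ext fun z => funext fun i => ?_
    exact act_one_apply (Z i) (z i)
  act_mul a b := by
    refine LinearMap.ext fun z => funext fun i => ?_
    exact act_mul_apply (Z i) a b (z i)

/-- The coordinates of the product. -/
def piProj {ι : Type u} [Finite ι] (Z : ι → RMod K H) (i : ι) : pi Z →ₗ[K] Z i :=
  (LinearMap.proj i : (∀ i, Z i) →ₗ[K] Z i)

theorem piProj_act {ι : Type u} [Finite ι] (Z : ι → RMod K H) (i : ι) (a : H) (z : pi Z) :
    piProj Z i ((pi Z).act a z) = (Z i).act a (piProj Z i z) := rfl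

open Classical in
/-- The inclusions into the product. -/
def piSingle {ι : Type u} [Finite ι] (Z : ι → RMod K H) (i : ι) : Z i →ₗ[K] pi Z :=
  (LinearMap.single K (fun i => Z i) i : Z i →ₗ[K] ∀ i, Z i)

theorem piProj_piSingle_same {ι : Type u} [Finite ι] (Z : ι → RMod K H) (i : ι) (z : Z i) :
    piProj Z i (piSingle Z i z) = z := by
  classical exact Pi.single_eq_same (M := fun i => Z i) i z

theorem piProj_piSingle_ne {ι : Type u} [Finite ι] (Z : ι → RMod K H) {i j : ι} (h : j ≠ i)
    (z : Z i) : piProj Z j (piSingle Z i z) = 0 := by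
  classical exact Pi.single_eq_of_ne (M := fun i => Z i) h z

theorem sum_piSingle {ι : Type u} [Fintype ι] (Z : ι → RMod K H) (z : pi Z) :
    ∑ i, piSingle Z i (piProj Z i z) = z := by
  classical exact Finset.univ_sum_single (M := fun i => Z i) z

end KerPi

end RMod

section RightDual

variable {K G A : Type u} [Field K] [Group G] [Fintype G] [Ring A] [HopfAlgebra K A]
  {S : GWeakHopf K G A}

/-- A module `X` of degree `g` is the dual of `^g(X^*)`. -/
theorem exists_iso_dual_of_deg (rib : GRibbonAlgebra S) {g : G} {X : RMod K A} (hX : S.deg g X) :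
    ∃ Z : RMod K A, Nonempty (X ≅ RMod.dual Z) := by
  let L := RMod.dual X
  let Z : RMod K A := (S.equivariant.act g).obj L
  let p : Z ⊗ X ⟶ 𝟙_ (RMod K A) := (rib.braiding.braid hX L).inv ≫ ε_ L X
  let j : X ⟶ RMod.dual Z := ofPairing p
  -- a submodule of a module of degree `g` has degree `g`, so the braiding is natural for it
  have hU : S.deg g (RMod.ker j) := fun h hh a ha v => Subtype.ext (hX h hh a ha v.1)
  have hj : Function.Injective (RMod.lin j) := RMod.injective_of_kerι j
    (rib.braiding.eq_zero_of_whiskerLeft_evaluation (L := L) hX hU _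
      (whiskerLeft_comp_eq_zero_of_comp_ofPairing p _ (RMod.kerι_comp j)))
  have hd : Module.finrank K X = Module.finrank K (RMod.dual Z) := by
    rw [RMod.finrank_dual]
    exact (RMod.finrank_dual X).symm
  have := RMod.isIso_of_bijective j
    ⟨hj, (LinearMap.injective_iff_surjective_of_finrank_eq_finrank hd).1 hj⟩
  exact ⟨Z, ⟨asIso j⟩⟩

theorem componentι_componentπ (X : RMod K A) (g : G) (x : S.component X g) :
    RMod.lin (S.componentπ X g) (RMod.lin (S.componentι X g) x) = x := by
  obtain ⟨_, x, rfl⟩ := x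
  refine Subtype.ext ?_
  change X.act (S.gunit g) (X.act (S.gunit g) x) = X.act (S.gunit g) x
  rw [← RMod.act_mul_apply, S.gunit_mul (S.gunit_mem g)]

theorem componentι_componentπ_ne (X : RMod K A) {g h : G} (hgh : g ≠ h) (x : S.component X g) :
    RMod.lin (S.componentπ X h) (RMod.lin (S.componentι X g) x) = 0 := by
  rw [← LinearMap.comp_apply, ← RMod.lin_comp,
    S.deg_hom hgh (S.deg_component X g) (S.deg_component X h) (S.componentι X g ≫ S.componentπ X h)]
  rfl

theorem sum_componentπ_componentι (X : RMod K A) (x : X) :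
    ∑ g, RMod.lin (S.componentι X g) (RMod.lin (S.componentπ X g) x) = x := by
  change ∑ g, X.act (S.gunit g) x = x
  rw [← LinearMap.sum_apply, ← map_sum, sum_gunit_univ, RMod.act_one_apply]

/-- If the components of a module are duals, then so is the module. -/
theorem exists_iso_dual_of_components (X : RMod K A)
    (h : ∀ g, ∃ Z : RMod K A, Nonempty (S.component X g ≅ RMod.dual Z)) :
    ∃ Z : RMod K A, Nonempty (X ≅ RMod.dual Z) := by
  choose Z e using h
  let e' (g : G) : S.component X g ≅ RMod.dual (Z g) := (e g).some
  let b (g : G) : X →ₗ[K] Z g →ₗ[K] K :=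
    RMod.dualEval (Z g) ∘ₗ RMod.lin (e' g).hom ∘ₗ RMod.lin (S.componentπ X g)
  have hb (g : G) (a : A) (x : X) (z : Z g) :
      b g (X.act a x) z = b g x ((Z g).act (HopfAlgebra.antipode K a) z) := by
    simp only [b, LinearMap.comp_apply, RMod.lin_act, RMod.dualEval_act]
  -- the homomorphism `x ↦ (z ↦ ∑_g e_g(x_g)(z_g))`
  let J : X →ₗ[K] (RMod.pi Z →ₗ[K] K) := ∑ g, (RMod.piProj Z g).dualMap ∘ₗ b g
  have hJ (x : X) (z : RMod.pi Z) : J x z = ∑ g, b g x (RMod.piProj Z g z) := by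
    simp [J]
  have hJs (x : X) (g : G) (z : Z g) : J x (RMod.piSingle Z g z) = b g x z := by
    rw [hJ, Finset.sum_eq_single g, RMod.piProj_piSingle_same]
    · intro h _ hh
      rw [RMod.piProj_piSingle_ne Z hh, map_zero]
    · simp
  let j : X ⟶ RMod.dual (RMod.pi Z) := RMod.ofLin J fun a x => LinearMap.ext fun z => by
    change J (X.act a x) z = J x ((RMod.pi Z).act (HopfAlgebra.antipode K a) z)
    simp only [hJ, hb, RMod.piProj_act]
  have hi : Function.Injective (RMod.lin j) := by
    rw [← LinearMap.ker_eq_bot, LinearMap.ker_eq_bot']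
    intro x hx
    rw [← sum_componentπ_componentι (S := S) X x]
    refine Finset.sum_eq_zero fun g _ => ?_
    have h1 : RMod.lin (e' g).hom (RMod.lin (S.componentπ X g) x) = 0 :=
      RMod.dual_ext _ fun z => by
        refine (hJs x g z).symm.trans ?_
        rw [show J x = 0 from hx]
        simp
    rw [← RMod.lin_hom_inv_apply (e' g) (RMod.lin (S.componentπ X g) x), h1, map_zero, map_zero]
  have hs : Function.Surjective (RMod.lin j) := fun (f : RMod.pi Z →ₗ[K] K) => by
    let f' (g : G) : RMod.dual (Z g) := f ∘ₗ RMod.piSingle Z g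
    let x : X := ∑ g, RMod.lin (S.componentι X g) (RMod.lin (e' g).inv (f' g))
    refine ⟨x, LinearMap.ext fun z => ?_⟩
    change J x z = f z
    have hx (g : G) : b g x = f ∘ₗ RMod.piSingle Z g := by
      simp only [b, LinearMap.comp_apply, x, map_sum]
      rw [Finset.sum_eq_single g, componentι_componentπ, RMod.lin_inv_hom_apply]
      · rfl
      · intro h _ hh
        rw [componentι_componentπ_ne X hh, map_zero, map_zero]
      · simp
    rw [hJ, ← RMod.sum_piSingle Z z, map_sum]
    simp only [hx, RMod.sum_piSingle]
    rfl
  have := RMod.isIso_of_bijective j ⟨hi, hs⟩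
  exact ⟨RMod.pi Z, ⟨asIso j⟩⟩

/-- The category of modules over a `G`-ribbon algebra has left and right duals. -/
theorem hasDuals_hopf (rib : GRibbonAlgebra S) : HasDuals (RMod K A) := fun X => by
  obtain ⟨Z, ⟨e⟩⟩ := exists_iso_dual_of_components X
    fun g => exists_iso_dual_of_deg rib (S.deg_component X g)
  exact ⟨⟨RMod.dual X, ⟨inferInstance⟩⟩, ⟨Z, ⟨exactPairingCongrLeft e⟩⟩⟩

end RightDual

/-! ### The equivalence of `G`-ribbon categories -/

section Equivalence

variable {K G A : Type u} [Field K] [Group G] [Fintype G] [Ring A] [HopfAlgebra K A]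
  {S : GWeakHopf K G A} (rib : GRibbonAlgebra S)

/-- `F` is an equivalence of `G`-ribbon categories. -/
def strictRibbonEquivalence (hA : HasDuals (RMod K A)) (hStr : HasDuals (RMod K (Strict S))) :
    GRibbonEquivalence (rib.ribbonStructure hA) ((strictRibbon rib).ribbonStructure hStr)
      (strictFunctor S) where
  additive := inferInstance
  linear := inferInstance
  monoidal := strictFunctorMonoidal S
  ψ := strictPsiIso S
  ψ_isMonoidal := inferInstance
  ψ_comp := strictPsiIso_comp S
  map_deg hM := strict_deg_obj S hM
  isEquivalence := inferInstance
  map_braid {g M} hM N := by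
    have h1 := imageBraid_hom_comp_μ (strictPsiIso S) rib.braiding hM N
    rw [← transportBraid_obj (strictPsiIso S) rib.braiding (fun _ _ => deg_of_strict_deg S) hM
      (strict_deg_obj S hM)] at h1
    exact h1.symm
  map_twist {g M} hM :=
    (transportTwistIso_obj (strictPsiIso S) rib.twist (fun _ _ => deg_of_strict_deg S) hM
      (strict_deg_obj S hM)).symm

/-- Duals in `A^str-mod` are the images of duals in `A-mod` under the equivalence `F`. -/
theorem hasDuals_strict (hA : HasDuals (RMod K A)) : HasDuals (RMod K (Strict S)) := fun V => by
  let e : (strictFunctor S).obj (corner S V) ≅ V := cornerIso S V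
  obtain ⟨⟨Y, ⟨h⟩⟩, ⟨Z, ⟨h'⟩⟩⟩ := hA (corner S V)
  let p := mapExactPairing (strictFunctor S) Y (corner S V)
  let p' := mapExactPairing (strictFunctor S) (corner S V) Z
  exact ⟨⟨_, ⟨exactPairingCongrRight (X := (strictFunctor S).obj Y) e.symm⟩⟩,
    ⟨_, ⟨exactPairingCongrLeft (Y := (strictFunctor S).obj Z) e.symm⟩⟩⟩

end Equivalence

end

end GHopf

theorem mainTheorem3 {K G A : Type u} [Field K] [Group G] [Fintype G] [Ring A] [HopfAlgebra K A]
    (S : GHopf.GWeakHopf K G A) (rib : GHopf.GRibbonAlgebra S) :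
    ∃ (ribStr : GHopf.GRibbonAlgebra (GHopf.strict S))
      (hA : GHopf.HasDuals (GHopf.RMod K A))
      (hStr : GHopf.HasDuals (GHopf.RMod K (GHopf.Strict S)))
      (E : GHopf.GRibbonEquivalence (rib.ribbonStructure hA) (ribStr.ribbonStructure hStr)
        (GHopf.strictFunctor S)),
      (∀ (z : (𝟙_ (GHopf.RMod K A) : GHopf.RMod K A)) (k : G),
        GHopf.RMod.unitIncl (GHopf.RMod.lin E.monoidal.toOplaxMonoidal.η
          (GHopf.strictObjMk S (𝟙_ (GHopf.RMod K A)) z k)) =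
            GHopf.Strict.of S k 1 (GHopf.RMod.unitIncl z)) ∧
      (∀ (M N : GHopf.RMod K A) (m : M) (n : N) (k : G),
        GHopf.RMod.lin (E.monoidal.toLaxMonoidal.μ M N)
          (GHopf.RMod.pr (GHopf.strictObj S M) (GHopf.strictObj S N)
            (GHopf.strictObjMk S M m k ⊗ₜ[K] GHopf.strictObjMk S N n k)) =
          GHopf.strictObjMk S (M ⊗ N) (GHopf.RMod.pr M N (m ⊗ₜ[K] n)) k) ∧
      (∀ (g : G) (M : GHopf.RMod K A) (m : M) (k : G),
        GHopf.RMod.fromTw (GHopf.strict S).toWeakAction g (GHopf.strictObj S M)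
          (GHopf.RMod.lin ((E.ψ g).hom.app M)
            (GHopf.strictObjMk S (GHopf.RMod.twist S.toWeakAction g M)
              (GHopf.RMod.toTw S.toWeakAction g M m) k)) =
          GHopf.strictObjMk S M (M.act (S.c g⁻¹ k : A) m) (g⁻¹ * k)) :=
  ⟨GHopf.strictRibbon rib, GHopf.hasDuals_hopf rib, GHopf.hasDuals_strict (GHopf.hasDuals_hopf rib),
    GHopf.strictRibbonEquivalence rib _ _,
    fun z k => GHopf.unitIncl_strictEta S k z,
    fun M N m n k => GHopf.strictFunctor_μ_diag S M N k (m ⊗ₜ n),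
    fun g M m k => GHopf.fromTw_strictPsi S g M k _⟩
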